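/- Let $K=\mathbb Q(q,t)$, let $\mathrm{Sym}[X]$ be the ring of symmetric functions over $K$ with power sums $p_n$, and put $V_k=\mathrm{Sym}[X]\otimes K[y_1,\dots,y_k]$, $V_*=\bigoplus_{k\ge 0}V_k$. For $F\in V_k$ and a variable $y$ among $y_1,y_2,\dots$, $F[X\pm(q-1)y;\dots]$ is the plethystic substitution $p_n\mapsto p_n\pm(q^n-1)y^n$, and $\mathrm{Exp}[-y^{-1}X]=\exp\bigl(-\sum_{n\ge1}p_n y^{-n}/n\bigr)$. Operators are composed from right to left. **Algebras.** For a parameter $u$ (here $u=q$ or $u=q^{-1}$), $\mathbb A_u$ is the path algebra over $\mathbb Q(q)$ of the quiver with vertices $k\in\mathbb Z_{\ge0}$, arrows $d_+:k\to k+1$, $d_-:k+1\to k$ and loops $T_1,\dots,T_{k-1}$ at $k$, with idempotents $e_k$, modulo the relations (where $k$ is the vertex at which the paths begin) $$(T_i-1)(T_i+u)=0,\quad T_iT_{i+1}T_i=T_{i+1}T_iT_{i+1},\quad T_iT_j=T_jT_i\ (|i-j|>1),$$ $$d_-^2T_{k-1}=d_-^2\ (k\ge 2),\qquad T_id_-=d_-T_i\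 (1\le i\le k-2),$$ $$T_1d_+^2=d_+^2,\qquad d_+T_i=T_{i+1}d_+\ (1\le i\le k-1),$$ $$d_-(d_+d_--d_-d_+)T_{k-1}=u(d_+d_--d_-d_+)d_-\ (k\ge2),\qquad T_1(d_+d_--d_-d_+)d_+=u\,d_+(d_+d_--d_-d_+)\ (k\ge1).$$ In $\mathbb A_u$ define loops at $k\ge1$ by $y_1=\frac1{u^{k-1}(u-1)}(d_+d_--d_-d_+)T_{k-1}\cdots T_1$ and $y_{i+1}=u\,T_i^{-1}y_iT_i^{-1}$ for $1\le i\le k-1$. All actions on $V_*$ are by $K$-linear operators and such that $e_k$ acts as the projection to $V_k$. **Operators.** For $F\in V_k$ put $$T_iF=\frac{(q-1)y_iF+(y_{i+1}-qy_i)\,\mathrm{swap}_{y_i\leftrightarrow y_{i+1}}F}{y_{i+1}-y_i}\quad(1\le i\le k-1),$$ $$d_-F=\text{the coefficient of }y_k^0\text{ in }F[X-(q-1)y_k;y_1,\dots,y_k]\,\mathrm{Exp}[-y_k^{-1}X]\ \in V_{k-1}\quad(k\ge1),$$ $$d_+F=-T_1T_2\cdots T_k\bigl(y_{k+1}F[X+(q-1)y_{k+1};y_1,\dots,y_k]\bigr)\in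 V_{k+1},$$ $$d_+^*F=\gamma\bigl(F[X+(q-1)y_{k+1};y_1,\dots,y_k]\bigr)\in V_{k+1},$$ where $\gamma$ fixes $\mathrm{Sym}[X]$ and sends $y_i\mapsto y_{i+1}$ for $i<k+1$ and $y_{k+1}\mapsto ty_1$. **Statement.** 1. The operators $T_i,d_-,d_+$ define a (unique) action $\rho$ of $\mathbb A_q$ on $V_*$; moreover $\rho(y_i)$ is multiplication by $y_i$ on $V_k$ for $1\le i\le k$. 2. The operators $T_i$ are invertible, and $T_i^{-1},d_-,d_+^*$ define a (unique) action $\rho^*$ of $\mathbb A_{q^{-1}}$ on $V_*$. 3. $\rho$ and $\rho^*$ are correctly intertwined: $\rho^*(T_i)=\rho(T_i)^{-1}$ on $V_k$ for $1\le i\le k-1$, $\rho^*(d_-)=\rho(d_-)$, and, writing $y_i=\rho(y_i)$, $z_i=\rho^*(y_i)$, for all $k\ge0$ one has on $V_k$ $$d_+z_i=z_{i+1}d_+,\quad d_+^*y_i=y_{i+1}d_+^*\quad(1\le i\le k),\qquad z_1d_+=-tq^{k+1}y_1d_+^*.$$ 4. Let $\mathbb A_{q,t}$ be the path algebra over $K$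 of the quiver with the arrows of $\mathbb A_q$ and additional arrows $d_+^*:k\to k+1$, modulo the relations of $\mathbb A_q$ for $T_i,d_-,d_+$, the relations of $\mathbb A_{q^{-1}}$ for $T_i^{-1},d_-,d_+^*$, and the relations displayed in 3 (where $y_i$ and $z_i$ are formed from $T_i,d_-,d_+$ with parameter $q$, respectively from $T_i^{-1},d_-,d_+^*$ with parameter $q^{-1}$). Then $T_i,d_-,d_+,d_+^*$ define a (unique) action of $\mathbb A_{q,t}$ on $V_*$. -/

import Mathlib

noncomputable section

namespace DyckAlgebra

/-! ## Path algebras of quivers and their quotients by relations -/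

section PathAlgebra

/-- The path algebra of a quiver `Q` over `R`: formal `R`-linear combinations of paths of `Q`
(the path of length zero at a vertex being the idempotent of that vertex). It has no unit when `Q`
has infinitely many vertices. -/
def PathAlgebra (R : Type) (Q : Type) [CommRing R] [Quiver.{0} Q] : Type :=
  (Σ a b : Q, Quiver.Path a b) →₀ R

variable {R : Type} {Q : Type} [CommRing R] [Quiver.{0} Q]

instance : AddCommGroup (PathAlgebra R Q) :=
  inferInstanceAs (AddCommGroup ((Σ a b : Q, Quiver.Path a b) →₀ R))

instance : Module R (PathAlgebra R Q) :=
  inferInstanceAs (Module R ((Σ a b : Q, Quiver.Path a b) →₀ R))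

namespace PathAlgebra

/-- The basis element of the path algebra given by a path. -/
def ofPath (R : Type) [CommRing R] {a b : Q} (p : Quiver.Path a b) : PathAlgebra R Q :=
  Finsupp.single ⟨a, b, p⟩ 1

open Classical in
/-- The product of two paths. Paths are composed like operators, from right to left: `x * y` is
the path that first follows `y` and then `x` if `y` ends where `x` begins, and zero otherwise. -/
def mulPath (R : Type) [CommRing R] (x y : Σ a b : Q, Quiver.Path a b) : PathAlgebra R Q :=
  if h : y.2.1 = x.1 then ofPath R (y.2.2.comp (x.2.2.cast h.symm rfl)) else 0

theorem induction {P : PathAlgebra R Q → Prop} (x : PathAlgebra R Q) (zero : P 0)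
    (add : ∀ x y, P x → P y → P (x + y))
    (smul : ∀ (r : R) (a b : Q) (p : Quiver.Path a b), P (r • ofPath R p)) : P x := by
  refine Finsupp.induction_linear x zero add fun p r => ?_
  have : (Finsupp.single p r : (Σ a b : Q, Quiver.Path a b) →₀ R)
      = r • Finsupp.single p (1 : R) := by rw [Finsupp.smul_single_one]
  rw [this]
  exact smul r p.1 p.2.1 p.2.2

/-- The linear extension of a function on paths. -/
def linLift {M : Type} [AddCommGroup M] [Module R M] (v : (Σ a b : Q, Quiver.Path a b) → M) :
    PathAlgebra R Q →ₗ[R] M :=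
  Finsupp.linearCombination R v

theorem linLift_ofPath {M : Type} [AddCommGroup M] [Module R M]
    (v : (Σ a b : Q, Quiver.Path a b) → M) {a b : Q} (p : Quiver.Path a b) :
    linLift v (ofPath R p) = v ⟨a, b, p⟩ :=
  (Finsupp.linearCombination_single R _ _).trans (one_smul R _)

/-- The bilinear extension of the product of paths. -/
def mulLin : PathAlgebra R Q →ₗ[R] PathAlgebra R Q →ₗ[R] PathAlgebra R Q :=
  linLift fun x => linLift fun y => mulPath R x y

theorem mulLin_ofPath {a b c d : Q} (x : Quiver.Path a b) (y : Quiver.Path c d) :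
    mulLin (ofPath R x) (ofPath R y) = mulPath R ⟨a, b, x⟩ ⟨c, d, y⟩ :=
  by rw [mulLin, linLift_ofPath, linLift_ofPath]

theorem mulPath_comp {a b c : Q} (x : Quiver.Path b c) (y : Quiver.Path a b) :
    mulPath R ⟨b, c, x⟩ ⟨a, b, y⟩ = ofPath R (y.comp x) := by
  simp [mulPath]

theorem mulPath_ne {a b c d : Q} (x : Quiver.Path a b) (y : Quiver.Path c d) (h : d ≠ a) :
    mulPath R ⟨a, b, x⟩ ⟨c, d, y⟩ = 0 := by
  simp [mulPath, h]

theorem mulLin_assoc (x y z : PathAlgebra R Q) :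
    mulLin (mulLin x y) z = mulLin x (mulLin y z) := by
  induction x using PathAlgebra.induction with
  | zero => simp only [map_zero, LinearMap.zero_apply]
  | add x x' hx hx' => rw [map_add, LinearMap.add_apply, map_add, LinearMap.add_apply,
      LinearMap.add_apply, hx, hx']
  | smul r a b x =>
  induction y using PathAlgebra.induction with
  | zero => simp only [map_zero, LinearMap.zero_apply]
  | add y y' hy hy' => simp only [map_add, LinearMap.add_apply, hy, hy']
  | smul s c d y =>
  induction z using PathAlgebra.induction with
  | zero => simp only [map_zero]
  | add z z' hz hz' => rw [map_add, map_add, map_add, hz, hz']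
  | smul t e f z =>
  have key : mulLin (mulLin (ofPath R x) (ofPath R y)) (ofPath R z)
      = mulLin (ofPath R x) (mulLin (ofPath R y) (ofPath R z)) := by
    simp only [mulLin_ofPath]
    by_cases h1 : d = a
    · subst h1
      by_cases h2 : f = c
      · subst h2
        simp only [mulPath_comp, mulLin_ofPath, Quiver.Path.comp_assoc]
      · simp only [mulPath_comp, mulLin_ofPath, mulPath_ne _ _ h2, map_zero]
    · by_cases h2 : f = c
      · subst h2
        simp only [mulPath_comp, mulLin_ofPath, mulPath_ne _ _ h1, map_zero, LinearMap.zero_apply]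
      · simp only [mulPath_ne _ _ h1, mulPath_ne _ _ h2, map_zero, LinearMap.zero_apply]
  simp only [map_smul, LinearMap.smul_apply, key]

instance : NonUnitalRing (PathAlgebra R Q) :=
  { (inferInstance : AddCommGroup (PathAlgebra R Q)) with
    mul := fun x y => mulLin x y
    left_distrib := fun x y z => map_add (mulLin x) y z
    right_distrib := fun x y z => by
      change mulLin (x + y) z = mulLin x z + mulLin y z
      rw [map_add, LinearMap.add_apply]
    zero_mul := fun x => by
      change mulLin 0 x = 0
      rw [map_zero, LinearMap.zero_apply]
    mul_zero := fun x => map_zero (mulLin x)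
    mul_assoc := mulLin_assoc }

theorem ofPath_mul_ofPath {a b c : Q} (x : Quiver.Path b c) (y : Quiver.Path a b) :
    ofPath R x * ofPath R y = ofPath R (y.comp x) :=
  (mulLin_ofPath x y).trans (mulPath_comp x y)

theorem ofPath_mul_ofPath_of_ne {a b c d : Q} (x : Quiver.Path a b) (y : Quiver.Path c d)
    (h : d ≠ a) : ofPath R x * ofPath R y = 0 :=
  (mulLin_ofPath x y).trans (mulPath_ne x y h)

instance : IsScalarTower R (PathAlgebra R Q) (PathAlgebra R Q) where
  smul_assoc r x y := by
    change mulLin (r • x) y = r • mulLin x y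
    rw [map_smul, LinearMap.smul_apply]

instance : SMulCommClass R (PathAlgebra R Q) (PathAlgebra R Q) where
  smul_comm r x y := (map_smul (mulLin x) r y).symm

end PathAlgebra

end PathAlgebra

section Quotient

variable {R B : Type} [CommRing R] [NonUnitalRing B] [Module R B]

/-- The smallest `R`-algebra congruence on a (non-unital) `R`-algebra `B` that contains the
relation `r`; equivalently, congruence modulo the two-sided ideal of the `R`-algebra `B`
generated by the differences `x - y` with `r x y`. -/
def algCon (R : Type) {B : Type} [CommRing R] [NonUnitalRing B] [Module R B]
    (r : B → B → Prop) : RingCon B :=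
  ringConGen fun x y => ∃ (c : R) (x' y' : B), r x' y' ∧ x = c • x' ∧ y = c • y'

theorem algCon_smul [IsScalarTower R B B] [SMulCommClass R B B] (r : B → B → Prop) (c : R)
    {x y : B} (h : algCon R r x y) : algCon R r (c • x) (c • y) := by
  change RingConGen.Rel _ x y at h
  change RingConGen.Rel _ (c • x) (c • y)
  induction h with
  | of x y h =>
    obtain ⟨d, x', y', h, rfl, rfl⟩ := h
    exact .of _ _ ⟨c * d, x', y', h, by rw [mul_smul], by rw [mul_smul]⟩
  | refl x => exact .refl _
  | symm _ ih => exact .symm ih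
  | trans _ _ ih1 ih2 => exact .trans ih1 ih2
  | add _ _ ih1 ih2 => rw [smul_add, smul_add]; exact .add ih1 ih2
  | mul _ h2 ih1 _ => rw [← smul_mul_assoc, ← smul_mul_assoc]; exact .mul ih1 h2

/-- The quotient of the `R`-algebra `B` by the relations `r`. -/
def AlgQuot (R : Type) {B : Type} [CommRing R] [NonUnitalRing B] [Module R B]
    (r : B → B → Prop) : Type :=
  (algCon R r).Quotient

namespace AlgQuot

variable (r : B → B → Prop)

instance : NonUnitalRing (AlgQuot R r) :=
  inferInstanceAs (NonUnitalRing (algCon R r).Quotient)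

/-- The class of an element of `B` in the quotient, as a ring homomorphism. -/
def mkHom : B →ₙ+* AlgQuot R r where
  toFun x := RingCon.toQuotient (c := algCon R r) x
  map_mul' _ _ := rfl
  map_zero' := rfl
  map_add' _ _ := rfl

theorem mkHom_surjective : Function.Surjective (mkHom (R := R) r) :=
  Quotient.mk''_surjective

variable [IsScalarTower R B B] [SMulCommClass R B B]

instance : SMul R (AlgQuot R r) where
  smul c := Quotient.map' (c • ·) fun _ _ h => algCon_smul r c h

instance : Module R (AlgQuot R r) :=
  Function.Surjective.module R (mkHom (R := R) r).toAddMonoidHom (mkHom_surjective r)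
    fun _ _ => rfl

instance : IsScalarTower R (AlgQuot R r) (AlgQuot R r) where
  smul_assoc c x y := by
    obtain ⟨x, rfl⟩ := mkHom_surjective r x
    obtain ⟨y, rfl⟩ := mkHom_surjective r y
    exact congrArg (mkHom (R := R) r) (smul_mul_assoc c x y)

instance : SMulCommClass R (AlgQuot R r) (AlgQuot R r) where
  smul_comm c x y := by
    obtain ⟨x, rfl⟩ := mkHom_surjective r x
    obtain ⟨y, rfl⟩ := mkHom_surjective r y
    exact congrArg (mkHom (R := R) r) (mul_smul_comm c x y).symm

/-- The quotient map `B → B / (r)` as a homomorphism of (non-unital) `R`-algebras. -/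
def mk : B →ₙₐ[R] AlgQuot R r :=
  { mkHom (R := R) r with map_smul' := fun _ _ => rfl }

variable {r} in
theorem mk_eq_of_rel {x y : B} (h : r x y) : mk (R := R) r x = mk r y :=
  Quotient.sound' (RingConGen.Rel.of _ _ ⟨1, x, y, h, (one_smul R x).symm, (one_smul R y).symm⟩)

end AlgQuot

end Quotient

/-! ## The Dyck path algebra and the double Dyck path algebra -/

/-- The arrows of the quiver of the Dyck path algebra, with vertex set `ℕ`: loops
`T₁, …, T_{k-1}` at `k`, arrows `d₋ : k + 1 → k` and `d₊ : k → k + 1`. -/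
inductive DyckArrow : ℕ → ℕ → Type
  | T (k i : ℕ) (h₁ : 1 ≤ i) (h₂ : i < k) : DyckArrow k k
  | dMinus (k : ℕ) : DyckArrow (k + 1) k
  | dPlus (k : ℕ) : DyckArrow k (k + 1)

/-- The quiver of the Dyck path algebra. -/
def DyckQuiver : Type := ℕ

instance : Quiver.{0} DyckQuiver := ⟨DyckArrow⟩

/-- The arrows of the quiver of the double Dyck path algebra: there is in addition an arrow
`d₊^* : k → k + 1` for each `k`. -/
inductive DoubleDyckArrow : ℕ → ℕ → Type
  | T (k i : ℕ) (h₁ : 1 ≤ i) (h₂ : i < k) : DoubleDyckArrow k k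
  | dMinus (k : ℕ) : DoubleDyckArrow (k + 1) k
  | dPlus (k : ℕ) : DoubleDyckArrow k (k + 1)
  | dPlusStar (k : ℕ) : DoubleDyckArrow k (k + 1)

/-- The quiver of the double Dyck path algebra. -/
def DoubleDyckQuiver : Type := ℕ

instance : Quiver.{0} DoubleDyckQuiver := ⟨DoubleDyckArrow⟩

/-- A family of elements of an algebra `B` indexed like the idempotents and arrows of the quiver of
the Dyck path algebra: `e k` at the vertex `k`, `T k i` is the loop `Tᵢ` at `k` (meaningful only
for `1 ≤ i < k`), `dm k` is `d₋ : k + 1 → k` and `dp k` is `d₊ : k → k + 1`. -/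
structure DyckFamily (B : Type) where
  e : ℕ → B
  T : ℕ → ℕ → B
  dm : ℕ → B
  dp : ℕ → B

namespace DyckFamily

/-- The image of a family under a map. -/
def map {B C : Type} (f : B → C) (g : DyckFamily B) : DyckFamily C where
  e k := f (g.e k)
  T k i := f (g.T k i)
  dm k := f (g.dm k)
  dp k := f (g.dp k)

section Ring

variable {B : Type} [NonUnitalRing B] (g : DyckFamily B)

/-- The loop `d₊ d₋ - d₋ d₊` at the vertex `k` (for `k ≥ 1`). -/
def comm (k : ℕ) : B := g.dp (k - 1) * g.dm (k - 1) - g.dm k * g.dp k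

/-- The loop `T_j T_{j-1} ⋯ T_1` at the vertex `k`. -/
def descT (k : ℕ) : ℕ → B
  | 0 => g.e k
  | j + 1 => g.T k (j + 1) * descT k j

end Ring

section Field

variable {F B : Type} [Field F] [NonUnitalRing B] [Module F B] (u : F) (g : DyckFamily B)

/-- The defining relations of the Dyck path algebra with parameter `u`. -/
inductive Rel : B → B → Prop
  | quadratic (k i : ℕ) (h₁ : 1 ≤ i) (h₂ : i < k) :
      Rel ((g.T k i - g.e k) * (g.T k i + u • g.e k)) 0
  | braid (k i : ℕ) (h₁ : 1 ≤ i) (h₂ : i + 1 < k) :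
      Rel (g.T k i * g.T k (i + 1) * g.T k i) (g.T k (i + 1) * g.T k i * g.T k (i + 1))
  | far (k i j : ℕ) (hi₁ : 1 ≤ i) (hi₂ : i < k) (hj₁ : 1 ≤ j) (hj₂ : j < k)
      (hij : i + 1 < j ∨ j + 1 < i) :
      Rel (g.T k i * g.T k j) (g.T k j * g.T k i)
  | dm_dm_T (k : ℕ) :
      Rel (g.dm k * g.dm (k + 1) * g.T (k + 2) (k + 1)) (g.dm k * g.dm (k + 1))
  | T_dm (k i : ℕ) (h₁ : 1 ≤ i) (h₂ : i < k) :
      Rel (g.T k i * g.dm k) (g.dm k * g.T (k + 1) i)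
  | T_dp_dp (k : ℕ) :
      Rel (g.T (k + 2) 1 * g.dp (k + 1) * g.dp k) (g.dp (k + 1) * g.dp k)
  | dp_T (k i : ℕ) (h₁ : 1 ≤ i) (h₂ : i < k) :
      Rel (g.dp k * g.T k i) (g.T (k + 1) (i + 1) * g.dp k)
  | dm_comm_T (k : ℕ) (hk : 2 ≤ k) :
      Rel (g.dm (k - 1) * g.comm k * g.T k (k - 1)) (u • (g.comm (k - 1) * g.dm (k - 1)))
  | T_comm_dp (k : ℕ) (hk : 1 ≤ k) :
      Rel (g.T (k + 1) 1 * g.comm (k + 1) * g.dp k) (u • (g.dp k * g.comm k))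

/-- The inverse `u⁻¹ (Tᵢ + (u - 1) e_k)` of `Tᵢ` at the vertex `k` (see `dyckGen_T_mul_Tinv`,
`dyckGen_Tinv_mul_T`). -/
def Tinv (k i : ℕ) : B := u⁻¹ • (g.T k i + (u - 1) • g.e k)

/-- The elements `y₁, …, y_k` at the vertex `k ≥ 1`:
`y₁ = (d₊ d₋ - d₋ d₊) T_{k-1} ⋯ T₁ / (u^{k-1} (u - 1))` and
`y_{i+1} = u Tᵢ⁻¹ yᵢ Tᵢ⁻¹` for `1 ≤ i ≤ k - 1`. The value is meaningful only for `1 ≤ i ≤ k`. -/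
def y (k : ℕ) : ℕ → B
  | 0 => 0
  | 1 => (u ^ (k - 1) * (u - 1))⁻¹ • (g.comm k * g.descT k (k - 1))
  | i + 2 => u • (g.Tinv u k (i + 1) * y k (i + 1) * g.Tinv u k (i + 1))

end Field

end DyckFamily

section Algebras

variable (F : Type) [Field F]

/-- The idempotents and arrows of the Dyck quiver in its path algebra. -/
def dyckPaths : DyckFamily (PathAlgebra F DyckQuiver) where
  e k := PathAlgebra.ofPath F (Quiver.Path.nil (V := DyckQuiver) (a := k))
  T k i := if h : 1 ≤ i ∧ i < k then
    PathAlgebra.ofPath F (Quiver.Hom.toPath (V := DyckQuiver) (DyckArrow.T k i h.1 h.2)) else 0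
  dm k := PathAlgebra.ofPath F (Quiver.Hom.toPath (V := DyckQuiver) (DyckArrow.dMinus k))
  dp k := PathAlgebra.ofPath F (Quiver.Hom.toPath (V := DyckQuiver) (DyckArrow.dPlus k))

/-- The Dyck path algebra over the field `F` with parameter `u`. -/
abbrev DyckAlg (u : F) : Type :=
  AlgQuot F ((dyckPaths F).Rel u)

/-- The generators of the Dyck path algebra. -/
def dyckGen (u : F) : DyckFamily (DyckAlg F u) :=
  (dyckPaths F).map (AlgQuot.mk (R := F) ((dyckPaths F).Rel u))

variable {F}

theorem dyckGen_e_mul_e (u : F) (k : ℕ) :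
    (dyckGen F u).e k * (dyckGen F u).e k = (dyckGen F u).e k := by
  change AlgQuot.mk _ _ * AlgQuot.mk _ _ = AlgQuot.mk _ _
  rw [← map_mul]
  exact congrArg _ (PathAlgebra.ofPath_mul_ofPath _ _)

theorem dyckGen_e_mul_T (u : F) (k i : ℕ) :
    (dyckGen F u).e k * (dyckGen F u).T k i = (dyckGen F u).T k i := by
  change AlgQuot.mk _ _ * AlgQuot.mk _ _ = AlgQuot.mk _ _
  rw [← map_mul]
  refine congrArg _ ?_
  by_cases h : 1 ≤ i ∧ i < k
  · simp only [dyckPaths, h, and_self, dite_true]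
    exact PathAlgebra.ofPath_mul_ofPath _ _
  · simp only [dyckPaths, h, dite_false, mul_zero]

theorem dyckGen_T_mul_e (u : F) (k i : ℕ) :
    (dyckGen F u).T k i * (dyckGen F u).e k = (dyckGen F u).T k i := by
  change AlgQuot.mk _ _ * AlgQuot.mk _ _ = AlgQuot.mk _ _
  rw [← map_mul]
  refine congrArg _ ?_
  by_cases h : 1 ≤ i ∧ i < k
  · simp only [dyckPaths, h, and_self, dite_true]
    exact PathAlgebra.ofPath_mul_ofPath _ _
  · simp only [dyckPaths, h, dite_false, zero_mul]

theorem dyckGen_quadratic (u : F) (k i : ℕ) (h₁ : 1 ≤ i) (h₂ : i < k) :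
    (dyckGen F u).T k i * (dyckGen F u).T k i + (u - 1) • (dyckGen F u).T k i
      = u • (dyckGen F u).e k := by
  have h : AlgQuot.mk (R := F) ((dyckPaths F).Rel u) _ = AlgQuot.mk ((dyckPaths F).Rel u) _ :=
    AlgQuot.mk_eq_of_rel (DyckFamily.Rel.quadratic (u := u) (g := dyckPaths F) k i h₁ h₂)
  rw [map_mul, map_sub, map_add, map_smul, map_zero] at h
  change ((dyckGen F u).T k i - (dyckGen F u).e k) *
    ((dyckGen F u).T k i + u • (dyckGen F u).e k) = 0 at h
  rw [sub_mul, mul_add, mul_add, mul_smul_comm, mul_smul_comm, dyckGen_e_mul_e, dyckGen_e_mul_T,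
    dyckGen_T_mul_e] at h
  rw [← sub_eq_zero, ← h, sub_smul, one_smul]
  abel

/-- In the Dyck path algebra `Tinv` is the inverse of `Tᵢ` at the vertex `k`. -/
theorem dyckGen_T_mul_Tinv (u : F) (hu : u ≠ 0) (k i : ℕ) (h₁ : 1 ≤ i) (h₂ : i < k) :
    (dyckGen F u).T k i * (dyckGen F u).Tinv u k i = (dyckGen F u).e k := by
  rw [DyckFamily.Tinv, mul_smul_comm, mul_add, mul_smul_comm, dyckGen_T_mul_e,
    dyckGen_quadratic u k i h₁ h₂, inv_smul_smul₀ hu]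

theorem dyckGen_Tinv_mul_T (u : F) (hu : u ≠ 0) (k i : ℕ) (h₁ : 1 ≤ i) (h₂ : i < k) :
    (dyckGen F u).Tinv u k i * (dyckGen F u).T k i = (dyckGen F u).e k := by
  rw [DyckFamily.Tinv, smul_mul_assoc, add_mul, smul_mul_assoc, dyckGen_e_mul_T,
    dyckGen_quadratic u k i h₁ h₂, inv_smul_smul₀ hu]

variable (F)

/-- The idempotents and the arrows `Tᵢ`, `d₋`, `d₊` of the double Dyck quiver in its path
algebra. -/
def doublePaths : DyckFamily (PathAlgebra F DoubleDyckQuiver) where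
  e k := PathAlgebra.ofPath F (Quiver.Path.nil (V := DoubleDyckQuiver) (a := k))
  T k i := if h : 1 ≤ i ∧ i < k then PathAlgebra.ofPath F
    (Quiver.Hom.toPath (V := DoubleDyckQuiver) (DoubleDyckArrow.T k i h.1 h.2)) else 0
  dm k := PathAlgebra.ofPath F
    (Quiver.Hom.toPath (V := DoubleDyckQuiver) (DoubleDyckArrow.dMinus k))
  dp k := PathAlgebra.ofPath F
    (Quiver.Hom.toPath (V := DoubleDyckQuiver) (DoubleDyckArrow.dPlus k))

/-- The elements `Tᵢ⁻¹`, `d₋`, `d₊^*` of the path algebra of the double Dyck quiver (`Tᵢ⁻¹` being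
expressed through `Tᵢ` by means of the quadratic relation). -/
def doublePathsStar (q : F) : DyckFamily (PathAlgebra F DoubleDyckQuiver) where
  e := (doublePaths F).e
  T := (doublePaths F).Tinv q
  dm := (doublePaths F).dm
  dp k := PathAlgebra.ofPath F
    (Quiver.Hom.toPath (V := DoubleDyckQuiver) (DoubleDyckArrow.dPlusStar k))

/-- The defining relations of the double Dyck path algebra: those of the Dyck path algebra with
parameter `q` for `Tᵢ, d₋, d₊`, those of the Dyck path algebra with parameter `q⁻¹` for
`Tᵢ⁻¹, d₋, d₊^*`, and the relations expressing correct intertwining, in which `yᵢ` and `zᵢ` are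
formed in the first and in the second family. -/
inductive DoubleRel (q t : F) :
    PathAlgebra F DoubleDyckQuiver → PathAlgebra F DoubleDyckQuiver → Prop
  | first {x y} (h : (doublePaths F).Rel q x y) : DoubleRel q t x y
  | second {x y} (h : (doublePathsStar F q).Rel q⁻¹ x y) : DoubleRel q t x y
  | dp_z (k i : ℕ) (h₁ : 1 ≤ i) (h₂ : i ≤ k) : DoubleRel q t
      ((doublePaths F).dp k * (doublePathsStar F q).y q⁻¹ k i)
      ((doublePathsStar F q).y q⁻¹ (k + 1) (i + 1) * (doublePaths F).dp k)
  | dpStar_y (k i : ℕ) (h₁ : 1 ≤ i) (h₂ : i ≤ k) : DoubleRel q t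
      ((doublePathsStar F q).dp k * (doublePaths F).y q k i)
      ((doublePaths F).y q (k + 1) (i + 1) * (doublePathsStar F q).dp k)
  | z_dp (k : ℕ) : DoubleRel q t
      ((doublePathsStar F q).y q⁻¹ (k + 1) 1 * (doublePaths F).dp k)
      (-(t * q ^ (k + 1)) • ((doublePaths F).y q (k + 1) 1 * (doublePathsStar F q).dp k))

/-- The double Dyck path algebra over the field `F` with parameters `q` and `t`. -/
abbrev DoubleDyckAlg (q t : F) : Type :=
  AlgQuot F (DoubleRel F q t)

/-- The generators `e_k`, `Tᵢ`, `d₋`, `d₊` of the double Dyck path algebra. -/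
def doubleGen (q t : F) : DyckFamily (DoubleDyckAlg F q t) :=
  (doublePaths F).map (AlgQuot.mk (R := F) (DoubleRel F q t))

/-- The generator `d₊^* : k → k + 1` of the double Dyck path algebra. -/
def doubleGenStar (q t : F) (k : ℕ) : DoubleDyckAlg F q t :=
  AlgQuot.mk (R := F) (DoubleRel F q t) ((doublePathsStar F q).dp k)

end Algebras

/-! ## The spaces `V_k` and the operators on them -/

section Spaces

variable (K : Type) [Field K]

/-- The ring `Sym[X]` of symmetric functions over a field `K` of characteristic zero: the polynomial
ring in the power sums `p₁, p₂, …`, which are algebraically independent generators. -/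
abbrev SymFun : Type := MvPolynomial ℕ+ K

/-- `V_k = Sym[X] ⊗ K[y₁, …, y_k]`, the polynomials in `y₁, …, y_k` over `Sym[X]`; the variable
`yᵢ` has index `i - 1` in `Fin k`. -/
abbrev V (k : ℕ) : Type := MvPolynomial (Fin k) (SymFun K)

/-- `V_*`, the direct sum of the `V_k` over `k ≥ 0`. -/
abbrev VStar : Type := DirectSum ℕ (V K)

/-- The operator on `V_*` that is `f` on `V_k` and zero on the other summands. -/
def extend {k l : ℕ} (f : V K k →ₗ[K] V K l) : Module.End K (VStar K) :=
  DirectSum.lof K ℕ (V K) l ∘ₗ f ∘ₗ DirectSum.component K ℕ (V K) k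

variable {K}

/-- The power sum `p_n = p_n[X]`. -/
def pSum (n : ℕ+) : SymFun K := MvPolynomial.X n

/-- Substitution `F ↦ F[A; b₁, …, b_k]` into a `K`-algebra `R`: the plethystic substitution
`X ↦ A`, where the alphabet `A` is given through the elements `a n = p_n[A]` of `R`, together with
the substitution `yᵢ ↦ bᵢ`. -/
def pleth {k : ℕ} {R : Type} [CommRing R] [Algebra K R] (a : ℕ+ → R) (b : Fin k → R) :
    V K k →ₐ[K] R :=
  MvPolynomial.aevalTower (MvPolynomial.aeval a) b

/-- The plethystic exponential in a graded form: for an alphabet `A` with `p_n[A] = a n`, the power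
series `Exp[z A] = exp(∑_{n ≥ 1} p_n[A] z^n / n)`. -/
def pExp [CharZero K] (a : ℕ+ → SymFun K) : PowerSeries (SymFun K) :=
  (PowerSeries.exp (SymFun K)).subst
    (PowerSeries.mk fun n : ℕ =>
      if h : 0 < n then ((n : K)⁻¹ • a (n.toPNat h) : SymFun K) else 0)

/-- The series `Exp[-z X]`; here `p_n[-X] = -p_n[X]`. -/
def expNeg [CharZero K] : PowerSeries (SymFun K) := pExp fun n => -pSum n

/-- The operator interchanging two of the variables `y`. -/
def swapY {k : ℕ} (a b : Fin k) : V K k →ₐ[SymFun K] V K k :=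
  MvPolynomial.rename (Equiv.swap a b)

/-- The numerator `(q - 1) y_a F + (y_b - q y_a) swap(F)`. -/
def heckeNum (q : K) {k : ℕ} (a b : Fin k) : V K k →ₗ[K] V K k where
  toFun F := (q - 1) • (MvPolynomial.X a * F)
    + (MvPolynomial.X b - q • MvPolynomial.X a) * swapY a b F
  map_add' F G := by simp only [mul_add, smul_add, map_add]; ring
  map_smul' c F := by
    have : swapY a b (c • F) = c • swapY a b F :=
      map_smul ((swapY a b : V K k →ₐ[SymFun K] V K k).restrictScalars K) c F
    rw [this, RingHom.id_apply, smul_add, mul_smul_comm, mul_smul_comm,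
      smul_comm (q - 1) c (MvPolynomial.X a * F : V K k)]

theorem dvd_sub_swapY {k : ℕ} (a b : Fin k) (F : V K k) :
    (MvPolynomial.X b - MvPolynomial.X a : V K k) ∣ swapY a b F - F := by
  induction F using MvPolynomial.induction_on with
  | C c => simp [swapY]
  | add F G hF hG =>
    rw [map_add, add_sub_add_comm]
    exact dvd_add hF hG
  | mul_X F i hF =>
    have hX : (MvPolynomial.X b - MvPolynomial.X a : V K k) ∣
        swapY a b (MvPolynomial.X i) - MvPolynomial.X i := by
      rw [swapY, MvPolynomial.rename_X]
      by_cases hia : i = a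
      · subst hia; rw [Equiv.swap_apply_left]
      · by_cases hib : i = b
        · subst hib; rw [Equiv.swap_apply_right]; exact ⟨-1, by ring⟩
        · rw [Equiv.swap_apply_of_ne_of_ne hia hib, sub_self]; exact dvd_zero _
    have : swapY a b (F * MvPolynomial.X i) - F * MvPolynomial.X i
        = (swapY a b F - F) * swapY a b (MvPolynomial.X i)
          + F * (swapY a b (MvPolynomial.X i) - MvPolynomial.X i) := by
      rw [map_mul]; ring
    rw [this]
    exact dvd_add (hF.mul_right _) (hX.mul_left _)

theorem dvd_heckeNum (q : K) {k : ℕ} (a b : Fin k) (F : V K k) :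
    (MvPolynomial.X b - MvPolynomial.X a : V K k) ∣ heckeNum q a b F := by
  have : heckeNum q a b F = (MvPolynomial.X b - MvPolynomial.X a) * F
      + (MvPolynomial.X b - q • (MvPolynomial.X a : V K k)) * (swapY a b F - F) := by
    change (q - 1) • (MvPolynomial.X a * F)
      + (MvPolynomial.X b - q • MvPolynomial.X a) * swapY a b F = _
    simp only [Algebra.smul_def, map_sub, map_one]
    ring
  rw [this]
  exact dvd_add (dvd_mul_right _ _) ((dvd_sub_swapY a b F).mul_left _)

theorem X_sub_X_ne_zero {k : ℕ} {a b : Fin k} (h : a ≠ b) :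
    (MvPolynomial.X b - MvPolynomial.X a : V K k) ≠ 0 :=
  sub_ne_zero.mpr fun h' => h (MvPolynomial.X_injective h').symm

/-- The quotient `((q - 1) y_a F + (y_b - q y_a) swap(F)) / (y_b - y_a)`, an exact division in the
polynomial ring `V_k`. -/
def heckeAux (q : K) {k : ℕ} (a b : Fin k) (h : a ≠ b) : V K k →ₗ[K] V K k where
  toFun F := Classical.choose (dvd_heckeNum q a b F)
  map_add' F G := by
    apply mul_left_cancel₀ (X_sub_X_ne_zero h)
    rw [mul_add, ← Classical.choose_spec (dvd_heckeNum q a b (F + G)),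
      ← Classical.choose_spec (dvd_heckeNum q a b F),
      ← Classical.choose_spec (dvd_heckeNum q a b G), map_add]
  map_smul' c F := by
    apply mul_left_cancel₀ (X_sub_X_ne_zero h)
    rw [RingHom.id_apply, mul_smul_comm, ← Classical.choose_spec (dvd_heckeNum q a b (c • F)),
      ← Classical.choose_spec (dvd_heckeNum q a b F), map_smul]

theorem heckeAux_spec (q : K) {k : ℕ} (a b : Fin k) (h : a ≠ b) (F : V K k) :
    (MvPolynomial.X b - MvPolynomial.X a) * heckeAux q a b h F
      = (q - 1) • (MvPolynomial.X a * F)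
        + (MvPolynomial.X b - q • MvPolynomial.X a) * swapY a b F :=
  (Classical.choose_spec (dvd_heckeNum q a b F)).symm

/-- The operator `Tᵢ F = ((q - 1) yᵢ F + (y_{i+1} - q yᵢ) swap(F)) / (y_{i+1} - yᵢ)` on `V_k`, for
`1 ≤ i ≤ k - 1` (and zero, by convention, for other `i`). -/
def opT (q : K) (k i : ℕ) : Module.End K (V K k) :=
  if h : 1 ≤ i ∧ i < k then
    heckeAux q ⟨i - 1, by omega⟩ ⟨i, h.2⟩ (by simp only [ne_eq, Fin.mk.injEq]; omega)
  else 0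

/-- Multiplication by `yᵢ` on `V_k`, for `1 ≤ i ≤ k` (and zero, by convention, for other `i`). -/
def opY (k i : ℕ) : Module.End K (V K k) :=
  if h : 1 ≤ i ∧ i ≤ k then
    LinearMap.mulLeft K (MvPolynomial.X ⟨i - 1, by omega⟩ : V K k)
  else 0

/-- The substitution `F ↦ F[X - (q - 1) y_{k+1}; y₁, …, y_{k+1}]` on `V_{k+1}`, with the result
written as a polynomial in `y_{k+1}` with coefficients in `V_k`. -/
def lowerSubst (q : K) (k : ℕ) : V K (k + 1) →ₐ[K] Polynomial (V K k) :=
  pleth (K := K) (R := Polynomial (V K k))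
    (fun n => Polynomial.C (MvPolynomial.C (pSum n)) - (q ^ (n : ℕ) - 1) • Polynomial.X ^ (n : ℕ))
    (Fin.lastCases (motive := fun _ => Polynomial (V K k)) Polynomial.X
      fun i => Polynomial.C (MvPolynomial.X i))

/-- The operator `d₋ : V_{k+1} → V_k`, sending `F` to the coefficient of `y_{k+1}^0` in
`F[X - (q - 1) y_{k+1}; y₁, …, y_{k+1}] Exp[-y_{k+1}⁻¹ X]`: the sum over `j` of the coefficient of
`y_{k+1}^j` in the first factor times the coefficient of `y_{k+1}^{-j}` in the second. -/
def opDm [CharZero K] (q : K) (k : ℕ) : V K (k + 1) →ₗ[K] V K k :=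
  Polynomial.lsum
      (fun j => LinearMap.mulRight K (MvPolynomial.C (PowerSeries.coeff j expNeg) : V K k)) ∘ₗ
    (lowerSubst q k).toLinearMap

/-- The substitution `F ↦ F[X + (q - 1) y_{k+1}; y₁, …, y_k]` from `V_k` to `V_{k+1}`. -/
def raiseSubst (q : K) (k : ℕ) : V K k →ₐ[K] V K (k + 1) :=
  pleth
    (fun n => MvPolynomial.C (pSum n)
      + (q ^ (n : ℕ) - 1) • MvPolynomial.X (Fin.last k) ^ (n : ℕ))
    fun i => MvPolynomial.X i.castSucc

/-- The operator `d₊ : V_k → V_{k+1}`,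
`d₊ F = -T₁ T₂ ⋯ T_k (y_{k+1} F[X + (q - 1) y_{k+1}; y₁, …, y_k])`. -/
def opDp (q : K) (k : ℕ) : V K k →ₗ[K] V K (k + 1) :=
  -(((List.range k).map fun j => opT q (k + 1) (j + 1)).prod ∘ₗ opY (k + 1) (k + 1) ∘ₗ
    (raiseSubst q k).toLinearMap)

/-- The operator `γ` on `V_{k+1}`: it fixes `Sym[X]` and sends `yᵢ` to `y_{i+1}` for `i < k + 1`
and `y_{k+1}` to `t y₁`. -/
def gammaHom (t : K) (k : ℕ) : V K (k + 1) →ₐ[K] V K (k + 1) :=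
  pleth (fun n => MvPolynomial.C (pSum n))
    (Fin.lastCases (motive := fun _ => V K (k + 1)) (t • MvPolynomial.X 0)
      fun i => MvPolynomial.X i.succ)

/-- The operator `d₊^* : V_k → V_{k+1}`, `d₊^* F = γ(F[X + (q - 1) y_{k+1}; y₁, …, y_k])`. -/
def opDpStar (q t : K) (k : ℕ) : V K k →ₗ[K] V K (k + 1) :=
  (gammaHom t k).toLinearMap ∘ₗ (raiseSubst q k).toLinearMap

/-- The projections to the `V_k` and the operators `Tᵢ`, `d₋`, `d₊`, as operators on `V_*`. -/
def firstOps [CharZero K] (q : K) : DyckFamily (Module.End K (VStar K)) where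
  e k := extend K (LinearMap.id : V K k →ₗ[K] V K k)
  T k i := extend K (opT q k i)
  dm k := extend K (opDm q k)
  dp k := extend K (opDp q k)

/-- The projections to the `V_k` and the operators `Tᵢ⁻¹`, `d₋`, `d₊^*`, as operators on `V_*`. Here
`Tᵢ⁻¹` is the inverse in the ring of endomorphisms of `V_k`. -/
def secondOps [CharZero K] (q t : K) : DyckFamily (Module.End K (VStar K)) where
  e k := extend K (LinearMap.id : V K k →ₗ[K] V K k)
  T k i := extend K (Ring.inverse (opT q k i))
  dm k := extend K (opDm q k)
  dp k := extend K (opDpStar q t k)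

end Spaces

/-! ## Actions -/

section Actions

/-- The map `f` sends the members of the family `g` to those of the family `g'`. -/
def DyckFamily.MapsTo {B C : Type} (f : B → C) (g : DyckFamily B) (g' : DyckFamily C) : Prop :=
  (∀ k, f (g.e k) = g'.e k) ∧
  (∀ k i, 1 ≤ i → i < k → f (g.T k i) = g'.T k i) ∧
  (∀ k, f (g.dm k) = g'.dm k) ∧
  (∀ k, f (g.dp k) = g'.dp k)

variable {F : Type} [Field F] {K : Type} [Field K] [Algebra F K]

/-- Correct intertwining of an action `ρ` of the Dyck path algebra with parameter `q` and an action
`ρ'` of the Dyck path algebra with parameter `q⁻¹` on `V_*` (for both of which `e_k` acts as the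
projection to `V_k`). -/
structure CorrectlyIntertwined (q : F) (t : K)
    (ρ : DyckAlg F q →ₙₐ[F] Module.End K (VStar K))
    (ρ' : DyckAlg F q⁻¹ →ₙₐ[F] Module.End K (VStar K)) : Prop where
  T_mul_T : ∀ k i, 1 ≤ i → i < k →
    ρ ((dyckGen F q).T k i) * ρ' ((dyckGen F q⁻¹).T k i) = ρ ((dyckGen F q).e k)
  T_mul_T' : ∀ k i, 1 ≤ i → i < k →
    ρ' ((dyckGen F q⁻¹).T k i) * ρ ((dyckGen F q).T k i) = ρ ((dyckGen F q).e k)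
  dm_eq : ∀ k, ρ' ((dyckGen F q⁻¹).dm k) = ρ ((dyckGen F q).dm k)
  dp_z : ∀ k i, 1 ≤ i → i ≤ k →
    ρ ((dyckGen F q).dp k) * ρ' ((dyckGen F q⁻¹).y q⁻¹ k i)
      = ρ' ((dyckGen F q⁻¹).y q⁻¹ (k + 1) (i + 1)) * ρ ((dyckGen F q).dp k)
  dpStar_y : ∀ k i, 1 ≤ i → i ≤ k →
    ρ' ((dyckGen F q⁻¹).dp k) * ρ ((dyckGen F q).y q k i)
      = ρ ((dyckGen F q).y q (k + 1) (i + 1)) * ρ' ((dyckGen F q⁻¹).dp k)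
  z_dp : ∀ k,
    ρ' ((dyckGen F q⁻¹).y q⁻¹ (k + 1) 1) * ρ ((dyckGen F q).dp k)
      = -(t * algebraMap F K q ^ (k + 1)) •
        (ρ ((dyckGen F q).y q (k + 1) 1) * ρ' ((dyckGen F q⁻¹).dp k))

end Actions

/-! ## The base fields -/

/-- The field `ℚ(q)`. -/
abbrev Qq : Type := RatFunc ℚ

/-- The field `ℚ(q, t) = ℚ(q)(t)`. -/
abbrev Qqt : Type := RatFunc Qq

/-- The element `q` of `ℚ(q)`. -/
def qElt : Qq := RatFunc.X

/-- The element `q` of `ℚ(q, t)`. -/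
def qElt' : Qqt := algebraMap Qq Qqt qElt

/-- The element `t` of `ℚ(q, t)`. -/
def tElt : Qqt := RatFunc.X

end DyckAlgebra

end

open DyckAlgebra

/-! Both algebras are given by generators and relations, so existence and uniqueness of the actions
reduce to checking relations between operators (`existsUnique_dyckAlg_hom`,
`existsUnique_doubleDyckAlg_hom`). The Hecke relations are divided-difference identities; the
relations without commutators follow from braid manipulations of T_1⋯T_m and from symmetries of the
substitutions, except d_-²T_{k-1} = d_-², which already needs the rule below.

The real content concerns d_-, a constant term in w against Exp[-w⁻¹X], and one rule carries it. If
A' = A + c - d, then (w - d)Exp[-w⁻¹A'] = (w - c)Exp[-w⁻¹A]. Hence, with the divided difference N =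
(G - G(d))/(w - d), the constant term of G against A' is that of G + (d - c)N against A
(`ctExp_shift`). All alphabets that occur differ from X by terms ±(q-1)x, so composites of the
operators become constant terms against X itself, and operator identities become identities between
divided differences. The lemmas allow an arbitrary coefficient homomorphism ι, so that they can be
iterated with ι replaced by a further substitution.

For the first action, d_+d_- - d_-d_+ on V_{m+1} equals (q-1)T_1⋯T_m y_{m+1} (`firstComm_apply`).
Together with T_i y_{i+1} T_i = q y_i this gives the two commutator relations and shows that y_i
acts as multiplication.

For the second action, d_+^* is an algebra homomorphism, and d_+^*d_- - d_-d_+^* is (1-q)t y_1 times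
the constant term of a divided difference at w = t y_1 (`algHom_secondComm`). Its relation with
d_+^* is an identity between second divided differences (`divided_difference_symm`). In its relation
with d_-, the two sides differ by an iterated constant term of an expression antisymmetric in both
variables, which vanishes since equal alphabets make iterated constant terms symmetric
(`ctExp_ctExp_polySwap`).

Correct intertwining rests on two evaluations of the second commutator on raised elements,
`secondComm_X_mul_raiseSubst` and `X_mul_raiseSubst_secondComm`, together with index shifts in the
products of the T_i. -/

noncomputable section

namespace DyckAlgebra

/-! ### Homomorphisms out of path algebras -/

section UniversalProperty

variable {F Q C : Type} [Field F] [Quiver.{0} Q] [NonUnitalRing C] [Module F C]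

/-- The value of a path on a representation of a quiver in a ring: the product of the values of its
arrows. -/
def pathVal (e : Q → C) (v : ∀ {a b : Q}, (a ⟶ b) → C) {a : Q} : ∀ {b : Q}, Quiver.Path a b → C
  | _, .nil => e a
  | _, .cons p f => v f * pathVal e v p

variable (e : Q → C) (v : ∀ {a b : Q}, (a ⟶ b) → C)

theorem mul_pathVal (he : ∀ a, e a * e a = e a) (hl : ∀ {a b : Q} (f : a ⟶ b), e b * v f = v f)
    {a b : Q} (p : Quiver.Path a b) : e b * pathVal e v p = pathVal e v p := by
  cases p with
  | nil => exact he a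
  | cons p f => rw [pathVal, ← mul_assoc, hl]

theorem pathVal_mul (he : ∀ a, e a * e a = e a) {a b : Q} (p : Quiver.Path a b) :
    pathVal e v p * e a = pathVal e v p := by
  induction p with
  | nil => exact he a
  | cons p f ih => rw [pathVal, mul_assoc, ih]

theorem pathVal_comp (he : ∀ a, e a * e a = e a) (hl : ∀ {a b : Q} (f : a ⟶ b), e b * v f = v f)
    {a b c : Q} (p : Quiver.Path a b) (r : Quiver.Path b c) :
    pathVal e v (p.comp r) = pathVal e v r * pathVal e v p := by
  induction r with
  | nil => rw [Quiver.Path.comp_nil, pathVal, mul_pathVal e v he hl]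
  | cons r f ih => rw [Quiver.Path.comp_cons, pathVal, pathVal, ih, mul_assoc]

/-- Every path is a product of arrows and a trivial path. The trivial paths need their own
hypothesis, since the homomorphisms are not unital. -/
theorem pathAlgebra_hom_ext {f g : PathAlgebra F Q →ₙₐ[F] C}
    (hnil : ∀ a : Q, f (PathAlgebra.ofPath F (Quiver.Path.nil (a := a)))
      = g (PathAlgebra.ofPath F (Quiver.Path.nil (a := a))))
    (harr : ∀ {a b : Q} (h : a ⟶ b), f (PathAlgebra.ofPath F h.toPath)
      = g (PathAlgebra.ofPath F h.toPath)) : f = g := by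
  refine NonUnitalAlgHom.ext fun x => ?_
  induction x using PathAlgebra.induction with
  | zero => rw [map_zero, map_zero]
  | add x y hx hy => rw [map_add, map_add, hx, hy]
  | smul r a b p =>
    rw [map_smul, map_smul]
    congr 1
    induction p with
    | nil => exact hnil a
    | cons p h ih =>
      have : PathAlgebra.ofPath F (p.cons h)
          = PathAlgebra.ofPath F h.toPath * PathAlgebra.ofPath F p :=
        (PathAlgebra.ofPath_mul_ofPath h.toPath p).symm
      rw [this, map_mul, map_mul, ih, harr]

variable [IsScalarTower F C C] [SMulCommClass F C C]

/-- The homomorphism from a path algebra determined by the values of the idempotents and of the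
arrows. -/
def pathHom (he : ∀ a, e a * e a = e a) (hne : ∀ a b, a ≠ b → e a * e b = 0)
    (hl : ∀ {a b : Q} (f : a ⟶ b), e b * v f = v f) : PathAlgebra F Q →ₙₐ[F] C :=
  { PathAlgebra.linLift (R := F) (Q := Q) (fun p => pathVal e v p.2.2) with
    map_zero' := map_zero (PathAlgebra.linLift (R := F) (Q := Q) (fun p => pathVal e v p.2.2))
    map_mul' := fun x y => by
      change PathAlgebra.linLift (R := F) (Q := Q) (fun p => pathVal e v p.2.2) (x * y)
        = PathAlgebra.linLift (R := F) (Q := Q) (fun p => pathVal e v p.2.2) x *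
          PathAlgebra.linLift (R := F) (Q := Q) (fun p => pathVal e v p.2.2) y
      induction x using PathAlgebra.induction with
      | zero => rw [zero_mul, map_zero, zero_mul]
      | add x x' hx hx' => rw [add_mul, map_add, hx, hx', map_add, add_mul]
      | smul r a b x =>
      induction y using PathAlgebra.induction with
      | zero => rw [mul_zero, map_zero, mul_zero]
      | add y y' hy hy' => rw [mul_add, map_add, hy, hy', map_add, mul_add]
      | smul s c d y =>
      rw [smul_mul_assoc, mul_smul_comm, map_smul, map_smul, map_smul, map_smul, smul_mul_assoc,
        mul_smul_comm, PathAlgebra.linLift_ofPath, PathAlgebra.linLift_ofPath]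
      by_cases h : d = a
      · subst h
        rw [PathAlgebra.ofPath_mul_ofPath, PathAlgebra.linLift_ofPath, pathVal_comp e v he hl]
      -- For paths that do not compose, the orthogonal idempotents of the two vertices are inserted
      -- between the values.
      · rw [PathAlgebra.ofPath_mul_ofPath_of_ne _ _ h, map_zero, ← pathVal_mul e v he x,
          ← mul_pathVal e v he hl y, mul_assoc, ← mul_assoc (e a), hne a d (Ne.symm h), zero_mul,
          mul_zero] }

theorem pathHom_ofPath (he : ∀ a, e a * e a = e a) (hne : ∀ a b, a ≠ b → e a * e b = 0)
    (hl : ∀ {a b : Q} (f : a ⟶ b), e b * v f = v f) {a b : Q} (p : Quiver.Path a b) :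
    pathHom (F := F) e v he hne hl (PathAlgebra.ofPath F p) = pathVal e v p :=
  PathAlgebra.linLift_ofPath (R := F) (Q := Q) (fun p => pathVal e v p.2.2) p

end UniversalProperty

/-! ### Homomorphisms out of quotients by relations -/

section QuotLift

variable {R B C : Type} [CommRing R] [NonUnitalRing B] [Module R B] [NonUnitalRing C] [Module R C]

/-- The kernel congruence of `f` is stable under scalars and contains `r`, hence contains the
congruence generated. -/
theorem AlgQuot.hom_eq_of_algCon {r : B → B → Prop} (f : B →ₙₐ[R] C)
    (hf : ∀ x y, r x y → f x = f y) {x y : B} (h : algCon R r x y) : f x = f y := by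
  change RingConGen.Rel _ x y at h
  induction h with
  | of x y h =>
    obtain ⟨c, x', y', h, rfl, rfl⟩ := h
    rw [map_smul, map_smul, hf _ _ h]
  | refl x => rfl
  | symm _ ih => exact ih.symm
  | trans _ _ ih1 ih2 => exact ih1.trans ih2
  | add _ _ ih1 ih2 => rw [map_add, map_add, ih1, ih2]
  | mul _ _ ih1 ih2 => rw [map_mul, map_mul, ih1, ih2]

variable [IsScalarTower R B B] [SMulCommClass R B B] (r : B → B → Prop)

/-- A homomorphism compatible with the relations `r` descends to the quotient. -/
def AlgQuot.lift (f : B →ₙₐ[R] C) (hf : ∀ x y, r x y → f x = f y) : AlgQuot R r →ₙₐ[R] C where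
  toFun := Quotient.lift f fun _ _ h => AlgQuot.hom_eq_of_algCon f hf h
  map_smul' c x := by
    obtain ⟨x, rfl⟩ := AlgQuot.mkHom_surjective r x
    exact map_smul f c x
  map_zero' := map_zero f
  map_add' x y := by
    obtain ⟨x, rfl⟩ := AlgQuot.mkHom_surjective r x
    obtain ⟨y, rfl⟩ := AlgQuot.mkHom_surjective r y
    exact map_add f x y
  map_mul' x y := by
    obtain ⟨x, rfl⟩ := AlgQuot.mkHom_surjective r x
    obtain ⟨y, rfl⟩ := AlgQuot.mkHom_surjective r y
    exact map_mul f x y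

theorem AlgQuot.hom_ext {f g : AlgQuot R r →ₙₐ[R] C}
    (h : f.comp (AlgQuot.mk (R := R) r) = g.comp (AlgQuot.mk r)) : f = g := by
  refine NonUnitalAlgHom.ext fun x => ?_
  obtain ⟨x, rfl⟩ := AlgQuot.mkHom_surjective r x
  exact DFunLike.congr_fun h x

end QuotLift

/-! ### Transport of families and of their relations -/

namespace DyckFamily

variable {F B C : Type} [Field F] [NonUnitalRing B] [Module F B] [NonUnitalRing C] [Module F C]

section MapsTo

variable {f : B →ₙₐ[F] C} {g : DyckFamily B} {g' : DyckFamily C}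

theorem MapsTo.comm (h : g.MapsTo f g') (k : ℕ) : f (g.comm k) = g'.comm k := by
  obtain ⟨-, -, hm, hp⟩ := h
  simp only [DyckFamily.comm, map_sub, map_mul, hm, hp]

theorem MapsTo.descT (h : g.MapsTo f g') (k j : ℕ) (hj : j < k) :
    f (g.descT k j) = g'.descT k j := by
  induction j with
  | zero => exact h.1 k
  | succ j ih =>
    rw [DyckFamily.descT, DyckFamily.descT, map_mul, ih (by omega), h.2.1 k (j + 1) (by omega) hj]

theorem MapsTo.Tinv (h : g.MapsTo f g') (u : F) (k i : ℕ) (h₁ : 1 ≤ i) (h₂ : i < k) :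
    f (g.Tinv u k i) = g'.Tinv u k i := by
  rw [DyckFamily.Tinv, DyckFamily.Tinv, map_smul, map_add, map_smul, h.1, h.2.1 k i h₁ h₂]

theorem MapsTo.y (h : g.MapsTo f g') (u : F) (k i : ℕ) (h₁ : 1 ≤ i) (h₂ : i ≤ k) :
    f (g.y u k i) = g'.y u k i := by
  induction i with
  | zero => omega
  | succ i ih =>
    cases i with
    | zero => rw [DyckFamily.y, DyckFamily.y, map_smul, map_mul, h.comm, h.descT _ _ (by omega)]
    | succ i =>
      rw [DyckFamily.y, DyckFamily.y, map_smul, map_mul, map_mul, ih (by omega) (by omega),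
        h.Tinv u _ _ (by omega) (by omega)]

/-- Each relation goes to the same relation among the images; the index bounds in `Rel` keep every
T_i in the range where `MapsTo` determines its image. -/
theorem MapsTo.rel (h : g.MapsTo f g') (u : F) (hrel : ∀ x y, g'.Rel u x y → x = y) {x y : B}
    (hxy : g.Rel u x y) : f x = f y := by
  have hT := h.2.1
  have hm := h.2.2.1
  have hp := h.2.2.2
  have he := h.1
  induction hxy with
  | quadratic k i h₁ h₂ =>
    rw [map_mul, map_sub, map_add, map_smul, map_zero, he, hT k i h₁ h₂]
    exact hrel _ _ (.quadratic k i h₁ h₂)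
  | braid k i h₁ h₂ =>
    simp only [map_mul]
    rw [hT k i h₁ (by omega), hT k (i + 1) (by omega) h₂]
    exact hrel _ _ (.braid k i h₁ h₂)
  | far k i j hi₁ hi₂ hj₁ hj₂ hij =>
    rw [map_mul, map_mul, hT k i hi₁ hi₂, hT k j hj₁ hj₂]
    exact hrel _ _ (.far k i j hi₁ hi₂ hj₁ hj₂ hij)
  | dm_dm_T k =>
    rw [map_mul, map_mul, hm, hm, hT _ _ (by omega) (by omega)]
    exact hrel _ _ (.dm_dm_T k)
  | T_dm k i h₁ h₂ =>
    rw [map_mul, map_mul, hm, hT _ _ h₁ h₂, hT _ _ h₁ (by omega)]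
    exact hrel _ _ (.T_dm k i h₁ h₂)
  | T_dp_dp k =>
    rw [map_mul, map_mul, map_mul, hp, hp, hT _ _ (by omega) (by omega)]
    exact hrel _ _ (.T_dp_dp k)
  | dp_T k i h₁ h₂ =>
    rw [map_mul, map_mul, hp, hT _ _ h₁ h₂, hT _ _ (by omega) (by omega)]
    exact hrel _ _ (.dp_T k i h₁ h₂)
  | dm_comm_T k hk =>
    rw [map_mul, map_mul, map_smul, map_mul, h.comm, h.comm, hm, hT _ _ (by omega) (by omega)]
    exact hrel _ _ (.dm_comm_T k hk)
  | T_comm_dp k hk =>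
    rw [map_mul, map_mul, map_smul, map_mul, h.comm, h.comm, hp, hT _ _ (by omega) (by omega)]
    exact hrel _ _ (.T_comm_dp k hk)

end MapsTo

end DyckFamily

/-! ### Universal properties of the Dyck and double Dyck path algebras -/

section Actions

variable {F C : Type} [Field F] [NonUnitalRing C] [Module F C]

/-- The members of the family are supported between the idempotents of the vertices they join. -/
structure DyckFamily.IsQuiverRep (g : DyckFamily C) : Prop where
  e_mul_e : ∀ k, g.e k * g.e k = g.e k
  e_mul_e_of_ne : ∀ k l, k ≠ l → g.e k * g.e l = 0
  e_mul_T : ∀ k i, g.e k * g.T k i = g.T k i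
  T_mul_e : ∀ k i, g.T k i * g.e k = g.T k i
  e_mul_dm : ∀ k, g.e k * g.dm k = g.dm k
  dm_mul_e : ∀ k, g.dm k * g.e (k + 1) = g.dm k
  e_mul_dp : ∀ k, g.e (k + 1) * g.dp k = g.dp k
  dp_mul_e : ∀ k, g.dp k * g.e k = g.dp k

/-- The values of the arrows of the Dyck quiver. -/
def DyckFamily.arrowVal (g : DyckFamily C) : ∀ {a b : DyckQuiver}, (a ⟶ b) → C
  | _, _, DyckArrow.T k i _ _ => g.T k i
  | _, _, DyckArrow.dMinus k => g.dm k
  | _, _, DyckArrow.dPlus k => g.dp k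

/-- The values of the arrows of the double Dyck quiver. -/
def DyckFamily.doubleArrowVal (g : DyckFamily C) (s : ℕ → C) :
    ∀ {a b : DoubleDyckQuiver}, (a ⟶ b) → C
  | _, _, DoubleDyckArrow.T k i _ _ => g.T k i
  | _, _, DoubleDyckArrow.dMinus k => g.dm k
  | _, _, DoubleDyckArrow.dPlus k => g.dp k
  | _, _, DoubleDyckArrow.dPlusStar k => s k

variable [IsScalarTower F C C] [SMulCommClass F C C]

/-- A family that satisfies the relations of the Dyck path algebra defines a unique
homomorphism. -/
theorem existsUnique_dyckAlg_hom (u : F) (g : DyckFamily C) (hg : g.IsQuiverRep)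
    (hrel : ∀ x y, g.Rel u x y → x = y) :
    ∃! ρ : DyckAlg F u →ₙₐ[F] C, (dyckGen F u).MapsTo ρ g := by
  let φ : PathAlgebra F DyckQuiver →ₙₐ[F] C :=
    pathHom (Q := DyckQuiver) g.e g.arrowVal hg.e_mul_e hg.e_mul_e_of_ne (by
      rintro _ _ (⟨k, i, h₁, h₂⟩ | k | k)
      · exact hg.e_mul_T _ i
      · exact hg.e_mul_dm _
      · exact hg.e_mul_dp _)
  have hφ : (dyckPaths F).MapsTo φ g := by
    refine ⟨fun k => pathHom_ofPath _ _ _ _ _ _, fun k i h₁ h₂ => ?_, fun k => ?_, fun k => ?_⟩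
    · simp only [dyckPaths, h₁, h₂, and_self, dite_true]
      -- An arrow, as a path, is appended to a trivial path, so its value carries an idempotent on
      -- the right that must be absorbed.
      exact (pathHom_ofPath _ _ _ _ _ _).trans (hg.T_mul_e k i)
    · exact (pathHom_ofPath _ _ _ _ _ _).trans (hg.dm_mul_e k)
    · exact (pathHom_ofPath _ _ _ _ _ _).trans (hg.dp_mul_e k)
  refine ⟨AlgQuot.lift _ φ fun x y h => hφ.rel u hrel h, hφ, fun ρ hρ => ?_⟩
  refine AlgQuot.hom_ext _ (pathAlgebra_hom_ext (fun k => (hρ.1 k).trans (hφ.1 k).symm) ?_)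
  rintro _ _ (⟨k, i, h₁, h₂⟩ | k | k)
  · have := (hρ.2.1 _ i h₁ h₂).trans (hφ.2.1 _ i h₁ h₂).symm
    have h : (dyckPaths F).T _ i = PathAlgebra.ofPath F
        (Quiver.Hom.toPath (V := DyckQuiver) (DyckArrow.T _ i h₁ h₂)) := dif_pos ⟨h₁, h₂⟩
    rw [← h]
    exact this
  · exact (hρ.2.2.1 _).trans (hφ.2.2.1 _).symm
  · exact (hρ.2.2.2 _).trans (hφ.2.2.2 _).symm

/-- Families that satisfy the relations of the double Dyck path algebra define a unique
homomorphism. -/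
theorem existsUnique_doubleDyckAlg_hom (q t : F) (g g' : DyckFamily C) (hg : g.IsQuiverRep)
    (he : g'.e = g.e) (hdm : g'.dm = g.dm) (hg' : g'.IsQuiverRep)
    (hT : ∀ k i, 1 ≤ i → i < k → g.Tinv q k i = g'.T k i)
    (hrel : ∀ x y, g.Rel q x y → x = y) (hrel' : ∀ x y, g'.Rel q⁻¹ x y → x = y)
    (hz : ∀ k i, 1 ≤ i → i ≤ k → g.dp k * g'.y q⁻¹ k i = g'.y q⁻¹ (k + 1) (i + 1) * g.dp k)
    (hy : ∀ k i, 1 ≤ i → i ≤ k → g'.dp k * g.y q k i = g.y q (k + 1) (i + 1) * g'.dp k)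
    (hzy : ∀ k, g'.y q⁻¹ (k + 1) 1 * g.dp k
      = -(t * q ^ (k + 1)) • (g.y q (k + 1) 1 * g'.dp k)) :
    ∃! σ : DoubleDyckAlg F q t →ₙₐ[F] C, (doubleGen F q t).MapsTo σ g ∧
      ∀ k, σ (doubleGenStar F q t k) = g'.dp k := by
  let φ : PathAlgebra F DoubleDyckQuiver →ₙₐ[F] C :=
    pathHom (Q := DoubleDyckQuiver) g.e (g.doubleArrowVal g'.dp) hg.e_mul_e hg.e_mul_e_of_ne (by
      rintro _ _ (⟨k, i, h₁, h₂⟩ | k | k | k)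
      · exact hg.e_mul_T _ i
      · exact hg.e_mul_dm _
      · exact hg.e_mul_dp _
      · rw [← he]
        exact hg'.e_mul_dp _)
  have hφ : (doublePaths F).MapsTo φ g := by
    refine ⟨fun k => pathHom_ofPath _ _ _ _ _ _, fun k i h₁ h₂ => ?_, fun k => ?_, fun k => ?_⟩
    · simp only [doublePaths, h₁, h₂, and_self, dite_true]
      exact (pathHom_ofPath _ _ _ _ _ _).trans (hg.T_mul_e k i)
    · exact (pathHom_ofPath _ _ _ _ _ _).trans (hg.dm_mul_e k)
    · exact (pathHom_ofPath _ _ _ _ _ _).trans (hg.dp_mul_e k)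
  have hφ' : (doublePathsStar F q).MapsTo φ g' := by
    refine ⟨fun k => ?_, fun k i h₁ h₂ => ?_, fun k => ?_, fun k => ?_⟩
    · rw [he]; exact hφ.1 k
    -- In the path algebra T_i⁻¹ is only a linear expression in T_i; `hT` matches its value with the
    -- second family.
    · exact (hφ.Tinv q k i h₁ h₂).trans (hT k i h₁ h₂)
    · rw [hdm]; exact hφ.2.2.1 k
    · refine (pathHom_ofPath _ _ _ _ _ _).trans ?_
      have := hg'.dp_mul_e k
      rwa [he] at this
  have hR : ∀ x y, DoubleRel F q t x y → φ x = φ y := by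
    intro x y h
    cases h with
    | first h => exact hφ.rel q hrel h
    | second h => exact hφ'.rel q⁻¹ hrel' h
    | dp_z k i h₁ h₂ =>
      rw [map_mul, map_mul, hφ.2.2.2, hφ'.y _ _ _ h₁ h₂, hφ'.y _ _ _ (by omega) (by omega)]
      exact hz k i h₁ h₂
    | dpStar_y k i h₁ h₂ =>
      rw [map_mul, map_mul, hφ'.2.2.2, hφ.y _ _ _ h₁ h₂, hφ.y _ _ _ (by omega) (by omega)]
      exact hy k i h₁ h₂
    | z_dp k =>
      rw [map_mul, map_smul, map_mul, hφ.2.2.2, hφ'.2.2.2, hφ'.y _ _ _ le_rfl (by omega),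
        hφ.y _ _ _ le_rfl (by omega)]
      exact hzy k
  refine ⟨AlgQuot.lift _ φ hR, ⟨hφ, hφ'.2.2.2⟩, fun σ hσ => ?_⟩
  obtain ⟨hσ, hσ'⟩ := hσ
  refine AlgQuot.hom_ext _ (pathAlgebra_hom_ext (fun k => (hσ.1 k).trans (hφ.1 k).symm) ?_)
  rintro _ _ (⟨k, i, h₁, h₂⟩ | k | k | k)
  · have := (hσ.2.1 _ i h₁ h₂).trans (hφ.2.1 _ i h₁ h₂).symm
    have h : (doublePaths F).T _ i = PathAlgebra.ofPath F
        (Quiver.Hom.toPath (V := DoubleDyckQuiver) (DoubleDyckArrow.T _ i h₁ h₂)) := dif_pos ⟨h₁, h₂⟩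
    rw [← h]
    exact this
  · exact (hσ.2.2.1 _).trans (hφ.2.2.1 _).symm
  · exact (hσ.2.2.2 _).trans (hφ.2.2.2 _).symm
  · exact (hσ' _).trans (hφ'.2.2.2 _).symm

end Actions

/-! ### Uniqueness for a linear differential equation of power series -/

section PowerSeriesLemmas

variable {R : Type} [CommRing R]

/-- A power series over a `ℚ`-algebra that solves a homogeneous linear differential equation of
first order and has constant term zero vanishes. -/
theorem powerSeries_eq_zero_of_derivative_eq_mul [Algebra ℚ R] {f c : PowerSeries R}
    (h : PowerSeries.derivative R f = c * f) (h0 : PowerSeries.constantCoeff f = 0) : f = 0 := by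
  have key : ∀ n, ∀ m ≤ n, PowerSeries.coeff m f = 0 := by
    intro n
    induction n with
    | zero =>
      intro m hm
      obtain rfl : m = 0 := by omega
      rwa [PowerSeries.coeff_zero_eq_constantCoeff_apply]
    | succ n ih =>
      intro m hm
      rcases Nat.lt_or_ge m (n + 1) with hm' | hm'
      · exact ih m (by omega)
      obtain rfl : m = n + 1 := by omega
      have h1 := congrArg (PowerSeries.coeff n) h
      rw [PowerSeries.coeff_derivative, PowerSeries.coeff_mul, Finset.sum_eq_zero] at h1
      · have h2 : ((n : ℚ) + 1) • PowerSeries.coeff (n + 1) f = 0 := by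
          rw [Algebra.smul_def, mul_comm, ← h1]
          simp
        have h3 : ((n : ℚ) + 1) ≠ 0 := by positivity
        rw [← inv_smul_smul₀ h3 (PowerSeries.coeff (n + 1) f), h2, smul_zero]
      · rintro ⟨i, j⟩ hij
        rw [ih j (by have := Finset.HasAntidiagonal.mem_antidiagonal.mp hij; simp only at this; omega),
          mul_zero]
  ext n
  rw [key n n le_rfl, map_zero]

/-- The geometric series. -/
theorem one_sub_C_mul_X_mul_mk_pow (c : R) :
    (1 - PowerSeries.C c * PowerSeries.X) * PowerSeries.mk (fun n => c ^ n) = 1 := by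
  ext n
  rw [sub_mul, one_mul, map_sub, PowerSeries.coeff_mk, mul_assoc, PowerSeries.coeff_C_mul,
    PowerSeries.coeff_one]
  cases n with
  | zero => simp
  | succ n => simp [PowerSeries.coeff_succ_X_mul, pow_succ']

end PowerSeriesLemmas

/-! ### The differential equation of Exp[-zX] -/

section ExpNeg

variable {K : Type} [Field K]

theorem constantCoeff_expArg (a : ℕ+ → SymFun K) :
    PowerSeries.constantCoeff (PowerSeries.mk fun n : ℕ =>
      if h : 0 < n then ((n : K)⁻¹ • a (n.toPNat h) : SymFun K) else 0) = 0 := by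
  rw [← PowerSeries.coeff_zero_eq_constantCoeff_apply, PowerSeries.coeff_mk]
  simp

theorem hasSubst_expArg (a : ℕ+ → SymFun K) :
    PowerSeries.HasSubst (PowerSeries.mk fun n : ℕ =>
      if h : 0 < n then ((n : K)⁻¹ • a (n.toPNat h) : SymFun K) else 0) := by
  exact PowerSeries.HasSubst.of_constantCoeff_zero' (constantCoeff_expArg a)

/-- Chain rule, with the factors n cancelling the denominators in ∑ p_n z^n/n. Besides the constant
term 1, this is all that is used about the exponential. -/
theorem derivative_expNeg [CharZero K] : PowerSeries.derivative (SymFun K) (expNeg (K := K))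
    = -(PowerSeries.mk fun n => pSum n.succPNat) * expNeg := by
  refine (PowerSeries.derivative_subst (hasSubst_expArg fun n => -pSum n)).trans ?_
  rw [PowerSeries.derivative_exp, mul_comm]
  refine congrArg (· * _) ?_
  ext1 n
  have hn : (n : K) + 1 ≠ 0 := by exact_mod_cast Nat.succ_ne_zero n
  rw [PowerSeries.coeff_derivative, PowerSeries.coeff_mk, dif_pos (Nat.succ_pos n), map_neg,
    PowerSeries.coeff_mk]
  have : ((n : SymFun K) + 1) = algebraMap K (SymFun K) ((n : K) + 1) := by simp
  rw [this, mul_comm, ← Algebra.smul_def, Nat.cast_succ, smul_inv_smul₀ hn]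
  rfl

theorem constantCoeff_expNeg [CharZero K] :
    PowerSeries.constantCoeff (expNeg (K := K)) = 1 := by
  refine (PowerSeries.constantCoeff_subst (hasSubst_expArg fun n => -pSum n) _).trans ?_
  rw [finsum_eq_single _ 0]
  · simp
  · intro n hn
    rw [map_pow]
    refine (congrArg (fun x => _ • x ^ n) (constantCoeff_expArg fun n => -pSum n)).trans ?_
    rw [zero_pow hn, smul_zero]

end ExpNeg

/-! ### Constant terms under a change of alphabet -/

section CtExp

variable (K : Type) [Field K] [CharZero K] {R S : Type} [CommRing R] [Algebra K R] [CommRing S]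
  [Algebra K S]

/-- The coefficient of `z^j` in `Exp[-z A]`, where the alphabet `A` is given through the elements
`a n = p_n[A]` of `R`. -/
def expCoeff (a : ℕ+ → R) (j : ℕ) : R :=
  MvPolynomial.aeval a (PowerSeries.coeff j (expNeg (K := K)))

/-- The series `Exp[-z A]`. -/
def expSeries (a : ℕ+ → R) : PowerSeries R :=
  PowerSeries.map (MvPolynomial.aeval a : SymFun K →ₐ[K] R).toRingHom expNeg

theorem coeff_expSeries (a : ℕ+ → R) (j : ℕ) :
    PowerSeries.coeff j (expSeries K a) = expCoeff K a j := rfl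

theorem expCoeff_zero (a : ℕ+ → R) : expCoeff K a 0 = 1 := by
  rw [expCoeff, PowerSeries.coeff_zero_eq_constantCoeff_apply, constantCoeff_expNeg, map_one]

theorem derivative_expSeries (a : ℕ+ → R) : PowerSeries.derivative R (expSeries K a)
    = -(PowerSeries.mk fun n => a n.succPNat) * expSeries K a := by
  have h := congrArg (PowerSeries.map (MvPolynomial.aeval a : SymFun K →ₐ[K] R).toRingHom)
    (derivative_expNeg (K := K))
  rw [map_mul, map_neg] at h
  have h1 : PowerSeries.map (MvPolynomial.aeval a : SymFun K →ₐ[K] R).toRingHom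
      (PowerSeries.derivative (SymFun K) (expNeg (K := K)))
      = PowerSeries.derivative R (expSeries K a) := by
    ext n
    simp [expSeries, PowerSeries.coeff_derivative]
  have h2 : PowerSeries.map (MvPolynomial.aeval a : SymFun K →ₐ[K] R).toRingHom
      (PowerSeries.mk fun n => pSum n.succPNat) = PowerSeries.mk fun n => a n.succPNat := by
    ext n
    simp [pSum]
  rw [← h1, h, h2]
  rfl

/-- `Exp[-z(A + c - d)] (1 - d z) = Exp[-z A] (1 - c z)`. -/
theorem expSeries_shift {a a' : ℕ+ → R} {c d : R} (h : ∀ n : ℕ+, a' n + d ^ (n : ℕ)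
    = a n + c ^ (n : ℕ)) :
    (1 - PowerSeries.C d * PowerSeries.X) * expSeries K a'
      = (1 - PowerSeries.C c * PowerSeries.X) * expSeries K a := by
  let _ : Algebra ℚ R := ((algebraMap K R).comp (algebraMap ℚ K)).toAlgebra
  have hA : (PowerSeries.mk fun n => a' n.succPNat)
      + PowerSeries.C d * PowerSeries.mk (fun n => d ^ n)
      = (PowerSeries.mk fun n => a n.succPNat)
        + PowerSeries.C c * PowerSeries.mk (fun n => c ^ n) := by
    ext n
    have := h n.succPNat
    simpa [PowerSeries.coeff_C_mul, pow_succ'] using this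
  have hc := one_sub_C_mul_X_mul_mk_pow c
  have hd := one_sub_C_mul_X_mul_mk_pow d
  have hdc : ∀ c : R, PowerSeries.derivative R (1 - PowerSeries.C c * PowerSeries.X)
      = -PowerSeries.C c := fun c => by
    rw [map_sub, Derivation.leibniz]
    simp [PowerSeries.derivative_C, PowerSeries.derivative_X]
  rw [← sub_eq_zero]
  refine powerSeries_eq_zero_of_derivative_eq_mul (c := -((PowerSeries.mk fun n => a n.succPNat)
        + PowerSeries.C c * PowerSeries.mk (fun n => c ^ n))) ?_ ?_
  · rw [map_sub, Derivation.leibniz, Derivation.leibniz, derivative_expSeries,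
      derivative_expSeries, hdc, hdc]
    simp only [smul_eq_mul]
    generalize expSeries K a = E at *
    generalize expSeries K a' = E' at *
    generalize PowerSeries.mk (fun n => a n.succPNat) = A at *
    generalize PowerSeries.mk (fun n => a' n.succPNat) = A' at *
    generalize PowerSeries.mk (fun n => c ^ n) = gc at *
    generalize PowerSeries.mk (fun n => d ^ n) = gd at *
    linear_combination (-(1 - PowerSeries.C d * PowerSeries.X) * E') * hA
      + PowerSeries.C d * E' * hd - PowerSeries.C c * E * hc
  · have h1 : ∀ b : ℕ+ → R, PowerSeries.constantCoeff (expSeries K b) = 1 := fun b => by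
      rw [← PowerSeries.coeff_zero_eq_constantCoeff_apply, coeff_expSeries, expCoeff_zero]
    simp [h1]

theorem expCoeff_shift {a a' : ℕ+ → R} {c d : R} (h : ∀ n : ℕ+, a' n + d ^ (n : ℕ)
    = a n + c ^ (n : ℕ)) (j : ℕ) :
    expCoeff K a' (j + 1) - d * expCoeff K a' j = expCoeff K a (j + 1) - c * expCoeff K a j := by
  have := congrArg (PowerSeries.coeff (j + 1)) (expSeries_shift K h)
  simpa only [sub_mul, one_mul, map_sub, mul_assoc, PowerSeries.coeff_C_mul,
    PowerSeries.coeff_succ_X_mul, coeff_expSeries] using this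

theorem map_expCoeff (φ : R →ₐ[K] S) (a : ℕ+ → R) (j : ℕ) :
    φ (expCoeff K a j) = expCoeff K (fun n => φ (a n)) j := by
  rw [expCoeff, expCoeff, ← AlgHom.comp_apply, MvPolynomial.comp_aeval]

/-- The constant term in `w` of `G(w) Exp[-w⁻¹ A]`, for a polynomial `G`. -/
def ctExp (a : ℕ+ → R) : Polynomial R →ₗ[R] R :=
  Polynomial.lsum fun j => LinearMap.mulRight R (expCoeff K a j)

theorem ctExp_monomial (a : ℕ+ → R) (j : ℕ) (r : R) :
    ctExp K a (Polynomial.monomial j r) = r * expCoeff K a j := by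
  rw [ctExp, Polynomial.lsum_apply, Polynomial.sum_monomial_index]
  · rfl
  · simp

theorem ctExp_C (a : ℕ+ → R) (r : R) : ctExp K a (Polynomial.C r) = r := by
  rw [← Polynomial.monomial_zero_left, ctExp_monomial, expCoeff_zero, mul_one]

theorem ctExp_C_mul (a : ℕ+ → R) (r : R) (G : Polynomial R) :
    ctExp K a (Polynomial.C r * G) = r * ctExp K a G := by
  rw [← Polynomial.smul_eq_C_mul, map_smul, smul_eq_mul]

theorem map_ctExp (φ : R →ₐ[K] S) (a : ℕ+ → R) (G : Polynomial R) :
    φ (ctExp K a G) = ctExp K (fun n => φ (a n)) (G.map (φ : R →+* S)) := by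
  induction G using Polynomial.induction_on' with
  | add F G hF hG => rw [map_add, map_add, hF, hG, Polynomial.map_add, map_add]
  | monomial n r =>
    rw [Polynomial.map_monomial, ctExp_monomial, ctExp_monomial, map_mul, map_expCoeff]
    rfl

/-- This is the shift of exponentials at z = w⁻¹, after multiplying 1 - d w⁻¹ and 1 - c w⁻¹ by w. -/
theorem ctExp_X_sub_C_mul {a a' : ℕ+ → R} {c d : R} (h : ∀ n : ℕ+, a' n + d ^ (n : ℕ)
    = a n + c ^ (n : ℕ)) (G : Polynomial R) :
    ctExp K a' ((Polynomial.X - Polynomial.C d) * G)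
      = ctExp K a ((Polynomial.X - Polynomial.C c) * G) := by
  induction G using Polynomial.induction_on' with
  | add F G hF hG => rw [mul_add, map_add, hF, hG, mul_add, map_add]
  | monomial n r =>
    have key : ∀ (b : ℕ+ → R) (e : R), ctExp K b ((Polynomial.X - Polynomial.C e)
        * Polynomial.monomial n r) = r * (expCoeff K b (n + 1) - e * expCoeff K b n) := by
      intro b e
      rw [sub_mul, map_sub, ctExp_C_mul, Polynomial.X_mul_monomial, ctExp_monomial, ctExp_monomial]
      ring
    rw [key, key, expCoeff_shift K h]

/-- The effect of a change of alphabets on constant terms, expressed through a divided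
difference `N` of `G`. -/
theorem ctExp_shift {a a' : ℕ+ → R} {c d : R} (h : ∀ n : ℕ+, a' n + d ^ (n : ℕ)
    = a n + c ^ (n : ℕ)) {G N : Polynomial R} {g : R}
    (hN : (Polynomial.X - Polynomial.C d) * N = G - Polynomial.C g) :
    ctExp K a' G = ctExp K a (G + Polynomial.C (d - c) * N) := by
  have hG : G = (Polynomial.X - Polynomial.C d) * N + Polynomial.C g := by rw [hN]; ring
  have : G + Polynomial.C (d - c) * N = (Polynomial.X - Polynomial.C c) * N + Polynomial.C g := by
    rw [hG, Polynomial.C_sub]; ring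
  rw [this, map_add, ← ctExp_X_sub_C_mul K h, hG, map_add, ctExp_C, ctExp_C]

theorem exists_X_sub_C_mul_eq (G : Polynomial R) (d : R) :
    ∃ N : Polynomial R, (Polynomial.X - Polynomial.C d) * N = G - Polynomial.C (G.eval d) := by
  obtain ⟨N, hN⟩ := Polynomial.X_sub_C_dvd_sub_C_eval (a := d) (p := G)
  exact ⟨N, hN.symm⟩

end CtExp

/-! ### Plethystic substitutions and exchanges of variables -/

section Substitutions

variable {K : Type} [Field K] {k l : ℕ} {R S : Type} [CommRing R] [Algebra K R] [CommRing S]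
  [Algebra K S]

theorem pleth_C_pSum (a : ℕ+ → R) (b : Fin k → R) (n : ℕ+) :
    pleth a b (MvPolynomial.C (pSum n) : V K k) = a n := by
  rw [pleth, MvPolynomial.aevalTower_C, pSum, MvPolynomial.aeval_X]

theorem pleth_X (a : ℕ+ → R) (b : Fin k → R) (i : Fin k) :
    pleth a b (MvPolynomial.X i : V K k) = b i := by
  rw [pleth, MvPolynomial.aevalTower_X]

/-- The p_n and y_i generate V_k, so identities between composite substitutions are checked on them.
-/
theorem algHom_ext_V {φ ψ : V K k →ₐ[K] R}
    (hp : ∀ n : ℕ+, φ (MvPolynomial.C (pSum n)) = ψ (MvPolynomial.C (pSum n)))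
    (hX : ∀ i, φ (MvPolynomial.X i) = ψ (MvPolynomial.X i)) : φ = ψ := by
  refine AlgHom.ext fun F => ?_
  have hC : ∀ f : SymFun K, φ (MvPolynomial.C f) = ψ (MvPolynomial.C f) := by
    intro f
    have : (φ.comp (IsScalarTower.toAlgHom K (SymFun K) (V K k)))
        = ψ.comp (IsScalarTower.toAlgHom K (SymFun K) (V K k)) :=
      MvPolynomial.algHom_ext hp
    exact DFunLike.congr_fun this f
  induction F using MvPolynomial.induction_on with
  | C f => exact hC f
  | add F G hF hG => rw [map_add, map_add, hF, hG]
  | mul_X F i hF => rw [map_mul, map_mul, hF, hX]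

/-- The operator interchanging two of the variables `y`, as a homomorphism of `K`-algebras. -/
def swapHom (a b : Fin k) : V K k →ₐ[K] V K k := (swapY a b).restrictScalars K

theorem swapHom_C (a b : Fin k) (f : SymFun K) :
    swapHom a b (MvPolynomial.C f) = MvPolynomial.C f := MvPolynomial.rename_C _ _

theorem swapHom_X (a b i : Fin k) :
    swapHom a b (MvPolynomial.X i : V K k) = MvPolynomial.X (Equiv.swap a b i) :=
  MvPolynomial.rename_X _ _

theorem swapHom_comm {a b c d : Fin k} (hab : a ≠ b) (hcd : c ≠ d) (hac : a ≠ c)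
    (had : a ≠ d) (hbc : b ≠ c) (hbd : b ≠ d) (F : V K k) :
    swapHom a b (swapHom c d F) = swapHom c d (swapHom a b F) := by
  change MvPolynomial.rename _ (MvPolynomial.rename _ F)
    = MvPolynomial.rename _ (MvPolynomial.rename _ F)
  rw [MvPolynomial.rename_rename, MvPolynomial.rename_rename]
  congr 2
  have : Equiv.swap a b * Equiv.swap c d = Equiv.swap c d * Equiv.swap a b :=
    (Equiv.Perm.disjoint_swap_swap (by simp [*, Ne.symm]) ).commute
  exact congrArg DFunLike.coe this

theorem swapHom_braid {a b c : Fin k} (hab : a ≠ b) (hac : a ≠ c) (hbc : b ≠ c)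
    (F : V K k) : swapHom a b (swapHom b c (swapHom a b F))
      = swapHom b c (swapHom a b (swapHom b c F)) := by
  change MvPolynomial.rename _ (MvPolynomial.rename _ (MvPolynomial.rename _ F))
    = MvPolynomial.rename _ (MvPolynomial.rename _ (MvPolynomial.rename _ F))
  simp only [MvPolynomial.rename_rename]
  congr 2
  have h1 : Equiv.swap b c * Equiv.swap a b * Equiv.swap b c = Equiv.swap c a :=
    Equiv.swap_mul_swap_mul_swap hab hac
  have h2 : Equiv.swap b a * Equiv.swap c b * Equiv.swap b a = Equiv.swap a c :=
    Equiv.swap_mul_swap_mul_swap hbc.symm hac.symm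
  have h3 : Equiv.swap a b * Equiv.swap b c * Equiv.swap a b
      = Equiv.swap b c * Equiv.swap a b * Equiv.swap b c := by
    rw [h1, Equiv.swap_comm c a, ← h2, Equiv.swap_comm b a, Equiv.swap_comm c b]
  exact congrArg DFunLike.coe h3

theorem swapHom_swapHom (a b : Fin k) (F : V K k) : swapHom a b (swapHom a b F) = F := by
  change MvPolynomial.rename _ (MvPolynomial.rename _ F) = F
  rw [MvPolynomial.rename_rename]
  have : (Equiv.swap a b : Fin k → Fin k) ∘ Equiv.swap a b = id := by
    funext i; simp
  rw [this, MvPolynomial.rename_id_apply]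

end Substitutions

/-! ### Hecke relations for the divided-difference operators -/

section Hecke

variable {K : Type} [Field K] (q : K) {k : ℕ} {R : Type} [CommRing R] [Algebra K R]

/-- The form in which T enters later computations: φ will be an exchange of variables, the embedding
into the fraction field, or a lowering substitution. -/
theorem map_heckeAux (φ : V K k →ₐ[K] R) {a b : Fin k} (h : a ≠ b) (F : V K k) :
    (φ (MvPolynomial.X b) - φ (MvPolynomial.X a)) * φ (heckeAux q a b h F)
      = (algebraMap K R q - 1) * (φ (MvPolynomial.X a) * φ F)
        + (φ (MvPolynomial.X b) - algebraMap K R q * φ (MvPolynomial.X a))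
          * φ (swapHom a b F) := by
  have := congrArg φ (heckeAux_spec q a b h F)
  rw [map_mul, map_add, map_mul, map_sub, map_sub, map_smul, map_smul, map_mul] at this
  rw [this, Algebra.smul_def, Algebra.smul_def, map_sub, map_one]
  rfl

theorem heckeAux_spec' {a b : Fin k} (h : a ≠ b) (F : V K k) :
    (MvPolynomial.X b - MvPolynomial.X a) * heckeAux q a b h F
      = (algebraMap K (V K k) q - 1) * (MvPolynomial.X a * F)
        + (MvPolynomial.X b - algebraMap K (V K k) q * MvPolynomial.X a) * swapHom a b F :=
  map_heckeAux q (AlgHom.id K (V K k)) h F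

theorem heckeAux_eq_of_mul_eq {a b : Fin k} (h : a ≠ b) {F G : V K k}
    (hG : (MvPolynomial.X b - MvPolynomial.X a) * G
      = (algebraMap K (V K k) q - 1) * (MvPolynomial.X a * F)
        + (MvPolynomial.X b - algebraMap K (V K k) q * MvPolynomial.X a) * swapHom a b F) :
    heckeAux q a b h F = G :=
  mul_left_cancel₀ (X_sub_X_ne_zero h) ((heckeAux_spec' q h F).trans hG.symm)

theorem heckeAux_mul_of_swapHom_eq {a b : Fin k} (h : a ≠ b) {G : V K k}
    (hG : swapHom a b G = G) (F : V K k) :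
    heckeAux q a b h (G * F) = G * heckeAux q a b h F := by
  apply heckeAux_eq_of_mul_eq
  rw [map_mul, hG]
  linear_combination G * heckeAux_spec' q h F

theorem heckeAux_eq_self {a b : Fin k} (h : a ≠ b) {F : V K k} (hF : swapHom a b F = F) :
    heckeAux q a b h F = F := by
  apply heckeAux_eq_of_mul_eq
  rw [hF]
  ring

theorem heckeAux_quadratic {a b : Fin k} (h : a ≠ b) (F : V K k) :
    heckeAux q a b h (heckeAux q a b h F)
      = (1 - algebraMap K (V K k) q) * heckeAux q a b h F + algebraMap K (V K k) q * F := by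
  have h1 := heckeAux_spec' q h F
  have h2 := heckeAux_spec' q h (heckeAux q a b h F)
  have h3 := map_heckeAux q (swapHom a b) h F
  rw [swapHom_X, swapHom_X, Equiv.swap_apply_left, Equiv.swap_apply_right, swapHom_swapHom] at h3
  -- Two divisions by y_b - y_a are cleared; `h3` gives the exchanged value of T F, which occurs in
  -- the numerator of T² F.
  apply mul_left_cancel₀ (mul_ne_zero (X_sub_X_ne_zero (K := K) h) (X_sub_X_ne_zero h))
  linear_combination (MvPolynomial.X b - MvPolynomial.X a) * h2
    + (algebraMap K (V K k) q - 1) * MvPolynomial.X b * h1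
    - (MvPolynomial.X b - algebraMap K (V K k) q * MvPolynomial.X a) * h3

/-- This affine Hecke relation makes multiplication by the variables obey the recursion y_{i+1} = q
T_i⁻¹ y_i T_i⁻¹. -/
theorem heckeAux_X_mul_heckeAux {a b : Fin k} (h : a ≠ b) (F : V K k) :
    heckeAux q a b h (MvPolynomial.X b * heckeAux q a b h F)
      = algebraMap K (V K k) q * (MvPolynomial.X a * F) := by
  have h1 := heckeAux_spec' q h F
  have h3 := map_heckeAux q (swapHom a b) h F
  rw [swapHom_X, swapHom_X, Equiv.swap_apply_left, Equiv.swap_apply_right, swapHom_swapHom] at h3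
  apply heckeAux_eq_of_mul_eq
  rw [map_mul, swapHom_X, Equiv.swap_apply_right]
  apply mul_left_cancel₀ (X_sub_X_ne_zero (K := K) h)
  linear_combination -(algebraMap K (V K k) q - 1) * MvPolynomial.X a * MvPolynomial.X b * h1
    + (MvPolynomial.X b - algebraMap K (V K k) q * MvPolynomial.X a) * MvPolynomial.X a * h3

/-- `F1`, `F2`, `F12` stand for F with a, b exchanged, with c, d exchanged, and with both; with
these as independent symbols only rational functions of a, b, c, d have to be compared. -/
theorem far_field {A : Type} [Field A] {Q a b c d F F1 F2 F12 G G2 H G' G1' H' : A}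
    (hab : b - a ≠ 0) (hcd : d - c ≠ 0)
    (h1 : (b - a) * G = (Q - 1) * (a * F) + (b - Q * a) * F1)
    (h2 : (b - a) * G2 = (Q - 1) * (a * F2) + (b - Q * a) * F12)
    (h3 : (d - c) * H = (Q - 1) * (c * G) + (d - Q * c) * G2)
    (h1' : (d - c) * G' = (Q - 1) * (c * F) + (d - Q * c) * F2)
    (h2' : (d - c) * G1' = (Q - 1) * (c * F1) + (d - Q * c) * F12)
    (h3' : (b - a) * H' = (Q - 1) * (a * G') + (b - Q * a) * G1') : H = H' := by
  rw [mul_comm] at h1 h2 h3 h1' h2' h3'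
  rw [eq_div_of_mul_eq hcd h3, eq_div_of_mul_eq hab h3', eq_div_of_mul_eq hab h1,
    eq_div_of_mul_eq hab h2, eq_div_of_mul_eq hcd h1', eq_div_of_mul_eq hcd h2']
  field_simp
  ring

theorem heckeAux_comm {a b c d : Fin k} (hab : a ≠ b) (hcd : c ≠ d) (hac : a ≠ c) (had : a ≠ d)
    (hbc : b ≠ c) (hbd : b ≠ d) (F : V K k) :
    heckeAux q a b hab (heckeAux q c d hcd F) = heckeAux q c d hcd (heckeAux q a b hab F) := by
  let ι := (IsScalarTower.toAlgHom K (V K k) (FractionRing (V K k)))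
  have hι : Function.Injective ι := IsFractionRing.injective (V K k) (FractionRing (V K k))
  have hne : ∀ {a b : Fin k}, a ≠ b → ι (MvPolynomial.X b) - ι (MvPolynomial.X a) ≠ 0 := by
    intro a b h
    rw [← map_sub, ← map_zero ι]
    exact hι.ne (X_sub_X_ne_zero h)
  have h2 := map_heckeAux q (ι.comp (swapHom c d)) hab F
  have h2' := map_heckeAux q (ι.comp (swapHom a b)) hcd F
  simp only [AlgHom.comp_apply, swapHom_X, Equiv.swap_apply_of_ne_of_ne hac had,
    Equiv.swap_apply_of_ne_of_ne hbc hbd] at h2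
  simp only [AlgHom.comp_apply, swapHom_X, Equiv.swap_apply_of_ne_of_ne hac.symm hbc.symm,
    Equiv.swap_apply_of_ne_of_ne had.symm hbd.symm, swapHom_comm hab hcd hac had hbc hbd] at h2'
  refine hι (far_field (hne hcd) (hne hab) (map_heckeAux q ι hcd F) h2' (map_heckeAux q ι hab _)
    (map_heckeAux q ι hab F) h2 (map_heckeAux q ι hcd _))

/-- Both triple products are expressed through the six permuted copies of F, and their coefficients
agree as rational functions. -/
theorem braid_field {A : Type} [Field A] {Q a b c F F1 F2 F12 F21 F121 G G1 G2 G12 H H1 L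
    G' G2' G1' G21' H' H2' L' : A} (hab : b - a ≠ 0) (hac : c - a ≠ 0) (hbc : c - b ≠ 0)
    (h1 : (b - a) * G = (Q - 1) * (a * F) + (b - Q * a) * F1)
    (h2 : (a - b) * G1 = (Q - 1) * (b * F1) + (a - Q * b) * F)
    (h3 : (c - a) * G2 = (Q - 1) * (a * F2) + (c - Q * a) * F21)
    (h4 : (c - b) * G12 = (Q - 1) * (b * F12) + (c - Q * b) * F121)
    (h5 : (c - b) * H = (Q - 1) * (b * G) + (c - Q * b) * G2)
    (h6 : (c - a) * H1 = (Q - 1) * (a * G1) + (c - Q * a) * G12)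
    (h7 : (b - a) * L = (Q - 1) * (a * H) + (b - Q * a) * H1)
    (h1' : (c - b) * G' = (Q - 1) * (b * F) + (c - Q * b) * F2)
    (h2' : (b - c) * G2' = (Q - 1) * (c * F2) + (b - Q * c) * F)
    (h3' : (c - a) * G1' = (Q - 1) * (a * F1) + (c - Q * a) * F12)
    (h4' : (b - a) * G21' = (Q - 1) * (a * F21) + (b - Q * a) * F121)
    (h5' : (b - a) * H' = (Q - 1) * (a * G') + (b - Q * a) * G1')
    (h6' : (c - a) * H2' = (Q - 1) * (a * G2') + (c - Q * a) * G21')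
    (h7' : (c - b) * L' = (Q - 1) * (b * H') + (c - Q * b) * H2') : L = L' := by
  have hba : a - b ≠ 0 := by rwa [← neg_ne_zero, neg_sub]
  have hcb : b - c ≠ 0 := by rwa [← neg_ne_zero, neg_sub]
  rw [mul_comm] at h1 h2 h3 h4 h5 h6 h7 h1' h2' h3' h4' h5' h6' h7'
  rw [eq_div_of_mul_eq hab h7, eq_div_of_mul_eq hbc h7', eq_div_of_mul_eq hac h6,
    eq_div_of_mul_eq hac h6', eq_div_of_mul_eq hbc h5, eq_div_of_mul_eq hab h5',
    eq_div_of_mul_eq hab h1, eq_div_of_mul_eq hba h2, eq_div_of_mul_eq hac h3,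
    eq_div_of_mul_eq hbc h4, eq_div_of_mul_eq hbc h1', eq_div_of_mul_eq hcb h2',
    eq_div_of_mul_eq hac h3', eq_div_of_mul_eq hab h4',
    show a - b = -(b - a) by ring, show b - c = -(c - b) by ring]
  field_simp
  ring

theorem heckeAux_braid {a b c : Fin k} (hab : a ≠ b) (hbc : b ≠ c) (hac : a ≠ c) (F : V K k) :
    heckeAux q a b hab (heckeAux q b c hbc (heckeAux q a b hab F))
      = heckeAux q b c hbc (heckeAux q a b hab (heckeAux q b c hbc F)) := by
  let ι := (IsScalarTower.toAlgHom K (V K k) (FractionRing (V K k)))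
  have hι : Function.Injective ι := IsFractionRing.injective (V K k) (FractionRing (V K k))
  have hne : ∀ {a b : Fin k}, a ≠ b → ι (MvPolynomial.X b) - ι (MvPolynomial.X a) ≠ 0 := by
    intro a b h
    rw [← map_sub, ← map_zero ι]
    exact hι.ne (X_sub_X_ne_zero h)
  have e1 : Equiv.swap a b c = c := Equiv.swap_apply_of_ne_of_ne hac.symm hbc.symm
  have e2 : Equiv.swap b c a = a := Equiv.swap_apply_of_ne_of_ne hab hac
  have s2 := map_heckeAux q (ι.comp (swapHom a b)) hab F
  have s3 := map_heckeAux q (ι.comp (swapHom b c)) hab F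
  have s4 := map_heckeAux q (ι.comp ((swapHom a b).comp (swapHom b c))) hab F
  have s6 := map_heckeAux q (ι.comp (swapHom a b)) hbc (heckeAux q a b hab F)
  have t2 := map_heckeAux q (ι.comp (swapHom b c)) hbc F
  have t3 := map_heckeAux q (ι.comp (swapHom a b)) hbc F
  have t4 := map_heckeAux q (ι.comp ((swapHom b c).comp (swapHom a b))) hbc F
  have t6 := map_heckeAux q (ι.comp (swapHom b c)) hab (heckeAux q b c hbc F)
  simp only [AlgHom.comp_apply, swapHom_X, Equiv.swap_apply_left, Equiv.swap_apply_right, e1, e2,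
    swapHom_swapHom] at s2 s3 s4 s6 t2 t3 t4 t6
  rw [← swapHom_braid hab hac hbc] at t4
  exact hι (braid_field (hne hab) (hne hac) (hne hbc) (map_heckeAux q ι hab F) s2 s3 s4
    (map_heckeAux q ι hbc _) s6 (map_heckeAux q ι hab _) (map_heckeAux q ι hbc F) t2 t3 t4
    (map_heckeAux q ι hab _) t6 (map_heckeAux q ι hbc _))

end Hecke

/-! ### Values of the substitutions on generators -/

section Generators

variable {K : Type} [Field K] (q t : K) {k : ℕ} {R S : Type} [CommRing R] [Algebra K R]
  [CommRing S] [Algebra K S]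

theorem algHom_congr_V {φ ψ : V K k →ₐ[K] R} (F : V K k)
    (hp : ∀ n : ℕ+, φ (MvPolynomial.C (pSum n)) = ψ (MvPolynomial.C (pSum n)))
    (hX : ∀ i, φ (MvPolynomial.X i) = ψ (MvPolynomial.X i)) : φ F = ψ F :=
  DFunLike.congr_fun (algHom_ext_V hp hX) F

theorem lowerSubst_C (n : ℕ+) : lowerSubst q k (MvPolynomial.C (pSum n))
    = Polynomial.C (MvPolynomial.C (pSum n))
      - (algebraMap K _ q ^ (n : ℕ) - 1) * Polynomial.X ^ (n : ℕ) := by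
  rw [lowerSubst, pleth_C_pSum, Algebra.smul_def, map_sub, map_pow, map_one]

theorem lowerSubst_X_castSucc (i : Fin k) : lowerSubst q k (MvPolynomial.X i.castSucc)
    = Polynomial.C (MvPolynomial.X i) := by
  rw [lowerSubst, pleth_X, Fin.lastCases_castSucc]

theorem lowerSubst_X_last : lowerSubst q k (MvPolynomial.X (Fin.last k)) = Polynomial.X := by
  rw [lowerSubst, pleth_X, Fin.lastCases_last]

theorem raiseSubst_C (n : ℕ+) : raiseSubst q k (MvPolynomial.C (pSum n))
    = MvPolynomial.C (pSum n)
      + (algebraMap K _ q ^ (n : ℕ) - 1) * MvPolynomial.X (Fin.last k) ^ (n : ℕ) := by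
  rw [raiseSubst, pleth_C_pSum, Algebra.smul_def, map_sub, map_pow, map_one]

theorem raiseSubst_X (i : Fin k) : raiseSubst q k (MvPolynomial.X i)
    = MvPolynomial.X i.castSucc := by
  rw [raiseSubst, pleth_X]

theorem gammaHom_C (n : ℕ+) : gammaHom t k (MvPolynomial.C (pSum n))
    = MvPolynomial.C (pSum n) := by
  rw [gammaHom, pleth_C_pSum]

theorem gammaHom_X_castSucc (i : Fin k) : gammaHom t k (MvPolynomial.X i.castSucc)
    = MvPolynomial.X i.succ := by
  rw [gammaHom, pleth_X, Fin.lastCases_castSucc]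

theorem gammaHom_X_last : gammaHom t k (MvPolynomial.X (Fin.last k))
    = algebraMap K _ t * MvPolynomial.X 0 := by
  rw [gammaHom, pleth_X, Fin.lastCases_last, Algebra.smul_def]

/-- The operator `d₊^*` as a homomorphism of algebras. -/
def starHom (k : ℕ) : V K k →ₐ[K] V K (k + 1) := (gammaHom t k).comp (raiseSubst q k)

theorem opDpStar_apply (F : V K k) : opDpStar q t k F = starHom q t k F := rfl

theorem starHom_C (n : ℕ+) : starHom q t k (MvPolynomial.C (pSum n))
    = MvPolynomial.C (pSum n) + (algebraMap K _ q ^ (n : ℕ) - 1)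
      * (algebraMap K _ t * MvPolynomial.X 0) ^ (n : ℕ) := by
  rw [starHom, AlgHom.comp_apply, raiseSubst_C, map_add, map_mul, map_sub, map_pow, map_pow,
    gammaHom_C, gammaHom_X_last, map_one, AlgHom.commutes]

theorem starHom_X (i : Fin k) : starHom q t k (MvPolynomial.X i) = MvPolynomial.X i.succ := by
  rw [starHom, AlgHom.comp_apply, raiseSubst_X, gammaHom_X_castSucc]

/-- The homomorphism of polynomial rings induced by a homomorphism of coefficients. -/
def polyMap (φ : R →ₐ[K] S) : Polynomial R →ₐ[K] Polynomial S := Polynomial.mapAlgHom φ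

theorem algHom_ctExp [CharZero K] (φ : R →ₐ[K] S) (a : ℕ+ → R) (G : Polynomial R) :
    φ (ctExp K a G) = ctExp K (fun n => φ (a n)) (polyMap φ G) :=
  map_ctExp K φ a G

theorem polyMap_C (φ : R →ₐ[K] S) (r : R) :
    polyMap φ (Polynomial.C r) = Polynomial.C (φ r) :=
  Polynomial.map_C _

theorem polyMap_X (φ : R →ₐ[K] S) : polyMap φ Polynomial.X = Polynomial.X :=
  Polynomial.map_X _

theorem C_algebraMap (c : K) :
    Polynomial.C (algebraMap K R c) = algebraMap K (Polynomial R) c := rfl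

end Generators

/-! ### The operator d_- as a constant term -/

section Lowering

variable {K : Type} [Field K] [CharZero K] (q : K) {k : ℕ}

theorem opDm_apply (F : V K (k + 1)) : opDm q k F
    = ctExp K (fun n => (MvPolynomial.C (pSum n) : V K k)) (lowerSubst q k F) := by
  rw [opDm, LinearMap.comp_apply, ctExp, AlgHom.toLinearMap_apply, Polynomial.lsum_apply,
    Polynomial.lsum_apply]
  refine Finset.sum_congr rfl fun j _ => ?_
  refine congrArg (((lowerSubst q k) F).coeff j * ·) ?_
  have : (IsScalarTower.toAlgHom K (SymFun K) (V K k))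
      = MvPolynomial.aeval (fun n => (MvPolynomial.C (pSum n) : V K k)) :=
    MvPolynomial.algHom_ext fun n => by rw [MvPolynomial.aeval_X]; rfl
  exact DFunLike.congr_fun this _

theorem opDm_mul_of_lowerSubst {G : V K (k + 1)} {g : V K k}
    (h : lowerSubst q k G = Polynomial.C g) (F : V K (k + 1)) :
    opDm q k (G * F) = g * opDm q k F := by
  rw [opDm_apply, map_mul, h, ctExp_C_mul, opDm_apply]

theorem opDm_X_castSucc_mul (i : Fin k) (F : V K (k + 1)) :
    opDm q k (MvPolynomial.X i.castSucc * F) = MvPolynomial.X i * opDm q k F :=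
  opDm_mul_of_lowerSubst q (lowerSubst_X_castSucc q i) F

theorem opDm_algebraMap_mul (c : K) (F : V K (k + 1)) :
    opDm q k (algebraMap K _ c * F) = algebraMap K _ c * opDm q k F :=
  opDm_mul_of_lowerSubst q (AlgHom.commutes _ c) F

theorem castSucc_swap (a b i : Fin k) :
    Equiv.swap a.castSucc b.castSucc i.castSucc = (Equiv.swap a b i).castSucc :=
  ((Fin.castSucc_injective k).map_swap a b i).symm

theorem swap_castSucc_last (a b : Fin k) :
    Equiv.swap a.castSucc b.castSucc (Fin.last k) = Fin.last k :=
  Equiv.swap_apply_of_ne_of_ne (Fin.castSucc_lt_last a).ne' (Fin.castSucc_lt_last b).ne'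

theorem swapHom_opDm (a b : Fin k) (F : V K (k + 1)) :
    swapHom a b (opDm q k F) = opDm q k (swapHom a.castSucc b.castSucc F) := by
  rw [opDm_apply, opDm_apply, algHom_ctExp]
  simp only [swapHom_C]
  congr 1
  refine algHom_congr_V (R := Polynomial (V K k))
    (φ := (polyMap (swapHom a b)).comp (lowerSubst q k))
    (ψ := (lowerSubst q k).comp (swapHom a.castSucc b.castSucc)) F (fun n => ?_)
    (Fin.lastCases ?_ fun i => ?_)
  · simp only [AlgHom.comp_apply, swapHom_C, lowerSubst_C, map_sub, map_mul, map_pow, polyMap_C,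
      polyMap_X, map_one, AlgHom.commutes]
  · simp only [AlgHom.comp_apply, swapHom_X, swap_castSucc_last, lowerSubst_X_last, polyMap_X]
  · simp only [AlgHom.comp_apply, swapHom_X, castSucc_swap, lowerSubst_X_castSucc, polyMap_C]

/-- Although d_- is not a ring homomorphism, it is linear over y_1, …, y_k and commutes with their
exchanges, so it can be applied to the defining equation of T. -/
theorem opDm_heckeAux {a b : Fin k} (h : a ≠ b) (h' : a.castSucc ≠ b.castSucc)
    (F : V K (k + 1)) :
    opDm q k (heckeAux q a.castSucc b.castSucc h' F) = heckeAux q a b h (opDm q k F) := by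
  symm
  apply heckeAux_eq_of_mul_eq
  have := congrArg (opDm q k) (heckeAux_spec' q h' F)
  simp only [sub_mul, one_mul, mul_assoc, map_sub, map_add, opDm_X_castSucc_mul,
    opDm_algebraMap_mul] at this
  rw [swapHom_opDm]
  linear_combination this

end Lowering

/-! ### The operators T_i on V_k and the products T_1⋯T_m -/

section Hecke

variable {K : Type} [Field K] (q : K) {k : ℕ}

theorem opT_eq {i : ℕ} (h : i + 1 < k) : opT q k (i + 1)
    = heckeAux q ⟨i, by omega⟩ ⟨i + 1, h⟩ (by simp only [ne_eq, Fin.mk.injEq]; omega) :=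
  dif_pos ⟨by omega, h⟩

theorem opT_quadratic {i : ℕ} (h₁ : 1 ≤ i) (h₂ : i < k) (F : V K k) :
    opT q k i (opT q k i F)
      = (1 - algebraMap K (V K k) q) * opT q k i F + algebraMap K (V K k) q * F := by
  obtain ⟨i, rfl⟩ := Nat.exists_eq_add_of_le' h₁
  rw [opT_eq q h₂, heckeAux_quadratic]

theorem opT_braid {i : ℕ} (h₁ : 1 ≤ i) (h₂ : i + 1 < k) (F : V K k) :
    opT q k i (opT q k (i + 1) (opT q k i F))
      = opT q k (i + 1) (opT q k i (opT q k (i + 1) F)) := by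
  obtain ⟨i, rfl⟩ := Nat.exists_eq_add_of_le' h₁
  rw [opT_eq q h₂, opT_eq q (by omega)]
  exact heckeAux_braid q _ _ (by simp only [ne_eq, Fin.mk.injEq]; omega) F

theorem opT_far {i j : ℕ} (hi₁ : 1 ≤ i) (hi₂ : i < k) (hj₁ : 1 ≤ j) (hj₂ : j < k)
    (hij : i + 1 < j ∨ j + 1 < i) (F : V K k) :
    opT q k i (opT q k j F) = opT q k j (opT q k i F) := by
  obtain ⟨i, rfl⟩ := Nat.exists_eq_add_of_le' hi₁
  obtain ⟨j, rfl⟩ := Nat.exists_eq_add_of_le' hj₁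
  rw [opT_eq q hi₂, opT_eq q hj₂]
  apply heckeAux_comm <;> simp only [ne_eq, Fin.mk.injEq] <;> omega

theorem opT_algebraMap_mul (i : ℕ) (c : K) (F : V K k) :
    opT q k i (algebraMap K _ c * F) = algebraMap K _ c * opT q k i F := by
  rw [← Algebra.smul_def, map_smul, Algebra.smul_def]

theorem opT_X_mul {i : ℕ} (h₁ : 1 ≤ i) (h₂ : i < k) {l : Fin k} (hl : (l : ℕ) ≠ i)
    (hl' : (l : ℕ) + 1 ≠ i) (F : V K k) :
    opT q k i (MvPolynomial.X l * F) = MvPolynomial.X l * opT q k i F := by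
  obtain ⟨i, rfl⟩ := Nat.exists_eq_add_of_le' h₁
  rw [opT_eq q h₂]
  apply heckeAux_mul_of_swapHom_eq
  rw [swapHom_X, Equiv.swap_apply_of_ne_of_ne] <;> simp only [ne_eq, Fin.ext_iff] <;> omega

theorem opT_X_mul_opT {i : ℕ} (h : i + 1 < k) (F : V K k) :
    opT q k (i + 1) (MvPolynomial.X ⟨i + 1, h⟩ * opT q k (i + 1) F)
      = algebraMap K (V K k) q * (MvPolynomial.X ⟨i, by omega⟩ * F) := by
  rw [opT_eq q h, heckeAux_X_mul_heckeAux]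

theorem opT_eq_self {i : ℕ} (h : i + 1 < k) {F : V K k}
    (hF : swapHom ⟨i, by omega⟩ ⟨i + 1, h⟩ F = F) : opT q k (i + 1) F = F := by
  rw [opT_eq q h, heckeAux_eq_self q _ hF]

/-- Homomorphisms that carry two of the variables to variables and are compatible with their
interchange intertwine the corresponding operators. -/
theorem algHom_heckeAux {l : ℕ} (φ : V K k →ₐ[K] V K l) {a b : Fin k} {a' b' : Fin l}
    (h : a ≠ b) (h' : a' ≠ b') (ha : φ (MvPolynomial.X a) = MvPolynomial.X a')
    (hb : φ (MvPolynomial.X b) = MvPolynomial.X b')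
    (hs : ∀ F, φ (swapHom a b F) = swapHom a' b' (φ F)) (F : V K k) :
    φ (heckeAux q a b h F) = heckeAux q a' b' h' (φ F) := by
  symm
  apply heckeAux_eq_of_mul_eq
  rw [← hs, ← ha, ← hb]
  exact map_heckeAux q φ h F

theorem raiseSubst_swapHom (a b : Fin k) (F : V K k) : raiseSubst q k (swapHom a b F)
    = swapHom a.castSucc b.castSucc (raiseSubst q k F) := by
  refine algHom_congr_V (φ := (raiseSubst q k).comp (swapHom a b))
    (ψ := (swapHom a.castSucc b.castSucc).comp (raiseSubst q k)) F (fun n => ?_) fun i => ?_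
  · simp only [AlgHom.comp_apply, swapHom_C, raiseSubst_C, map_add, map_mul, map_sub, map_pow,
      map_one, swapHom_X, AlgHom.commutes, swap_castSucc_last]
  · simp only [AlgHom.comp_apply, swapHom_X, raiseSubst_X, castSucc_swap]

theorem raiseSubst_opT {i : ℕ} (h₁ : 1 ≤ i) (h₂ : i < k) (F : V K k) :
    raiseSubst q k (opT q k i F) = opT q (k + 1) i (raiseSubst q k F) := by
  obtain ⟨i, rfl⟩ := Nat.exists_eq_add_of_le' h₁
  rw [opT_eq q h₂, opT_eq q (by omega)]
  exact algHom_heckeAux q _ _ _ (raiseSubst_X q _) (raiseSubst_X q _) (raiseSubst_swapHom q _ _) F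

theorem opDm_opT [CharZero K] {i : ℕ} (h₁ : 1 ≤ i) (h₂ : i < k) (F : V K (k + 1)) :
    opDm q k (opT q (k + 1) i F) = opT q k i (opDm q k F) := by
  obtain ⟨i, rfl⟩ := Nat.exists_eq_add_of_le' h₁
  rw [opT_eq q h₂, opT_eq q (by omega)]
  exact opDm_heckeAux q (a := ⟨i, by omega⟩) (b := ⟨i + 1, h₂⟩) (by simp) (by simp) F

theorem starHom_opT (t : K) {i : ℕ} (h₁ : 1 ≤ i) (h₂ : i < k) (F : V K k) :
    starHom q t k (opT q k i F) = opT q (k + 1) (i + 1) (starHom q t k F) := by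
  obtain ⟨i, rfl⟩ := Nat.exists_eq_add_of_le' h₁
  rw [opT_eq q h₂, opT_eq q (by omega)]
  refine algHom_heckeAux q _ _ _ (starHom_X q t _) (starHom_X q t _) (fun F => ?_) F
  generalize (⟨i, _⟩ : Fin k) = a
  generalize (⟨i + 1, _⟩ : Fin k) = b
  refine algHom_congr_V (φ := (starHom q t k).comp (swapHom a b))
    (ψ := (swapHom a.succ b.succ).comp (starHom q t k)) F (fun n => ?_) fun i => ?_
  · have : Equiv.swap a.succ b.succ 0 = 0 :=
      Equiv.swap_apply_of_ne_of_ne (Fin.succ_ne_zero a).symm (Fin.succ_ne_zero b).symm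
    simp only [AlgHom.comp_apply, swapHom_C, starHom_C, map_add, map_mul, map_sub, map_pow,
      map_one, swapHom_X, AlgHom.commutes, this]
  · simp only [AlgHom.comp_apply, swapHom_X, starHom_X,
      ← (Fin.succ_injective k).map_swap]

/-- The operator `T₁ T₂ ⋯ T_m` on `V_n`. -/
def ascT (n m : ℕ) : Module.End K (V K n) := ((List.range m).map fun j => opT q n (j + 1)).prod

theorem ascT_succ (n m : ℕ) (F : V K n) :
    ascT q n (m + 1) F = ascT q n m (opT q n (m + 1) F) := by
  rw [ascT, List.range_succ, List.map_append, List.prod_append, List.map_singleton,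
    List.prod_singleton]
  rfl

theorem opDp_apply (F : V K k) : opDp q k F
    = -ascT q (k + 1) k (MvPolynomial.X (Fin.last k) * raiseSubst q k F) := by
  have : opY (K := K) (k + 1) (k + 1) = LinearMap.mulLeft K (MvPolynomial.X (Fin.last k)) :=
    dif_pos ⟨by omega, le_rfl⟩
  rw [opDp, this]
  rfl

theorem ascT_algebraMap_mul (n m : ℕ) (c : K) (F : V K n) :
    ascT q n m (algebraMap K _ c * F) = algebraMap K _ c * ascT q n m F := by
  rw [← Algebra.smul_def, map_smul, Algebra.smul_def]

/-- Moving left, T_i passes T_m, …, T_{i+2}; the braid relation at T_i T_{i+1} turns it into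
T_{i+1}, which passes T_{i-1}, …, T_1. -/
theorem ascT_opT {n m i : ℕ} (h₁ : 1 ≤ i) (h₂ : i < m) (h₃ : m < n) (F : V K n) :
    ascT q n m (opT q n i F) = opT q n (i + 1) (ascT q n m F) := by
  induction m generalizing F with
  | zero => omega
  | succ m ih =>
    rw [ascT_succ, ascT_succ]
    rcases Nat.lt_or_ge i m with h | h
    · rw [opT_far q (by omega) (by omega) h₁ (by omega) (by omega), ih h (by omega)]
    · obtain rfl : i = m := by omega
      obtain ⟨i, rfl⟩ := Nat.exists_eq_add_of_le' h₁
      rw [ascT_succ, opT_braid q (by omega) (by omega), ascT_succ]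
      have : ∀ j ≤ i, ∀ G, ascT q n j (opT q n (i + 1 + 1) G)
          = opT q n (i + 1 + 1) (ascT q n j G) := by
        intro j hj
        induction j with
        | zero => intro G; rfl
        | succ j ihj =>
          intro G
          rw [ascT_succ, ascT_succ, opT_far q (by omega) (by omega) (by omega) (by omega)
            (by omega), ihj (by omega)]
      rw [this i le_rfl]

theorem opDm_ascT [CharZero K] {m : ℕ} (h : m < k) (F : V K (k + 1)) :
    opDm q k (ascT q (k + 1) m F) = ascT q k m (opDm q k F) := by
  induction m generalizing F with
  | zero => rfl
  | succ m ih => rw [ascT_succ, ascT_succ, ih (by omega), opDm_opT q (by omega) h]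

theorem raiseSubst_ascT {m : ℕ} (h : m < k) (F : V K k) :
    raiseSubst q k (ascT q k m F) = ascT q (k + 1) m (raiseSubst q k F) := by
  induction m generalizing F with
  | zero => rfl
  | succ m ih => rw [ascT_succ, ascT_succ, ih (by omega), raiseSubst_opT q (by omega) h]

theorem ascT_X_mul {m : ℕ} {l : Fin k} (h : m < l) (F : V K k) :
    ascT q k m (MvPolynomial.X l * F) = MvPolynomial.X l * ascT q k m F := by
  induction m generalizing F with
  | zero => rfl
  | succ m ih =>
    rw [ascT_succ, ascT_succ, opT_X_mul q (by omega) (by omega) (by omega) (by omega),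
      ih (by omega)]

/-- In the left factor T_1 is split off, and T_2⋯T_{m+1} is moved through the right factor, emerging
as T_1⋯T_m. This trades a T_1 on the far left for a T_{m+1} on the far right. -/
theorem ascT_ascT {n m : ℕ} (h : m + 1 < n) (F : V K n) :
    ascT q n (m + 1) (ascT q n (m + 1) F) = opT q n 1 (ascT q n (m + 1) (ascT q n m F)) := by
  let C : ℕ → Module.End K (V K n) := fun m => ((List.range m).map fun j => opT q n (j + 2)).prod
  have h1 : ∀ G, ascT q n (m + 1) G = opT q n 1 (C m G) := by
    intro G
    rw [ascT, List.range_succ_eq_map, List.map_cons, List.prod_cons, List.map_map]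
    rfl
  have h2 : ∀ j ≤ m, ∀ G, C j (ascT q n (m + 1) G) = ascT q n (m + 1) (ascT q n j G) := by
    intro j hj
    induction j with
    | zero => intro G; rfl
    | succ j ih =>
      intro G
      have : ∀ G, C (j + 1) G = C j (opT q n (j + 2) G) := by
        intro G
        simp only [C]
        rw [List.range_succ, List.map_append, List.prod_append, List.map_singleton,
          List.prod_singleton]
        rfl
      rw [this, ascT_succ q n j, ← ih (by omega), ascT_opT q (by omega) (by omega) h]
  rw [h1, h2 m le_rfl]

end Hecke

/-! ### Constant terms in two variables -/

section Iterated

variable {K : Type} [Field K] {R : Type} [CommRing R] [Algebra K R]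

/-- The interchange of the two variables of a polynomial in two variables. -/
def polySwap (K : Type) [Field K] (R : Type) [CommRing R] [Algebra K R] :
    Polynomial (Polynomial R) →ₐ[K] Polynomial (Polynomial R) :=
  (Polynomial.Bivariate.swap (R := R)).toAlgHom.restrictScalars K

theorem polySwap_X : polySwap K R Polynomial.X = Polynomial.C Polynomial.X :=
  Polynomial.Bivariate.swap_Y

theorem polySwap_C_X : polySwap K R (Polynomial.C Polynomial.X) = Polynomial.X :=
  Polynomial.Bivariate.swap_X

theorem polySwap_C_C (r : R) :
    polySwap K R (Polynomial.C (Polynomial.C r)) = Polynomial.C (Polynomial.C r) :=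
  (Polynomial.Bivariate.swap (R := R)).commutes r

/-- On a monomial either side is its coefficient times two coefficients of the same series Exp[-zA].
It matters that A involves neither variable. -/
theorem ctExp_ctExp_polySwap [CharZero K] (a : ℕ+ → R) (Z : Polynomial (Polynomial R)) :
    ctExp K a (ctExp K (fun n => Polynomial.C (a n)) (polySwap K R Z))
      = ctExp K a (ctExp K (fun n => Polynomial.C (a n)) Z) := by
  have hC : ∀ j, expCoeff K (fun n => Polynomial.C (a n)) j = Polynomial.C (expCoeff K a j) :=
    fun j => (map_expCoeff K (IsScalarTower.toAlgHom K R (Polynomial R)) a j).symm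
  induction Z using Polynomial.induction_on' with
  | add F G hF hG => simp only [map_add, hF, hG]
  | monomial n r =>
    induction r using Polynomial.induction_on' with
    | add F G hF hG => simp only [map_add, hF, hG]
    | monomial m r =>
      have : polySwap K R (Polynomial.monomial n (Polynomial.monomial m r))
          = Polynomial.monomial m (Polynomial.monomial n r) := by
        rw [← Polynomial.C_mul_X_pow_eq_monomial, ← Polynomial.C_mul_X_pow_eq_monomial,
          ← Polynomial.C_mul_X_pow_eq_monomial, ← Polynomial.C_mul_X_pow_eq_monomial,
          Polynomial.C_mul, Polynomial.C_mul, Polynomial.C_pow, Polynomial.C_pow, map_mul, map_mul,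
          map_pow, map_pow, polySwap_C_C, polySwap_C_X, polySwap_X]
        ring
      rw [this, ctExp_monomial, ctExp_monomial, hC, hC, mul_comm, ctExp_C_mul, mul_comm,
        ctExp_monomial, mul_comm _ (Polynomial.C _), ctExp_C_mul, ctExp_monomial]
      ring

/-- Evaluation of polynomials as a homomorphism of algebras over the base field. -/
def evalHom (r : R) : Polynomial R →ₐ[K] R :=
  (Polynomial.aeval (R := R) r).restrictScalars K

theorem evalHom_apply (r : R) (G : Polynomial R) : evalHom (K := K) r G = G.eval r :=
  Polynomial.coe_aeval_eq_eval r ▸ rfl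

theorem evalHom_C (r s : R) : evalHom (K := K) r (Polynomial.C s) = s := by
  rw [evalHom_apply, Polynomial.eval_C]

theorem evalHom_X (r : R) : evalHom (K := K) r Polynomial.X = r := by
  rw [evalHom_apply, Polynomial.eval_X]

end Iterated

/-! ### Relations of the first action -/

section FirstAction

variable {K : Type} [Field K] (q : K)

theorem opT_last (m : ℕ) : opT q (m + 2) (m + 1)
    = heckeAux q (Fin.last m).castSucc (Fin.last (m + 1)) (Fin.castSucc_lt_last _).ne :=
  opT_eq q (by omega)

variable {R : Type} [CommRing R] [Algebra K R] {m : ℕ} (ι : V K m →ₐ[K] R)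

/-- The substitution `F ↦ F[X - (q - 1) y_{k+1}; y₁, …, y_{k+1}]` followed by a homomorphism applied
to the coefficients. -/
def lowerMap : V K (m + 1) →ₐ[K] Polynomial R := (polyMap ι).comp (lowerSubst q m)

theorem lowerMap_C (n : ℕ+) : lowerMap q ι (MvPolynomial.C (pSum n))
    = Polynomial.C (ι (MvPolynomial.C (pSum n)))
      - (algebraMap K _ q ^ (n : ℕ) - 1) * Polynomial.X ^ (n : ℕ) := by
  simp only [lowerMap, AlgHom.comp_apply, lowerSubst_C, map_sub, map_mul, map_pow, polyMap_C,
    polyMap_X, map_one, AlgHom.commutes]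

theorem lowerMap_X_castSucc (i : Fin m) : lowerMap q ι (MvPolynomial.X i.castSucc)
    = Polynomial.C (ι (MvPolynomial.X i)) := by
  simp only [lowerMap, AlgHom.comp_apply, lowerSubst_X_castSucc, polyMap_C]

theorem lowerMap_X_last : lowerMap q ι (MvPolynomial.X (Fin.last m)) = Polynomial.X := by
  simp only [lowerMap, AlgHom.comp_apply, lowerSubst_X_last, polyMap_X]

theorem algHom_opDm [CharZero K] (F : V K (m + 1)) : ι (opDm q m F)
    = ctExp K (fun n => ι (MvPolynomial.C (pSum n))) (lowerMap q ι F) := by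
  rw [opDm_apply, algHom_ctExp]
  rfl

/-- The substitution `F ↦ F[X - (q - 1) x - (q - 1) y; …, x, y]`. -/
def lowerMap₂ : V K (m + 2) →ₐ[K] Polynomial (Polynomial R) := lowerMap q (lowerMap q ι)

theorem polySwap_lowerMap₂ (F : V K (m + 2)) :
    polySwap K R (lowerMap₂ q ι F)
      = lowerMap₂ q ι (swapHom (Fin.last m).castSucc (Fin.last (m + 1)) F) := by
  refine algHom_congr_V (φ := (polySwap K R).comp (lowerMap₂ q ι))
    (ψ := (lowerMap₂ q ι).comp (swapHom (Fin.last m).castSucc (Fin.last (m + 1)))) F (fun n => ?_)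
    (Fin.lastCases ?_ (Fin.lastCases ?_ fun i => ?_))
  · simp only [AlgHom.comp_apply, swapHom_C, lowerMap₂, lowerMap_C, map_sub, map_mul, map_pow,
      map_one, AlgHom.commutes, polySwap_C_C, polySwap_X, C_algebraMap,
      polySwap_C_X]
    ring
  · simp only [AlgHom.comp_apply, swapHom_X, lowerMap₂, lowerMap_X_last, polySwap_X,
      Equiv.swap_apply_right, lowerMap_X_castSucc]
  · simp only [AlgHom.comp_apply, swapHom_X, lowerMap₂, lowerMap_X_last, polySwap_C_X,
      Equiv.swap_apply_left, lowerMap_X_castSucc]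
  · have : Equiv.swap (Fin.last m).castSucc (Fin.last (m + 1)) i.castSucc.castSucc
        = i.castSucc.castSucc :=
      Equiv.swap_apply_of_ne_of_ne
        (by simpa only [ne_eq, Fin.castSucc_inj] using (Fin.castSucc_lt_last i).ne)
        (Fin.castSucc_lt_last _).ne
    simp only [AlgHom.comp_apply, swapHom_X, polySwap_C_C, lowerMap₂, lowerMap_X_castSucc, this]

/-- Lowering a variable x changes the alphabet to X + x - qx; this is the shift datum c = x, d = qx
for returning to X. -/
theorem lowerMap_C_shift (n : ℕ+) :
    lowerMap q ι (MvPolynomial.C (pSum n)) + (algebraMap K _ q * Polynomial.X) ^ (n : ℕ)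
      = Polynomial.C (ι (MvPolynomial.C (pSum n))) + Polynomial.X ^ (n : ℕ) := by
  rw [lowerMap_C, mul_pow]
  ring

theorem algHom_opDm_opDm [CharZero K] (F : V K (m + 2)) : ι (opDm q m (opDm q (m + 1) F))
    = ctExp K (fun n => ι (MvPolynomial.C (pSum n)))
        (ctExp K (fun n => lowerMap q ι (MvPolynomial.C (pSum n))) (lowerMap₂ q ι F)) := by
  rw [algHom_opDm, algHom_opDm]
  rfl

/-- With x, y the last two variables and N = (swap F - F)/(y - x), one has T F - F = (y - qx)N.
Returning from the alphabet X - (q-1)x to X turns y - qx into y - x, leaving swap F - F, whose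
iterated constant term vanishes by symmetry. -/
theorem algHom_opDm_opDm_opT [CharZero K] (F : V K (m + 2)) :
    ι (opDm q m (opDm q (m + 1) (opT q (m + 2) (m + 1) F)))
      = ι (opDm q m (opDm q (m + 1) F)) := by
  rw [opT_last, ← sub_eq_zero, ← map_sub, ← map_sub, ← map_sub, algHom_opDm_opDm]
  obtain ⟨N, hN⟩ := dvd_sub_swapY (Fin.last m).castSucc (Fin.last (m + 1)) F
  change swapHom _ _ F - F = _ at hN
  have h := heckeAux_spec' q (Fin.castSucc_lt_last (Fin.last m)).ne F
  have h1 : heckeAux q (Fin.last m).castSucc (Fin.last (m + 1)) (Fin.castSucc_lt_last _).ne F - F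
      = (MvPolynomial.X (Fin.last (m + 1))
        - algebraMap K _ q * MvPolynomial.X (Fin.last m).castSucc) * N := by
    apply mul_left_cancel₀ (X_sub_X_ne_zero (K := K) (Fin.castSucc_lt_last (Fin.last m)).ne)
    linear_combination h + (MvPolynomial.X (Fin.last (m + 1))
        - algebraMap K _ q * MvPolynomial.X (Fin.last m).castSucc) * hN
  have hx : lowerMap₂ q ι (MvPolynomial.X (Fin.last m).castSucc) = Polynomial.C Polynomial.X := by
    rw [lowerMap₂, lowerMap_X_castSucc, lowerMap_X_last]
  have hy : lowerMap₂ q ι (MvPolynomial.X (Fin.last (m + 1))) = Polynomial.X := by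
    rw [lowerMap₂, lowerMap_X_last]
  have h2 := congrArg (lowerMap₂ q ι) h1
  rw [map_mul, map_sub _ (MvPolynomial.X _), map_mul, hx, hy, AlgHom.commutes] at h2
  have h3 := congrArg (lowerMap₂ q ι) hN
  rw [map_mul, map_sub, map_sub, hx, hy, ← polySwap_lowerMap₂] at h3
  -- The polynomial is divisible by y - qx, so its value at qx is 0 and the cofactor is the divided
  -- difference.
  rw [ctExp_shift K (lowerMap_C_shift q ι) (N := lowerMap₂ q ι N) (g := 0)
    (by rw [h2, Polynomial.C_0, Polynomial.C_mul, C_algebraMap]; ring), h2]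
  have h4 : (Polynomial.X - algebraMap K _ q * Polynomial.C Polynomial.X) * lowerMap₂ q ι N
      + Polynomial.C (algebraMap K _ q * Polynomial.X - Polynomial.X) * lowerMap₂ q ι N
      = polySwap K R (lowerMap₂ q ι F) - lowerMap₂ q ι F := by
    rw [h3, Polynomial.C_sub, Polynomial.C_mul, C_algebraMap]
    ring
  rw [h4, map_sub, map_sub, ctExp_ctExp_polySwap, sub_self]

theorem mul_neg_V {k : ℕ} (F G : V K k) : F * -G = -(F * G) := by ring

theorem opDp_opT {k i : ℕ} (h₁ : 1 ≤ i) (h₂ : i < k) (F : V K k) :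
    opDp q k (opT q k i F) = opT q (k + 1) (i + 1) (opDp q k F) := by
  rw [opDp_apply, opDp_apply, map_neg, raiseSubst_opT q h₁ h₂,
    ← opT_X_mul q h₁ (by omega) (by rw [Fin.val_last]; omega) (by rw [Fin.val_last]; omega),
    ascT_opT q h₁ h₂ (by omega)]

theorem swapHom_raiseSubst_raiseSubst (k : ℕ) (F : V K k) :
    swapHom (Fin.last k).castSucc (Fin.last (k + 1)) (raiseSubst q (k + 1) (raiseSubst q k F))
      = raiseSubst q (k + 1) (raiseSubst q k F) := by
  refine algHom_congr_V (φ := (swapHom (Fin.last k).castSucc (Fin.last (k + 1))).comp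
      ((raiseSubst q (k + 1)).comp (raiseSubst q k)))
    (ψ := (raiseSubst q (k + 1)).comp (raiseSubst q k)) F (fun n => ?_) fun i => ?_
  · simp only [AlgHom.comp_apply, swapHom_C, raiseSubst_C, map_add, map_sub, map_mul, map_pow,
      map_one, AlgHom.commutes, raiseSubst_X, swapHom_X, Equiv.swap_apply_left,
      Equiv.swap_apply_right]
    ring
  · have : Equiv.swap (Fin.last k).castSucc (Fin.last (k + 1)) i.castSucc.castSucc
        = i.castSucc.castSucc :=
      Equiv.swap_apply_of_ne_of_ne
        (by simpa only [ne_eq, Fin.castSucc_inj] using (Fin.castSucc_lt_last i).ne)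
        (Fin.castSucc_lt_last _).ne
    simp only [AlgHom.comp_apply, swapHom_X, raiseSubst_X, this]

/-- Up to T_1⋯T_{k+1} · T_1⋯T_k, d_+² F is y_{k+1}y_{k+2} F[X + (q-1)(y_{k+1} + y_{k+2})], symmetric
in both new variables and so fixed by T_{k+1}; by `ascT_ascT` the leading T_1 becomes this T_{k+1}.
-/
theorem opT_opDp_opDp (k : ℕ) (F : V K k) :
    opT q (k + 2) 1 (opDp q (k + 1) (opDp q k F)) = opDp q (k + 1) (opDp q k F) := by
  have h : opDp q (k + 1) (opDp q k F) = ascT q (k + 2) (k + 1) (ascT q (k + 2) k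
      (MvPolynomial.X (Fin.last (k + 1)) * (MvPolynomial.X (Fin.last k).castSucc
        * raiseSubst q (k + 1) (raiseSubst q k F)))) := by
    rw [opDp_apply, opDp_apply, map_neg, raiseSubst_ascT q (by omega), mul_neg_V, map_neg, neg_neg,
      ← ascT_X_mul q (by rw [Fin.val_last]; omega), map_mul (raiseSubst q (k + 1)), raiseSubst_X]
  rw [h, ← ascT_ascT q (by omega)]
  refine (congrArg (ascT q (k + 2) (k + 1)) (ascT_succ q (k + 2) k _)).trans ?_
  refine congrArg (fun G => ascT q (k + 2) (k + 1) (ascT q (k + 2) k G)) ?_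
  rw [opT_last]
  apply heckeAux_eq_self
  rw [map_mul, map_mul, swapHom_raiseSubst_raiseSubst, swapHom_X, swapHom_X,
    Equiv.swap_apply_left, Equiv.swap_apply_right]
  ring

/-- Before ι, both sides are F[X + (q-1)y_{m+1} - (q-1)w; y_1, …, y_m, w]; the exchange puts the
added variable in the place vacated by the lowered one. -/
theorem lowerMap_raiseSubst (m : ℕ) (ι : V K (m + 1) →ₐ[K] R) (F : V K (m + 1)) :
    lowerMap q (ι.comp (raiseSubst q m)) F
      = lowerMap q ι (swapHom (Fin.last m).castSucc (Fin.last (m + 1))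
          (raiseSubst q (m + 1) F)) := by
  refine algHom_congr_V (φ := lowerMap q (ι.comp (raiseSubst q m)))
    (ψ := ((lowerMap q ι).comp (swapHom (Fin.last m).castSucc (Fin.last (m + 1)))).comp
      (raiseSubst q (m + 1))) F (fun n => ?_) (Fin.lastCases ?_ fun i => ?_)
  · simp only [AlgHom.comp_apply, swapHom_C, lowerMap_C, raiseSubst_C, map_sub, map_add, map_mul,
      map_pow, map_one, AlgHom.commutes, swapHom_X, Equiv.swap_apply_right,
      lowerMap_X_castSucc, C_algebraMap]
    ring
  · simp only [AlgHom.comp_apply, swapHom_X, raiseSubst_X, Equiv.swap_apply_left,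
      lowerMap_X_last]
  · have : Equiv.swap (Fin.last m).castSucc (Fin.last (m + 1)) i.castSucc.castSucc
        = i.castSucc.castSucc :=
      Equiv.swap_apply_of_ne_of_ne
        (by simpa only [ne_eq, Fin.castSucc_inj] using (Fin.castSucc_lt_last i).ne)
        (Fin.castSucc_lt_last _).ne
    simp only [AlgHom.comp_apply, swapHom_X, raiseSubst_X, this, lowerMap_X_castSucc]

theorem lowerMap_raiseSubst_self (F : V K m) :
    lowerMap q ι (raiseSubst q m F) = Polynomial.C (ι F) := by
  refine algHom_congr_V (φ := (lowerMap q ι).comp (raiseSubst q m))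
    (ψ := (IsScalarTower.toAlgHom K R (Polynomial R)).comp ι) F (fun n => ?_) fun i => ?_
  · simp only [AlgHom.comp_apply, raiseSubst_C, lowerMap_C, lowerMap_X_last, map_add, map_sub,
      map_mul, map_pow, map_one, AlgHom.commutes, sub_add_cancel]
    rfl
  · simp only [AlgHom.comp_apply, raiseSubst_X, lowerMap_X_castSucc]
    rfl

theorem eval_lowerMap_raiseSubst (m : ℕ) (ι : V K (m + 1) →ₐ[K] R) (F : V K (m + 1)) :
    (lowerMap q (ι.comp (raiseSubst q m)) F).eval (ι (MvPolynomial.X (Fin.last m))) = ι F := by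
  rw [← evalHom_apply (K := K)]
  refine algHom_congr_V (φ := (evalHom (ι (MvPolynomial.X (Fin.last m)))).comp
      (lowerMap q (ι.comp (raiseSubst q m)))) (ψ := ι) F (fun n => ?_)
      (Fin.lastCases ?_ fun i => ?_)
  · simp only [AlgHom.comp_apply, lowerMap_C, raiseSubst_C, map_sub, map_add, map_mul,
      map_pow, map_one, AlgHom.commutes, evalHom_C, evalHom_X]
    ring
  · simp only [AlgHom.comp_apply, lowerMap_X_last, evalHom_X]
  · simp only [AlgHom.comp_apply, lowerMap_X_castSucc, raiseSubst_X, evalHom_C]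

/-- The raising and lowering substitutions in terms of `Tᵢ`, up to the factor `T₁ ⋯ T_{k-1}`. -/
theorem algHom_commutator_aux [CharZero K] [IsDomain R] (m : ℕ) (ι : V K (m + 1) →ₐ[K] R)
    (F : V K (m + 1)) :
    ι (MvPolynomial.X (Fin.last m)) * ι (raiseSubst q m (opDm q m F))
      - ι (opDm q (m + 1) (opT q (m + 2) (m + 1)
        (MvPolynomial.X (Fin.last (m + 1)) * raiseSubst q (m + 1) F)))
      = (1 - algebraMap K _ q) * (ι (MvPolynomial.X (Fin.last m)) * ι F) := by
  obtain ⟨N, hN⟩ := exists_X_sub_C_mul_eq (lowerMap q (ι.comp (raiseSubst q m)) F)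
    (ι (MvPolynomial.X (Fin.last m)))
  rw [eval_lowerMap_raiseSubst] at hN
  have h1 : ι (raiseSubst q m (opDm q m F)) = ctExp K (fun n => ι (MvPolynomial.C (pSum n)))
      (lowerMap q (ι.comp (raiseSubst q m)) F + Polynomial.C (ι (MvPolynomial.X (Fin.last m))
        - algebraMap K _ q * ι (MvPolynomial.X (Fin.last m))) * N) := by
    refine (algHom_opDm q (ι.comp (raiseSubst q m)) F).trans (ctExp_shift K (fun n => ?_) hN)
    simp only [AlgHom.comp_apply, raiseSubst_C, map_add, map_mul, map_sub, map_pow, map_one,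
      AlgHom.commutes, mul_pow]
    ring
  have h2 := map_heckeAux q (lowerMap q ι) (Fin.castSucc_lt_last (Fin.last m)).ne
    (MvPolynomial.X (Fin.last (m + 1)) * raiseSubst q (m + 1) F)
  rw [← opT_last, map_mul (lowerMap q ι), map_mul (swapHom _ _), map_mul (lowerMap q ι),
    swapHom_X, Equiv.swap_apply_right,
    ← lowerMap_raiseSubst, lowerMap_raiseSubst_self, lowerMap_X_last, lowerMap_X_castSucc] at h2
  -- The difference of the two polynomials is constant in w already before constant terms are taken;
  -- multiplying by w - y_{m+1} removes all divisions.
  have h3 : Polynomial.C (ι (MvPolynomial.X (Fin.last m))) * (lowerMap q (ι.comp (raiseSubst q m)) F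
        + Polynomial.C (ι (MvPolynomial.X (Fin.last m))
        - algebraMap K _ q * ι (MvPolynomial.X (Fin.last m))) * N)
      - lowerMap q ι (opT q (m + 2) (m + 1)
        (MvPolynomial.X (Fin.last (m + 1)) * raiseSubst q (m + 1) F))
      = Polynomial.C ((1 - algebraMap K _ q) * (ι (MvPolynomial.X (Fin.last m)) * ι F)) := by
    apply mul_left_cancel₀ (Polynomial.X_sub_C_ne_zero (ι (MvPolynomial.X (Fin.last m))))
    rw [mul_sub, h2]
    simp only [Polynomial.C_mul, Polynomial.C_sub, Polynomial.C_1, C_algebraMap]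
    linear_combination (1 - algebraMap K _ q) * Polynomial.C (ι (MvPolynomial.X (Fin.last m)))
      * Polynomial.C (ι (MvPolynomial.X (Fin.last m))) * hN
  have h4 := congrArg (ctExp K (fun n => ι (MvPolynomial.C (pSum n)))) h3
  rwa [map_sub, ctExp_C_mul, ← h1, ← algHom_opDm, ctExp_C] at h4

end FirstAction

section Sealed

/-- A copy of `V_k`, regarded as an abstract integral domain over `K`. -/
def Sealed (K : Type) [Field K] (k : ℕ) : Type := V K k

variable (K : Type) [Field K] (k : ℕ)

instance : CommRing (Sealed K k) := inferInstanceAs (CommRing (V K k))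

instance : IsDomain (Sealed K k) := inferInstanceAs (IsDomain (V K k))

instance : Algebra K (Sealed K k) := inferInstanceAs (Algebra K (V K k))

/-- The identification of `V_k` with its copy. -/
def toSealed : V K k →ₐ[K] Sealed K k := AlgHom.id K (V K k)

theorem toSealed_injective : Function.Injective (toSealed K k) := fun _ _ h => h

end Sealed

/-! ### The commutator of d_+ and d_- -/

section FirstAction

variable {K : Type} [Field K] [CharZero K] (q : K) {m : ℕ}

theorem opDm_opDm_opT (F : V K (m + 2)) :
    opDm q m (opDm q (m + 1) (opT q (m + 2) (m + 1) F)) = opDm q m (opDm q (m + 1) F) :=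
  toSealed_injective K m (algHom_opDm_opDm_opT q _ F)

/-- The commutator `d₊ d₋ - d₋ d₊` on `V_{m+1}`. -/
def firstComm (m : ℕ) : V K (m + 1) →ₗ[K] V K (m + 1) :=
  opDp q m ∘ₗ opDm q m - opDm q (m + 1) ∘ₗ opDp q (m + 1)

/-- As d_- commutes with T_1, …, T_m, the product T_1⋯T_m factors out of both terms, and
`algHom_commutator_aux` evaluates the rest. -/
theorem firstComm_apply (F : V K (m + 1)) : firstComm q m F
    = ascT q (m + 1) m (algebraMap K _ (q - 1) * (MvPolynomial.X (Fin.last m) * F)) := by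
  have h := algHom_commutator_aux q m (toSealed K (m + 1)) F
  have h' : MvPolynomial.X (Fin.last m) * raiseSubst q m (opDm q m F)
      - opDm q (m + 1) (opT q (m + 2) (m + 1)
        (MvPolynomial.X (Fin.last (m + 1)) * raiseSubst q (m + 1) F))
      = (1 - algebraMap K _ q) * (MvPolynomial.X (Fin.last m) * F) := h
  rw [firstComm, LinearMap.sub_apply, LinearMap.comp_apply, LinearMap.comp_apply, opDp_apply,
    opDp_apply, map_neg, ascT_succ, opDm_ascT q (by omega), sub_neg_eq_add, neg_add_eq_sub,
    ← map_sub]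
  congr 1
  rw [map_sub (algebraMap K _), map_one]
  linear_combination -h'

/-- Both commutators being explicit, the factor q comes from T_{m+1} y_{m+2} T_{m+1} = q y_{m+1},
and d_- is linear over y_{m+1}. -/
theorem opDm_firstComm_opT (F : V K (m + 2)) :
    opDm q (m + 1) (firstComm q (m + 1) (opT q (m + 2) (m + 1) F))
      = q • firstComm q m (opDm q (m + 1) F) := by
  rw [firstComm_apply, firstComm_apply, ascT_algebraMap_mul, ascT_algebraMap_mul, ascT_succ,
    opDm_algebraMap_mul, opDm_ascT q (by omega)]
  have h : opT q (m + 2) (m + 1) (MvPolynomial.X (Fin.last (m + 1)) * opT q (m + 2) (m + 1) F)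
      = algebraMap K _ q * (MvPolynomial.X (Fin.last m).castSucc * F) :=
    opT_X_mul_opT q (by omega) F
  rw [h, opDm_algebraMap_mul, opDm_X_castSucc_mul, ascT_algebraMap_mul, Algebra.smul_def]
  ring

theorem opT_firstComm_opDp (F : V K (m + 1)) :
    opT q (m + 2) 1 (firstComm q (m + 1) (opDp q (m + 1) F))
      = q • opDp q (m + 1) (firstComm q m F) := by
  rw [firstComm_apply, firstComm_apply, ascT_algebraMap_mul, ascT_algebraMap_mul, opDp_apply,
    opDp_apply, mul_neg_V, map_neg, map_mul (raiseSubst q (m + 1)) (algebraMap K _ _),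
    AlgHom.commutes, raiseSubst_ascT q (by omega), map_mul (raiseSubst q (m + 1)), raiseSubst_X,
    opT_algebraMap_mul]
  have h1 : ∀ G : V K (m + 2), MvPolynomial.X (Fin.last (m + 1)) * ascT q (m + 2) m G
      = ascT q (m + 2) m (MvPolynomial.X (Fin.last (m + 1)) * G) :=
    fun G => (ascT_X_mul q (by rw [Fin.val_last]; omega) G).symm
  have h2 : ∀ G, opT q (m + 2) (m + 1) (MvPolynomial.X (Fin.last (m + 1))
      * opT q (m + 2) (m + 1) G) = algebraMap K _ q * (MvPolynomial.X (Fin.last m).castSucc * G) :=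
    fun G => opT_X_mul_opT q (by omega) G
  rw [ascT_succ q (m + 2) m (_ * raiseSubst _ _ _), h1, map_neg, ← ascT_ascT q (by omega)]
  rw [congrArg (ascT q (m + 2) (m + 1)) (ascT_succ q (m + 2) m _), h2]
  rw [mul_left_comm (MvPolynomial.X (Fin.last (m + 1))), h1, ascT_algebraMap_mul,
    ascT_algebraMap_mul, ascT_algebraMap_mul,
    mul_left_comm (MvPolynomial.X (Fin.last (m + 1))), Algebra.smul_def]
  ring

end FirstAction

section FirstAction

variable {K : Type} [Field K] (q : K)

/-- The operator `T_j ⋯ T_1` on `V_n`. -/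
def descOpT (n : ℕ) : ℕ → Module.End K (V K n)
  | 0 => LinearMap.id
  | j + 1 => opT q n (j + 1) * descOpT n j

/-- The relation T_i y_{i+1} T_i = q y_i telescopes from the inside; this gives y_1 its
normalisation q^{k-1}(q-1). -/
theorem ascT_X_mul_descOpT {n j : ℕ} (h : j < n) (F : V K n) :
    ascT q n j (MvPolynomial.X ⟨j, h⟩ * descOpT q n j F)
      = algebraMap K _ (q ^ j) * (MvPolynomial.X ⟨0, by omega⟩ * F) := by
  induction j with
  | zero => simp [ascT, descOpT]
  | succ j ih =>
    rw [ascT_succ, descOpT, Module.End.mul_apply, opT_X_mul_opT q h, ascT_algebraMap_mul,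
      ih (by omega), pow_succ, map_mul]
    ring

end FirstAction

/-! ### Compatibilities of d_+^* with raising and lowering substitutions -/

section StarHom

variable {K : Type} [Field K] (q t : K) {R : Type} [CommRing R] [Algebra K R] {m : ℕ}

theorem lowerMap_starHom (ι : V K (m + 1) →ₐ[K] R) (F : V K (m + 1)) :
    lowerMap q ι (starHom q t (m + 1) F) = lowerMap q (ι.comp (starHom q t m)) F := by
  refine algHom_congr_V (φ := (lowerMap q ι).comp (starHom q t (m + 1)))
    (ψ := lowerMap q (ι.comp (starHom q t m))) F (fun n => ?_) (Fin.lastCases ?_ fun i => ?_)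
  · have : (0 : Fin (m + 2)) = Fin.castSucc 0 := rfl
    simp only [AlgHom.comp_apply, starHom_C, lowerMap_C, map_add, map_mul, map_sub, map_pow,
      map_one, AlgHom.commutes, this, lowerMap_X_castSucc, C_algebraMap]
    ring
  · simp only [AlgHom.comp_apply, starHom_X, Fin.succ_last, lowerMap_X_last]
  · simp only [AlgHom.comp_apply, starHom_X, Fin.succ_castSucc, lowerMap_X_castSucc]

/-- At w = t y_1 the plethystic terms introduced by d_+^* and by lowering cancel, which leaves γ.
Hence t y_1 is the node of the divided differences below. -/
theorem eval_lowerMap_starHom (ι : V K (m + 1) →ₐ[K] R) (F : V K (m + 1)) :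
    (lowerMap q (ι.comp (starHom q t m)) F).eval (algebraMap K R t * ι (MvPolynomial.X 0))
      = ι (gammaHom t m F) := by
  rw [← evalHom_apply (K := K)]
  refine algHom_congr_V (φ := (evalHom (algebraMap K R t * ι (MvPolynomial.X 0))).comp
    (lowerMap q (ι.comp (starHom q t m)))) (ψ := ι.comp (gammaHom t m)) F (fun n => ?_)
      (Fin.lastCases ?_ fun i => ?_)
  · simp only [AlgHom.comp_apply, lowerMap_C, starHom_C, gammaHom_C, map_sub, map_add, map_mul,
      map_pow, map_one, AlgHom.commutes, evalHom_C, evalHom_X]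
    ring
  · simp only [AlgHom.comp_apply, lowerMap_X_last, evalHom_X, gammaHom_X_last, map_mul,
      AlgHom.commutes]
  · simp only [AlgHom.comp_apply, lowerMap_X_castSucc, starHom_X, evalHom_C, gammaHom_X_castSucc]

theorem starHom_raiseSubst (F : V K m) : starHom q t (m + 1) (raiseSubst q m F)
    = raiseSubst q (m + 1) (starHom q t m F) := by
  refine algHom_congr_V (φ := (starHom q t (m + 1)).comp (raiseSubst q m))
    (ψ := (raiseSubst q (m + 1)).comp (starHom q t m)) F (fun n => ?_) fun i => ?_
  · have : (0 : Fin (m + 2)) = Fin.castSucc 0 := rfl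
    simp only [AlgHom.comp_apply, starHom_C, raiseSubst_C, map_add, map_mul, map_sub, map_pow,
      map_one, AlgHom.commutes, starHom_X, raiseSubst_X, Fin.succ_last, this]
    ring
  · simp only [AlgHom.comp_apply, starHom_X, raiseSubst_X, Fin.succ_castSucc]

theorem swapHom_starHom_starHom (F : V K m) :
    swapHom 0 1 (starHom q t (m + 1) (starHom q t m F)) = starHom q t (m + 1) (starHom q t m F) := by
  refine algHom_congr_V (φ := (swapHom 0 1).comp ((starHom q t (m + 1)).comp (starHom q t m)))
    (ψ := (starHom q t (m + 1)).comp (starHom q t m)) F (fun n => ?_) fun i => ?_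
  · have : (0 : Fin (m + 1)).succ = 1 := rfl
    simp only [AlgHom.comp_apply, starHom_C, swapHom_C, map_add, map_mul, map_sub, map_pow,
      map_one, AlgHom.commutes, starHom_X, swapHom_X, this, Equiv.swap_apply_left,
      Equiv.swap_apply_right]
    ring
  · have : Equiv.swap (0 : Fin (m + 2)) 1 i.succ.succ = i.succ.succ :=
      Equiv.swap_apply_of_ne_of_ne (Fin.succ_ne_zero _)
        fun h => Fin.succ_ne_zero i (Fin.succ_injective _ h)
    simp only [AlgHom.comp_apply, starHom_X, swapHom_X, this]

theorem opT_one_starHom_starHom (F : V K m) :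
    opT q (m + 2) 1 (starHom q t (m + 1) (starHom q t m F))
      = starHom q t (m + 1) (starHom q t m F) :=
  opT_eq_self q (i := 0) (by omega) (swapHom_starHom_starHom q t F)

theorem exists_divided_difference (ι : V K (m + 1) →ₐ[K] R) (F : V K (m + 1)) :
    ∃ N, (Polynomial.X - Polynomial.C (algebraMap K R t * ι (MvPolynomial.X 0))) * N
      = lowerMap q (ι.comp (starHom q t m)) F - Polynomial.C (ι (gammaHom t m F)) := by
  rw [← eval_lowerMap_starHom q t ι F]
  exact exists_X_sub_C_mul_eq _ _

end StarHom

/-! ### The commutator of d_+^* and d_-, and raising -/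

section SecondComm

variable {K : Type} [Field K] [CharZero K] (q t : K) {R : Type} [CommRing R] [Algebra K R] {m : ℕ}

/-- The commutator `d₊^* d₋ - d₋ d₊^*` on `V_{m+1}`. -/
def secondComm (m : ℕ) : V K (m + 1) →ₗ[K] V K (m + 1) :=
  opDpStar q t m ∘ₗ opDm q m - opDm q (m + 1) ∘ₗ opDpStar q t (m + 1)

theorem secondComm_apply (F : V K (m + 1)) : secondComm q t m F
    = starHom q t m (opDm q m F) - opDm q (m + 1) (starHom q t (m + 1) F) := rfl

/-- The commutator `d₊^* d₋ - d₋ d₊^*` in terms of a divided difference. -/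
theorem algHom_secondComm (ι : V K (m + 1) →ₐ[K] R) (F : V K (m + 1)) {N : Polynomial R}
    (hN : (Polynomial.X - Polynomial.C (algebraMap K R t * ι (MvPolynomial.X 0))) * N
      = lowerMap q (ι.comp (starHom q t m)) F - Polynomial.C (ι (gammaHom t m F))) :
    ι (secondComm q t m F) = (1 - algebraMap K R q) * (algebraMap K R t * ι (MvPolynomial.X 0))
      * ctExp K (fun n => ι (MvPolynomial.C (pSum n))) N := by
  -- The alphabet here is X + (q-1)t y_1, so c = q t y_1 and d = t y_1. The other term of the
  -- commutator has the same polynomial against X, and only the correction by `N` survives.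
  have h1 : ι (starHom q t m (opDm q m F)) = ctExp K (fun n => ι (MvPolynomial.C (pSum n)))
      (lowerMap q (ι.comp (starHom q t m)) F + Polynomial.C (algebraMap K R t
        * ι (MvPolynomial.X 0) - algebraMap K R q * (algebraMap K R t * ι (MvPolynomial.X 0)))
        * N) := by
    refine (algHom_opDm q (ι.comp (starHom q t m)) F).trans (ctExp_shift K (fun n => ?_) hN)
    simp only [AlgHom.comp_apply, starHom_C, map_add, map_mul, map_sub, map_pow, map_one,
      AlgHom.commutes, mul_pow]
    ring
  rw [secondComm_apply, map_sub, h1, algHom_opDm, lowerMap_starHom, map_add, ctExp_C_mul]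
  ring

/-- Lowering undoes raising, so the polynomial in w is w times a constant and its divided difference
is that constant. -/
theorem secondComm_X_mul_raiseSubst (F : V K m) :
    secondComm q t m (MvPolynomial.X (Fin.last m) * raiseSubst q m F)
      = algebraMap K _ (1 - q) * (algebraMap K _ t * (MvPolynomial.X 0 * starHom q t m F)) := by
  apply toSealed_injective
  rw [algHom_secondComm q t (toSealed K (m + 1)) _
    (N := Polynomial.C (toSealed K (m + 1) (starHom q t m F))) ?_, ctExp_C]
  · simp only [map_mul, AlgHom.commutes, map_sub, map_one]
    ring
  · rw [map_mul (lowerMap q _), lowerMap_raiseSubst_self, lowerMap_X_last,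
      map_mul (gammaHom t m), gammaHom_X_last, map_mul (toSealed _ _), map_mul (toSealed _ _),
      AlgHom.commutes, Polynomial.C_mul (a := _ * _), AlgHom.comp_apply]
    exact sub_mul _ _ _

/-- Here X is w, x is y_{m+2} and v is t y_1; H and D are the lowered forms of F and of T_{m+1}
applied to y_{m+2} times the raised F. The small letters are values: h, hv of H at x, v, e of N at
x, g of D at v. -/
theorem mul_divided_difference_eq {A : Type*} [CommRing A] [IsDomain A]
    {X x v Q H h hv e N N₂ N₃ D g : A} (hXv : X - v ≠ 0) (hXx : X - x ≠ 0) (hvx : v - x ≠ 0)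
    (hN : (X - v) * N = H - hv) (hN₂ : (X - x) * N₂ = N - e) (hN₃ : (X - v) * N₃ = D - g)
    (hD : (X - x) * D = (Q - 1) * (x * (X * h)) + (X - Q * x) * (x * H))
    (hg : (v - x) * g = (Q - 1) * (x * (v * h)) + (v - Q * x) * (x * hv))
    (he : (x - v) * e = h - hv) : x * (N + (x - Q * x) * N₂) = N₃ := by
  apply mul_left_cancel₀ (mul_ne_zero (mul_ne_zero hXv hXx) hvx)
  linear_combination x * (X - x) * (v - x) * hN + x * (x - Q * x) * (X - v) * (v - x) * hN₂
    + x ^ 2 * (1 - Q) * (v - x) * hN + x ^ 2 * (1 - Q) * (X - v) * he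
    - (X - x) * (v - x) * hN₃ - (v - x) * hD + (X - x) * hg

/-- On the left the alphabet is X + (q-1)y_{m+2}, and returning to X adds a second divided
difference at y_{m+2}. Both sides are then (1-q)t y_1 times constant terms against X of equal
polynomials. -/
theorem algHom_X_mul_raiseSubst_secondComm [IsDomain R] (ι : V K (m + 2) →ₐ[K] R)
    (hι : algebraMap K R t * ι (MvPolynomial.X 0) ≠ ι (MvPolynomial.X (Fin.last (m + 1))))
    (F : V K (m + 1)) :
    ι (MvPolynomial.X (Fin.last (m + 1))) * ι (raiseSubst q (m + 1) (secondComm q t m F))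
      = ι (secondComm q t (m + 1) (opT q (m + 2) (m + 1)
        (MvPolynomial.X (Fin.last (m + 1)) * raiseSubst q (m + 1) F))) := by
  obtain ⟨N, hN⟩ := exists_divided_difference q t (ι.comp (raiseSubst q (m + 1))) F
  obtain ⟨N₃, hN₃⟩ := exists_divided_difference q t ι (opT q (m + 2) (m + 1)
        (MvPolynomial.X (Fin.last (m + 1)) * raiseSubst q (m + 1) F))
  obtain ⟨N₂, hN₂⟩ := exists_X_sub_C_mul_eq N (ι (MvPolynomial.X (Fin.last (m + 1))))
  have h1 := algHom_secondComm q t (ι.comp (raiseSubst q (m + 1))) F hN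
  have hv : (ι.comp (raiseSubst q (m + 1))) (MvPolynomial.X 0) = ι (MvPolynomial.X 0) := by
    rw [AlgHom.comp_apply, raiseSubst_X]; rfl
  have hstar : (ι.comp (raiseSubst q (m + 1))).comp (starHom q t m)
      = (ι.comp (starHom q t (m + 1))).comp (raiseSubst q m) :=
    AlgHom.ext fun F => congrArg ι (starHom_raiseSubst q t F).symm
  rw [hv] at h1 hN
  rw [hstar] at hN
  rw [ctExp_shift K (fun n => ?_) hN₂] at h1
  rotate_left
  · exact fun n => ι (MvPolynomial.C (pSum n))
  · exact algebraMap K R q * ι (MvPolynomial.X (Fin.last (m + 1)))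
  · simp only [AlgHom.comp_apply, raiseSubst_C, map_add, map_mul, map_sub, map_pow, map_one,
      AlgHom.commutes, mul_pow]
    ring
  have hx : (ι.comp (starHom q t (m + 1))) (MvPolynomial.X (Fin.last m))
      = ι (MvPolynomial.X (Fin.last (m + 1))) := by
    rw [AlgHom.comp_apply, starHom_X, Fin.succ_last]
  have hD := map_heckeAux q (lowerMap q (ι.comp (starHom q t (m + 1))))
    (Fin.castSucc_lt_last (Fin.last m)).ne
    (MvPolynomial.X (Fin.last (m + 1)) * raiseSubst q (m + 1) F)
  rw [← opT_last, map_mul (lowerMap q _), map_mul (swapHom _ _), map_mul (lowerMap q _),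
    swapHom_X, Equiv.swap_apply_right, ← lowerMap_raiseSubst, lowerMap_raiseSubst_self,
    lowerMap_X_last, lowerMap_X_castSucc, hx] at hD
  have hH := eval_lowerMap_raiseSubst q m (ι.comp (starHom q t (m + 1))) F
  rw [hx] at hH
  have hg := congrArg (fun G => Polynomial.C (Polynomial.eval
    (algebraMap K R t * ι (MvPolynomial.X 0)) G)) hD
  have he := congrArg (fun G => Polynomial.C (Polynomial.eval
    (ι (MvPolynomial.X (Fin.last (m + 1)))) G)) hN
  have hv' := congrArg (fun G => Polynomial.C (Polynomial.eval
    (algebraMap K R t * ι (MvPolynomial.X 0)) G)) hN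
  simp only [Polynomial.eval_mul, Polynomial.eval_sub, Polynomial.eval_add, Polynomial.eval_X,
    Polynomial.eval_C, Polynomial.eval_one, ← C_algebraMap, sub_self, zero_mul, hH,
    eval_lowerMap_starHom, Polynomial.C_mul, Polynomial.C_sub, Polynomial.C_add,
    Polynomial.C_1, Polynomial.C_0] at hg he hv' hD hN hN₂ hN₃
  -- Evaluating `hN` at t y_1 identifies the value of H there with the γ-term occurring in `hN`.
  rw [sub_eq_zero.mp hv'.symm] at hg
  have key := mul_divided_difference_eq (Q := Polynomial.C (algebraMap K R q))
    (X := Polynomial.X) ?_ (Polynomial.X_sub_C_ne_zero _) ?_ hN hN₂ hN₃ hD hg he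
  · have h2 := algHom_secondComm q t ι (opT q (m + 2) (m + 1)
      (MvPolynomial.X (Fin.last (m + 1)) * raiseSubst q (m + 1) F)) (N := N₃) ?_
    · rw [AlgHom.comp_apply] at h1
      rw [h1, h2, ← key, ctExp_C_mul, Polynomial.C_sub, Polynomial.C_mul]
      ring
    · rw [Polynomial.C_mul, hN₃]
  · rw [← Polynomial.C_mul]
    exact Polynomial.X_sub_C_ne_zero _
  · rw [← Polynomial.C_mul, ← Polynomial.C_sub, Polynomial.C_ne_zero]
    exact sub_ne_zero.mpr hι

/-- Setting y_j = 1 and all other generators to 0 separates the two elements. -/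
theorem algebraMap_mul_X_ne_X {k : ℕ} {i j : Fin k} (h : i ≠ j) (c : K) :
    algebraMap K _ c * toSealed K k (MvPolynomial.X i) ≠ toSealed K k (MvPolynomial.X j) := by
  intro h'
  have h2 : (algebraMap K (V K k) c * MvPolynomial.X i : V K k) = MvPolynomial.X j := h'
  have h3 := congrArg (pleth (K := K) (fun _ => (0 : K)) (fun l => if l = j then 1 else 0)) h2
  rw [map_mul, AlgHom.commutes, pleth_X, pleth_X, if_neg h, if_pos rfl, mul_zero] at h3
  exact zero_ne_one h3

theorem X_mul_raiseSubst_secondComm (F : V K (m + 1)) :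
    MvPolynomial.X (Fin.last (m + 1)) * raiseSubst q (m + 1) (secondComm q t m F)
      = secondComm q t (m + 1) (opT q (m + 2) (m + 1)
        (MvPolynomial.X (Fin.last (m + 1)) * raiseSubst q (m + 1) F)) := by
  apply toSealed_injective
  rw [map_mul (toSealed _ _)]
  exact algHom_X_mul_raiseSubst_secondComm q t (toSealed K (m + 2))
    (algebraMap_mul_X_ne_X (by simp [Fin.ext_iff]) t) F

end SecondComm

/-! ### The relation between the second commutator and d_+^* -/

section SecondComm

variable {K : Type} [Field K] [CharZero K] (q t : K) {R : Type} [CommRing R] [Algebra K R] {m : ℕ}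

/-- The nodes are v₁ = t y_1 and v₂ = t y_2, taken in both orders for the second divided differences
`M₂` and `M₂'`; the right side imitates the numerator of T_1. -/
theorem divided_difference_symm {A : Type*} [CommRing A] [IsDomain A]
    {X v₁ v₂ Q H h₁ h₂ e e' N M M₂ M' M₂' : A} (h1 : X - v₁ ≠ 0) (h2 : X - v₂ ≠ 0)
    (h12 : v₁ - v₂ ≠ 0) (hN : (X - v₁) * N = H - h₁) (hM : (X - v₂) * M = H - h₂)
    (hM₂ : (X - v₁) * M₂ = M - e) (he : (v₁ - v₂) * e = h₁ - h₂)
    (hM' : (X - v₁) * M' = H - h₁) (hM₂' : (X - v₂) * M₂' = M' - e')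
    (he' : (v₂ - v₁) * e' = h₂ - h₁) :
    (v₂ - v₁) * (Q * (v₁ * N))
      = (Q - 1) * (v₁ * (v₂ * (M + (v₁ - Q * v₁) * M₂)))
        + (v₂ - Q * v₁) * (v₁ * (M' + (v₂ - Q * v₂) * M₂')) := by
  apply mul_left_cancel₀ (mul_ne_zero (mul_ne_zero h1 h2) h12)
  linear_combination (v₂ - v₁) * Q * v₁ * (X - v₂) * (v₁ - v₂) * hN
    - (Q - 1) * v₁ * v₂ * (X - v₁) * (v₁ - v₂) * hM
    - (Q - 1) * v₁ ^ 2 * v₂ * (1 - Q) * (X - v₂) * (v₁ - v₂) * hM₂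
    - (Q - 1) * v₁ ^ 2 * v₂ * (1 - Q) * (v₁ - v₂) * hM
    + (Q - 1) * v₁ ^ 2 * v₂ * (1 - Q) * (X - v₂) * he
    - (v₂ - Q * v₁) * v₁ * (X - v₂) * (v₁ - v₂) * hM'
    - (v₂ - Q * v₁) * v₁ * v₂ * (1 - Q) * (X - v₁) * (v₁ - v₂) * hM₂'
    - (v₂ - Q * v₁) * v₁ * v₂ * (1 - Q) * (v₁ - v₂) * hM'
    - (v₂ - Q * v₁) * v₁ * v₂ * (1 - Q) * (X - v₁) * he'

/-- The outer d_+^* moves the node of the commutator from t y_1 to t y_2 and adds (q-1)t y_1 to the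
alphabet; removing this costs the divided difference `M₂` at t y_1. -/
theorem algHom_starHom_secondComm (ι : V K (m + 2) →ₐ[K] R) (F : V K (m + 1)) {v₁ v₂ : R}
    (h₁ : algebraMap K R t * ι (MvPolynomial.X 0) = v₁)
    (h₂ : algebraMap K R t * ι (MvPolynomial.X 1) = v₂) {H : Polynomial R}
    (hH : lowerMap q ((ι.comp (starHom q t (m + 1))).comp (starHom q t m)) F = H) :
    ∃ M M₂, (Polynomial.X - Polynomial.C v₂) * M = H - Polynomial.C (H.eval v₂) ∧
      (Polynomial.X - Polynomial.C v₁) * M₂ = M - Polynomial.C (M.eval v₁) ∧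
      ι (starHom q t (m + 1) (secondComm q t m F)) = (1 - algebraMap K R q) * v₂
        * ctExp K (fun n => ι (MvPolynomial.C (pSum n)))
          (M + Polynomial.C (v₁ - algebraMap K R q * v₁) * M₂) := by
  have hX : (ι.comp (starHom q t (m + 1))) (MvPolynomial.X 0) = ι (MvPolynomial.X 1) := by
    rw [AlgHom.comp_apply, starHom_X]; rfl
  obtain ⟨M, hM⟩ := exists_divided_difference q t (ι.comp (starHom q t (m + 1))) F
  obtain ⟨M₂, hM₂⟩ := exists_X_sub_C_mul_eq M v₁
  have h := algHom_secondComm q t (ι.comp (starHom q t (m + 1))) F hM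
  rw [← eval_lowerMap_starHom, hX, hH, h₂] at hM
  refine ⟨M, M₂, hM, hM₂, ?_⟩
  rw [hX, h₂] at h
  refine h.trans (congrArg _ (ctExp_shift K (fun n => ?_) hM₂))
  simp only [AlgHom.comp_apply, starHom_C, map_add, map_mul, map_sub, map_pow, map_one,
    AlgHom.commutes, mul_pow, ← h₁]
  ring

theorem algHom_secondComm_starHom [IsDomain R] (ι : V K (m + 2) →ₐ[K] R) (ht : t ≠ 0)
    (hι : ι (MvPolynomial.X 0) ≠ ι (MvPolynomial.X 1)) (F : V K (m + 1)) :
    algebraMap K R q * ι (secondComm q t (m + 1) (starHom q t (m + 1) F))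
      = ι (opT q (m + 2) 1 (starHom q t (m + 1) (secondComm q t m F))) := by
  have ht' : algebraMap K R t ≠ 0 := (map_ne_zero (algebraMap K R)).mpr ht
  obtain ⟨N, hN⟩ := exists_divided_difference q t ι (starHom q t (m + 1) F)
  obtain ⟨M, M₂, hM, hM₂, h1⟩ := algHom_starHom_secondComm q t ι F rfl rfl rfl
  have hsw : ((ι.comp (swapHom 0 1)).comp (starHom q t (m + 1))).comp (starHom q t m)
      = (ι.comp (starHom q t (m + 1))).comp (starHom q t m) :=
    AlgHom.ext fun F => congrArg ι (swapHom_starHom_starHom q t F)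
  have h0 : (ι.comp (swapHom 0 1)) (MvPolynomial.X 0) = ι (MvPolynomial.X 1) := by
    rw [AlgHom.comp_apply, swapHom_X, Equiv.swap_apply_left]
  have h1' : (ι.comp (swapHom 0 1)) (MvPolynomial.X 1) = ι (MvPolynomial.X 0) := by
    rw [AlgHom.comp_apply, swapHom_X, Equiv.swap_apply_right]
  -- T_1 also involves the exchanged element: the same formula holds with nodes interchanged and H
  -- unchanged, since two applications of d_+^* are symmetric in y_1, y_2.
  obtain ⟨M', M₂', hM', hM₂', h2⟩ := algHom_starHom_secondComm q t (ι.comp (swapHom 0 1)) F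
    (congrArg _ h0) (congrArg _ h1') (congrArg (fun φ => lowerMap q φ F) hsw)
  have h3 := algHom_secondComm q t ι (starHom q t (m + 1) F) hN
  rw [← eval_lowerMap_starHom, lowerMap_starHom] at hN
  simp only [AlgHom.comp_apply, swapHom_C] at h2
  have he := congrArg (fun G => Polynomial.C (Polynomial.eval
    (algebraMap K R t * ι (MvPolynomial.X 0)) G)) hM
  have he' := congrArg (fun G => Polynomial.C (Polynomial.eval
    (algebraMap K R t * ι (MvPolynomial.X 1)) G)) hM'
  have hT := map_heckeAux q ι (a := 0) (b := 1) (by simp)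
    (starHom q t (m + 1) (secondComm q t m F))
  have hne : algebraMap K R t * ι (MvPolynomial.X 0) - algebraMap K R t * ι (MvPolynomial.X 1)
      ≠ 0 := sub_ne_zero.mpr fun h => hι (mul_left_cancel₀ ht' h)
  generalize lowerMap q ((ι.comp (starHom q t (m + 1))).comp (starHom q t m)) F = H at *
  simp only [Polynomial.eval_mul, Polynomial.eval_sub, Polynomial.eval_X,
    Polynomial.eval_C, Polynomial.C_mul (a := _ - _), Polynomial.C_sub] at he he'
  have key := congrArg (ctExp K (fun n => ι (MvPolynomial.C (pSum n))))
    (divided_difference_symm (Q := Polynomial.C (algebraMap K R q))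
      (Polynomial.X_sub_C_ne_zero _) (Polynomial.X_sub_C_ne_zero _)
      (by rwa [← Polynomial.C_sub, Polynomial.C_ne_zero]) hN hM hM₂ he hM' hM₂' he')
  simp only [← Polynomial.C_mul, ← Polynomial.C_sub, ← Polynomial.C_1, map_add, ctExp_C_mul] at key h1 h2
  have hT' : opT q (m + 2) 1 = heckeAux q 0 1 (by simp) := opT_eq q (by omega)
  rw [hT']
  apply mul_left_cancel₀ (mul_ne_zero ht' hne)
  rw [h3]
  linear_combination -algebraMap K R t * (1 - algebraMap K R q) * key
    + algebraMap K R t ^ 2 * hT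
    + algebraMap K R t ^ 2 * (algebraMap K R q - 1) * ι (MvPolynomial.X 0) * h1
    + algebraMap K R t ^ 2 * (ι (MvPolynomial.X 1)
      - algebraMap K R q * ι (MvPolynomial.X 0)) * h2

theorem opT_starHom_secondComm (ht : t ≠ 0) (F : V K (m + 1)) :
    opT q (m + 2) 1 (starHom q t (m + 1) (secondComm q t m F))
      = q • secondComm q t (m + 1) (starHom q t (m + 1) F) := by
  have h := algHom_secondComm_starHom q t (toSealed K (m + 2)) ht
    (fun h => by simpa [Fin.ext_iff] using MvPolynomial.X_injective (toSealed_injective _ _ h)) F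
  rw [Algebra.smul_def]
  exact h.symm

end SecondComm

/-! ### Partial evaluation and divided differences in the inner variable -/

section Iterated

variable {K : Type} [Field K] {R : Type} [CommRing R] [Algebra K R]

theorem polySwap_polySwap (Z : Polynomial (Polynomial R)) :
    polySwap K R (polySwap K R Z) = Z :=
  Polynomial.Bivariate.swap_swap_apply Z

/-- Evaluation of the inner variable at `v`, as an endomorphism of the ring of polynomials. -/
def constHom (v : R) : Polynomial R →ₐ[K] Polynomial R :=
  (IsScalarTower.toAlgHom K R (Polynomial R)).comp (evalHom v)

theorem constHom_apply (v : R) (G : Polynomial R) :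
    constHom (K := K) v G = Polynomial.C (G.eval v) :=
  congrArg Polynomial.C (evalHom_apply (K := K) v G)

theorem polySwap_C_eval (v : R) (Z : Polynomial (Polynomial R)) :
    polySwap K R (Polynomial.C (Z.eval (Polynomial.C v)))
      = polyMap (constHom (K := K) v) (polySwap K R Z) := by
  induction Z using Polynomial.induction_on' with
  | add p q hp hq => rw [Polynomial.eval_add, Polynomial.C_add, map_add, map_add, map_add, hp, hq]
  | monomial n r =>
    rw [← Polynomial.C_mul_X_pow_eq_monomial, map_mul (polySwap K R), map_mul (polyMap _), map_pow,
      map_pow, polySwap_X, polyMap_C, constHom_apply, Polynomial.eval_X, Polynomial.eval_mul,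
      Polynomial.eval_C, Polynomial.eval_pow, Polynomial.eval_X, Polynomial.C_mul,
      map_mul (polySwap K R), Polynomial.C_pow, map_pow, polySwap_C_C]
    congr 1
    induction r using Polynomial.induction_on' with
    | add p q hp hq =>
      rw [Polynomial.C_add, map_add, map_add]
      exact congrArg₂ (· + ·) hp hq
    | monomial n r =>
      rw [← Polynomial.C_mul_X_pow_eq_monomial, Polynomial.C_mul, map_mul (polySwap K R),
        map_mul (polyMap _), Polynomial.C_pow, map_pow, polySwap_C_X, polySwap_C_C, map_pow,
        polyMap_X, polyMap_C, constHom_apply, Polynomial.eval_C]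

theorem exists_C_X_sub_C_mul_eq (v : R) (G : Polynomial (Polynomial R)) :
    ∃ M : Polynomial (Polynomial R), Polynomial.C (Polynomial.X - Polynomial.C v) * M
      = G - polyMap (constHom (K := K) v) G := by
  induction G using Polynomial.induction_on' with
  | add p q hp hq =>
    obtain ⟨M, hM⟩ := hp
    obtain ⟨M', hM'⟩ := hq
    exact ⟨M + M', by rw [mul_add, hM, hM', map_add]; ring⟩
  | monomial n r =>
    obtain ⟨s, hs⟩ := exists_X_sub_C_mul_eq r v
    refine ⟨Polynomial.C s * Polynomial.X ^ n, ?_⟩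
    rw [← Polynomial.C_mul_X_pow_eq_monomial, map_mul (polyMap _), map_pow, polyMap_X, polyMap_C,
      constHom_apply, ← mul_assoc, ← Polynomial.C_mul, hs, Polynomial.C_sub, sub_mul]

theorem eq_zero_of_X_sub_C_mul_eq_C [IsDomain R] {d c : R} {Z : Polynomial R}
    (h : (Polynomial.X - Polynomial.C d) * Z = Polynomial.C c) : Z = 0 := by
  have h1 := congrArg (Polynomial.eval d) h
  rw [Polynomial.eval_mul, Polynomial.eval_sub, Polynomial.eval_X, Polynomial.eval_C, sub_self,
    zero_mul, Polynomial.eval_C] at h1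
  rw [← h1, Polynomial.C_0] at h
  exact (mul_eq_zero.mp h).resolve_left (Polynomial.X_sub_C_ne_zero d)

theorem X_sub_C_mul_X_ne_zero [IsDomain R] (q : K) :
    (Polynomial.X - Polynomial.C (algebraMap K (Polynomial R) q) * Polynomial.C Polynomial.X :
      Polynomial (Polynomial R)) ≠ 0 := by
  rw [← Polynomial.C_mul]
  exact Polynomial.X_sub_C_ne_zero _

theorem C_mul_X_sub_C_ne_zero [IsDomain R] {q : K} (hq : q ≠ 0) (v : R) :
    (Polynomial.C (algebraMap K (Polynomial R) q) * Polynomial.C Polynomial.X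
      - Polynomial.C (Polynomial.C v) : Polynomial (Polynomial R)) ≠ 0 := by
  rw [← Polynomial.C_mul, ← Polynomial.C_sub, Polynomial.C_ne_zero, ← C_algebraMap]
  intro h
  have h1 := congrArg (fun G => Polynomial.coeff G 1) h
  simp only [Polynomial.coeff_sub, Polynomial.coeff_C_mul, Polynomial.coeff_X_one, mul_one,
    Polynomial.coeff_C_succ, sub_zero, Polynomial.coeff_zero] at h1
  exact hq ((map_eq_zero (algebraMap K R)).mp h1)

end Iterated

/-! ### The relation between the second commutator and d_- -/

section LowerSecondComm

/-- J is a function of (x, y), s is J(y, x), and jxv, jvx, jvy, jyv, jxq are its values at (x,v),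
(v,x), (v,y), (y,v), (x,Qx). The point is the shape of the right side: it changes sign when x and y
are exchanged. -/
theorem iterated_divided_difference_eq {A : Type*} [CommRing A] [IsDomain A]
    {x y v Q J s jxv jvx jvy jyv jxq N n N₂ J' jp jpq J'v M₁ m₁ M₃ M₅ : A}
    (hyx : y - Q * x ≠ 0) (hxv : Q * x - v ≠ 0)
    (h1 : (y - v) * N = J - jxv) (h2 : (Q * x - v) * n = jxq - jxv)
    (h3 : (y - Q * x) * N₂ = N - n)
    (h4 : (y - x) * J' = (Q - 1) * (x * J) + (y - Q * x) * s)
    (h5 : (v - x) * jp = (Q - 1) * (x * jxv) + (v - Q * x) * jvx)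
    (h6 : (Q * x - x) * jpq = (Q - 1) * (x * jxq))
    (h7 : (y - v) * J'v = (Q - 1) * (v * jvy) + (y - Q * v) * jyv)
    (h8 : (y - v) * M₁ = J' - jp) (h10 : (Q * x - v) * m₁ = jpq - jp)
    (h11 : (y - Q * x) * M₃ = J' + (v - Q * v) * M₁ - (jpq + (v - Q * v) * m₁))
    (h12 : (x - v) * M₅ = J' + (v - Q * v) * M₁ + (Q * x - x) * M₃ - J'v) :
    (y - v) * (x - v) * (Q * (N + (Q * x - x) * N₂) - M₅)
      = (x - Q * v) * (J - jxv) - (y - Q * v) * (s - jyv) + (1 - Q) * v * (jvx - jvy) := by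
  apply mul_left_cancel₀ (mul_ne_zero hyx hxv)
  linear_combination Q * (x - v) * ((Q * x - v) * (y - v) * (Q * x - x) * h3
      + (Q * x - v) * (y - x) * h1 - (Q * x - x) * (y - v) * h2)
    - (y - v) * (y - Q * x) * (Q * x - v) * h12
    - ((y - v) * (Q * x - v) * (Q * x - x) * h11 + (Q * x - v) * (y - x) * (v - Q * v) * h8
      - (y - v) * (Q * x - x) * (v - Q * v) * h10 - (y - v) * Q * (x - v) * h6)
    + (y - Q * x) * (Q * x - v) * h7 - (Q * x - v) * (y - Q * v) * h4
    - (v - Q * v) * (y - Q * x) * h5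

variable {K : Type} [Field K] [CharZero K] (q t : K) {R : Type} [CommRing R] [Algebra K R] {m : ℕ}

/-- The commutator formula is used with coefficients in which x is already lowered; its alphabet X -
(q-1)x is then reduced to X through the divided difference `N₂` at qx. -/
theorem algHom_opDm_secondComm (ι : V K (m + 1) →ₐ[K] R) (F : V K (m + 2)) {v : R}
    (hv : algebraMap K R t * ι (MvPolynomial.X 0) = v) {J : Polynomial (Polynomial R)}
    (hJ : lowerMap₂ q (ι.comp (starHom q t m)) F = J) :
    ∃ N N₂ : Polynomial (Polynomial R),
      (Polynomial.X - Polynomial.C (Polynomial.C v)) * N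
        = J - Polynomial.C (J.eval (Polynomial.C v)) ∧
      (Polynomial.X - Polynomial.C (algebraMap K _ q * Polynomial.X)) * N₂
        = N - Polynomial.C (N.eval (algebraMap K _ q * Polynomial.X)) ∧
      ι (opDm q (m + 1) (secondComm q t (m + 1) F)) = (1 - algebraMap K R q) * v
        * ctExp K (fun n => ι (MvPolynomial.C (pSum n)))
          (ctExp K (fun n => Polynomial.C (ι (MvPolynomial.C (pSum n))))
            (N + Polynomial.C (algebraMap K _ q * Polynomial.X - Polynomial.X) * N₂)) := by
  have hX : algebraMap K (Polynomial R) t * lowerMap q ι (MvPolynomial.X 0) = Polynomial.C v := by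
    have : (0 : Fin (m + 2)) = Fin.castSucc 0 := rfl
    rw [this, lowerMap_X_castSucc, ← hv, Polynomial.C_mul, C_algebraMap]
  have hH : lowerMap q ((lowerMap q ι).comp (starHom q t (m + 1))) F = J := by
    rw [← hJ]
    exact congrArg (fun φ => lowerMap q φ F) (AlgHom.ext fun G => lowerMap_starHom q t ι G)
  obtain ⟨N, hN⟩ := exists_divided_difference q t (lowerMap q ι) F
  obtain ⟨N₂, hN₂⟩ := exists_X_sub_C_mul_eq N (algebraMap K (Polynomial R) q * Polynomial.X)
  have h := algHom_secondComm q t (lowerMap q ι) F hN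
  rw [← eval_lowerMap_starHom, hX, hH] at hN
  refine ⟨N, N₂, hN, hN₂, ?_⟩
  rw [algHom_opDm, h, hX, ctExp_shift K (lowerMap_C_shift q ι) hN₂, ← C_algebraMap,
    ← Polynomial.C_1, ← Polynomial.C_sub, ← Polynomial.C_mul, ctExp_C_mul]

/-- The inner d_- acts against X + (q-1)v - (q-1)x, which becomes X in two shifts, at v (`M₁`) and
at qx (`M₃`). The commutator then takes a divided difference in x at v (`M₅`). -/
theorem algHom_secondComm_opDm [IsDomain R] (ι : V K (m + 1) →ₐ[K] R) (F : V K (m + 2)) {v : R}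
    (hv : algebraMap K R t * ι (MvPolynomial.X 0) = v) {J : Polynomial (Polynomial R)}
    (hJ : lowerMap₂ q (ι.comp (starHom q t m)) F = J) :
    ∃ M₁ M₃ M₅ : Polynomial (Polynomial R),
      (Polynomial.X - Polynomial.C (Polynomial.C v)) * M₁
        = J - Polynomial.C (J.eval (Polynomial.C v)) ∧
      (Polynomial.X - Polynomial.C (algebraMap K _ q * Polynomial.X)) * M₃
        = J + Polynomial.C (Polynomial.C v - algebraMap K _ q * Polynomial.C v) * M₁
          - Polynomial.C ((J + Polynomial.C (Polynomial.C v - algebraMap K _ q * Polynomial.C v)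
            * M₁).eval (algebraMap K _ q * Polynomial.X)) ∧
      (Polynomial.C Polynomial.X - Polynomial.C (Polynomial.C v)) * M₅
        = J + Polynomial.C (Polynomial.C v - algebraMap K _ q * Polynomial.C v) * M₁
          + Polynomial.C (algebraMap K _ q * Polynomial.X - Polynomial.X) * M₃
          - polyMap (constHom (K := K) v) J ∧
      ι (secondComm q t m (opDm q (m + 1) F)) = (1 - algebraMap K R q) * v
        * ctExp K (fun n => ι (MvPolynomial.C (pSum n)))
          (ctExp K (fun n => Polynomial.C (ι (MvPolynomial.C (pSum n)))) M₅) := by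
  obtain ⟨M₁, h1⟩ := exists_X_sub_C_mul_eq J (Polynomial.C v)
  obtain ⟨M₃, h3⟩ := exists_X_sub_C_mul_eq
    (J + Polynomial.C (Polynomial.C v - algebraMap K _ q * Polynomial.C v) * M₁)
    (algebraMap K (Polynomial R) q * Polynomial.X)
  obtain ⟨M₅, h5⟩ := exists_C_X_sub_C_mul_eq (K := K) v
    (J + Polynomial.C (Polynomial.C v - algebraMap K _ q * Polynomial.C v) * M₁
      + Polynomial.C (algebraMap K _ q * Polynomial.X - Polynomial.X) * M₃)
  have h6 : lowerMap q (ι.comp (starHom q t m)) (opDm q (m + 1) F)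
      = ctExp K (fun n => Polynomial.C (ι (MvPolynomial.C (pSum n))))
        (J + Polynomial.C (Polynomial.C v - algebraMap K _ q * Polynomial.C v) * M₁
          + Polynomial.C (algebraMap K _ q * Polynomial.X - Polynomial.X) * M₃) := by
    rw [algHom_opDm]
    refine (congrArg _ hJ).trans ((ctExp_shift K (a := fun n => Polynomial.C (ι (MvPolynomial.C
      (pSum n))) - (algebraMap K _ q ^ (n : ℕ) - 1) * Polynomial.X ^ (n : ℕ)) (fun n => ?_)
      h1).trans (ctExp_shift K (fun n => ?_) h3))
    · simp only [lowerMap_C, AlgHom.comp_apply, starHom_C, map_add, map_mul, map_sub, map_pow,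
        map_one, AlgHom.commutes, ← hv, mul_pow, C_algebraMap]
      ring
    · ring
  -- At x = v the alphabet is X already, and the two corrections cancel: there (y - qv)(M₃ - M₁) is
  -- constant in y, so M₃ = M₁.
  have h7 : polyMap (constHom (K := K) v)
      (J + Polynomial.C (Polynomial.C v - algebraMap K _ q * Polynomial.C v) * M₁
        + Polynomial.C (algebraMap K _ q * Polynomial.X - Polynomial.X) * M₃)
      = polyMap (constHom (K := K) v) J := by
    have e1 := congrArg (polyMap (constHom (K := K) v)) h1
    have e3 := congrArg (polyMap (constHom (K := K) v)) h3
    simp only [map_mul (polyMap _), map_sub (polyMap _), map_add (polyMap _), polyMap_X, polyMap_C,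
      constHom_apply, Polynomial.eval_mul, Polynomial.eval_sub, Polynomial.eval_X,
      Polynomial.eval_C, Polynomial.eval_add, ← C_algebraMap] at e1 e3 ⊢
    generalize Polynomial.eval v _ = k₁ at e1
    generalize Polynomial.eval v _ + _ = k₃ at e3
    have e : polyMap (constHom (K := K) v) M₃ - polyMap (constHom (K := K) v) M₁ = 0 := by
      refine eq_zero_of_X_sub_C_mul_eq_C (d := Polynomial.C (algebraMap K R q * v))
        (c := Polynomial.C (k₁ - k₃)) ?_
      simp only [Polynomial.C_sub, Polynomial.C_mul] at e1 e3 ⊢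
      linear_combination e3 - e1
    rw [sub_eq_zero.mp e]
    simp only [Polynomial.C_sub]
    ring
  refine ⟨M₁, M₃, M₅, h1, h3, ?_, ?_⟩
  · rw [← Polynomial.C_sub, h5, h7]
  · refine (algHom_secondComm q t ι _ (N := ctExp K (fun n => Polynomial.C (ι (MvPolynomial.C
      (pSum n)))) M₅) ?_).trans (by rw [hv])
    rw [← eval_lowerMap_starHom, h6, hv, ← ctExp_C_mul, h5, map_sub, ← constHom_apply (K := K),
      algHom_ctExp]
    simp only [constHom_apply, Polynomial.eval_C]

theorem algHom_opDm_secondComm_eq [IsDomain R] (ι : V K (m + 1) →ₐ[K] R) (hq : q ≠ 0)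
    (F : V K (m + 2)) :
    algebraMap K R q * ι (opDm q (m + 1) (secondComm q t (m + 1) F))
      = ι (secondComm q t m (opDm q (m + 1) (opT q (m + 2) (m + 1) F))) := by
  obtain ⟨N, N₂, h1, h3, hl⟩ := algHom_opDm_secondComm q t ι F rfl rfl
  obtain ⟨M₁, M₃, M₅, h8, h11, h12, hr⟩ := algHom_secondComm_opDm q t ι
    (opT q (m + 2) (m + 1) F) rfl rfl
  generalize algebraMap K R t * ι (MvPolynomial.X 0) = v at *
  have h4 := map_heckeAux q (lowerMap₂ q (ι.comp (starHom q t m)))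
    (Fin.castSucc_lt_last (Fin.last m)).ne F
  have hx : lowerMap₂ q (ι.comp (starHom q t m)) (MvPolynomial.X (Fin.last m).castSucc)
      = Polynomial.C Polynomial.X := by
    rw [lowerMap₂, lowerMap_X_castSucc, lowerMap_X_last]
  have hy : lowerMap₂ q (ι.comp (starHom q t m)) (MvPolynomial.X (Fin.last (m + 1)))
      = Polynomial.X := by
    rw [lowerMap₂, lowerMap_X_last]
  rw [← opT_last, ← polySwap_lowerMap₂, hx, hy, ← C_algebraMap (R := Polynomial R)] at h4
  generalize lowerMap₂ q (ι.comp (starHom q t m)) (opT q (m + 2) (m + 1) F) = J' at *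
  generalize lowerMap₂ q (ι.comp (starHom q t m)) F = J at *
  have h2 := congrArg (fun G => Polynomial.C (Polynomial.eval
    (algebraMap K (Polynomial R) q * Polynomial.X) G)) h1
  have h5 := congrArg (fun G => Polynomial.C (Polynomial.eval (Polynomial.C v) G)) h4
  have h6 := congrArg (fun G => Polynomial.C (Polynomial.eval
    (algebraMap K (Polynomial R) q * Polynomial.X) G)) h4
  have h7 := congrArg (polyMap (constHom (K := K) v)) h4
  have h10 := congrArg (fun G => Polynomial.C (Polynomial.eval
    (algebraMap K (Polynomial R) q * Polynomial.X) G)) h8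
  have hs := polySwap_C_eval (K := K) v J
  have hs' := polySwap_C_eval (K := K) v (polySwap K R J)
  rw [polySwap_polySwap] at hs'
  have hX : constHom (K := K) v Polynomial.X = Polynomial.C v := by
    rw [constHom_apply, Polynomial.eval_X]
  simp only [map_mul (polyMap _), map_sub (polyMap _), map_add (polyMap _), polyMap_X, polyMap_C,
    hX, AlgHom.commutes, Polynomial.eval_mul, Polynomial.eval_sub, Polynomial.eval_X,
    Polynomial.eval_C, Polynomial.eval_add, Polynomial.eval_one, map_one, sub_self, zero_mul,
    add_zero, Polynomial.C_mul, Polynomial.C_add, Polynomial.C_sub]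
    at h1 h2 h3 h4 h5 h6 h7 h8 h10 h11 h12
  have key := iterated_divided_difference_eq (X_sub_C_mul_X_ne_zero q)
    (C_mul_X_sub_C_ne_zero hq v) h1 h2 h3 h4 h5 h6 h7 h8 h10 h11 h12
  rw [← hs, ← hs'] at key
  have key' := congrArg (polySwap K R) key
  have hQ : polySwap K R (Polynomial.C (algebraMap K (Polynomial R) q))
      = Polynomial.C (algebraMap K (Polynomial R) q) := by
    rw [C_algebraMap, AlgHom.commutes]
  have hne : (Polynomial.X - Polynomial.C (Polynomial.C v))
      * (Polynomial.C Polynomial.X - Polynomial.C (Polynomial.C v))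
      ≠ (0 : Polynomial (Polynomial R)) :=
    mul_ne_zero (Polynomial.X_sub_C_ne_zero _) (by
      rw [← Polynomial.C_sub, Polynomial.C_ne_zero]; exact Polynomial.X_sub_C_ne_zero _)
  generalize hZ : Polynomial.C (algebraMap K (Polynomial R) q) * (N
    + (Polynomial.C (algebraMap K (Polynomial R) q) * Polynomial.C Polynomial.X
      - Polynomial.C Polynomial.X) * N₂) - M₅ = Z at key key'
  simp only [map_mul (polySwap K R), map_sub (polySwap K R), map_add (polySwap K R), polySwap_X,
    polySwap_C_X, polySwap_C_C, polySwap_polySwap, map_one, hQ] at key'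
  -- The factor (y - v)(x - v) is symmetric and the right side of `key` antisymmetric, so Z is
  -- antisymmetric.
  have h0 : Z + polySwap K R Z = 0 := by
    apply (mul_eq_zero.mp _).resolve_left hne
    linear_combination key + key'
  have h0' := congrArg (fun Z => ctExp K (fun n => ι (MvPolynomial.C (pSum n)))
    (ctExp K (fun n => Polynomial.C (ι (MvPolynomial.C (pSum n)))) Z)) h0
  simp only [map_add, map_zero] at h0'
  -- Twice the iterated constant term of Z is zero, and 2 is invertible.
  rw [ctExp_ctExp_polySwap, ← two_mul, ← map_ofNat (algebraMap K R) 2] at h0'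
  have h00 := (mul_eq_zero.mp h0').resolve_left
    ((map_ne_zero (algebraMap K R)).mpr two_ne_zero)
  rw [← hZ, map_sub, map_sub, ctExp_C_mul, ← C_algebraMap, ctExp_C_mul] at h00
  rw [hl, hr, ← sub_eq_zero.mp h00]
  simp only [Polynomial.C_sub, Polynomial.C_mul, C_algebraMap]
  ring

theorem opDm_secondComm (hq : q ≠ 0) (F : V K (m + 2)) :
    q • opDm q (m + 1) (secondComm q t (m + 1) F)
      = secondComm q t m (opDm q (m + 1) (opT q (m + 2) (m + 1) F)) := by
  rw [Algebra.smul_def]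
  exact algHom_opDm_secondComm_eq q t (toSealed K (m + 1)) hq F

end LowerSecondComm

/-! ### Inverses of the T_i -/

section Inverse

variable {K : Type} [Field K] {q : K} {k : ℕ}

/-- The quadratic relation reads T(T + q - 1) = q. -/
theorem isUnit_opT (hq : q ≠ 0) {i : ℕ} (h₁ : 1 ≤ i) (h₂ : i < k) : IsUnit (opT q k i) := by
  have h : opT q k i * opT q k i = (1 - q) • opT q k i + q • 1 :=
    LinearMap.ext fun F => by
      refine (opT_quadratic q h₁ h₂ F).trans ?_
      rw [LinearMap.add_apply, LinearMap.smul_apply, LinearMap.smul_apply, Module.End.one_apply,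
        Algebra.smul_def, Algebra.smul_def, map_sub, map_one]
  refine ⟨⟨opT q k i, q⁻¹ • (opT q k i + (q - 1) • 1), ?_, ?_⟩, rfl⟩
  · rw [mul_smul_comm, mul_add, h, mul_smul_comm, mul_one, inv_smul_eq_iff₀ hq]
    module
  · rw [smul_mul_assoc, add_mul, h, smul_mul_assoc, one_mul, inv_smul_eq_iff₀ hq]
    module

theorem opT_inverse_apply (hq : q ≠ 0) {i : ℕ} (h₁ : 1 ≤ i) (h₂ : i < k) (F : V K k) :
    opT q k i (Ring.inverse (opT q k i) F) = F :=
  LinearMap.congr_fun (Ring.mul_inverse_cancel _ (isUnit_opT hq h₁ h₂)) F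

theorem inverse_opT_apply (hq : q ≠ 0) {i : ℕ} (h₁ : 1 ≤ i) (h₂ : i < k) (F : V K k) :
    Ring.inverse (opT q k i) (opT q k i F) = F :=
  LinearMap.congr_fun (Ring.inverse_mul_cancel _ (isUnit_opT hq h₁ h₂)) F

theorem inverse_opT (hq : q ≠ 0) {i : ℕ} (h₁ : 1 ≤ i) (h₂ : i < k) :
    Ring.inverse (opT q k i) = q⁻¹ • (opT q k i + (q - 1) • 1) := by
  refine LinearMap.ext fun F => ?_
  have h := opT_quadratic q h₁ h₂ (Ring.inverse (opT q k i) F)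
  rw [opT_inverse_apply hq h₁ h₂] at h
  rw [LinearMap.smul_apply, eq_inv_smul_iff₀ hq, LinearMap.add_apply, h, LinearMap.smul_apply,
    Module.End.one_apply, Algebra.smul_def, Algebra.smul_def, map_sub, map_one]
  ring

theorem opDm_inverse_opT [CharZero K] (hq : q ≠ 0) {i : ℕ} (h₁ : 1 ≤ i) (h₂ : i < k)
    (F : V K (k + 1)) :
    Ring.inverse (opT q k i) (opDm q k F) = opDm q k (Ring.inverse (opT q (k + 1) i) F) := by
  rw [← inverse_opT_apply hq h₁ h₂ (opDm q k (Ring.inverse (opT q (k + 1) i) F)), ← opDm_opT q h₁ h₂,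
    opT_inverse_apply hq h₁ (by omega)]

theorem opDp_inverse_opT (hq : q ≠ 0) {i : ℕ} (h₁ : 1 ≤ i) (h₂ : i < k) (F : V K k) :
    opDp q k (Ring.inverse (opT q k i) F)
      = Ring.inverse (opT q (k + 1) (i + 1)) (opDp q k F) := by
  rw [← inverse_opT_apply hq (k := k + 1) (i := i + 1) (by omega) (by omega)
    (opDp q k (Ring.inverse (opT q k i) F)), ← opDp_opT q h₁ h₂, opT_inverse_apply hq h₁ h₂]

theorem starHom_inverse_opT (hq : q ≠ 0) (t : K) {i : ℕ} (h₁ : 1 ≤ i) (h₂ : i < k) (F : V K k) :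
    starHom q t k (Ring.inverse (opT q k i) F)
      = Ring.inverse (opT q (k + 1) (i + 1)) (starHom q t k F) := by
  rw [← inverse_opT_apply hq (k := k + 1) (i := i + 1) (by omega) (by omega)
    (starHom q t k (Ring.inverse (opT q k i) F)), ← starHom_opT q t h₁ h₂, opT_inverse_apply hq h₁ h₂]

/-- The operator `T_j⁻¹ ⋯ T_1⁻¹` on `V_n`. -/
def descInv (q : K) (n : ℕ) : ℕ → Module.End K (V K n)
  | 0 => LinearMap.id
  | j + 1 => Ring.inverse (opT q n (j + 1)) * descInv q n j

theorem descInv_ascT (hq : q ≠ 0) {n j : ℕ} (h : j < n) (F : V K n) :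
    descInv q n j (ascT q n j F) = F := by
  induction j generalizing F with
  | zero => rfl
  | succ j ih =>
    rw [ascT_succ, descInv, Module.End.mul_apply, ih (by omega),
      inverse_opT_apply hq (by omega) h]

/-- Passing d_+ raises every index by one; T_1⁻¹T_1 is inserted to complete the product down to
index 1. -/
theorem opDp_descInv (hq : q ≠ 0) {j : ℕ} (h : j < k) (F : V K k) :
    opDp q k (descInv q k j F)
      = descInv q (k + 1) (j + 1) (opT q (k + 1) 1 (opDp q k F)) := by
  induction j with
  | zero => exact (inverse_opT_apply hq le_rfl (by omega) _).symm
  | succ j ih =>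
    rw [descInv, Module.End.mul_apply, opDp_inverse_opT hq (by omega) h, ih (by omega)]
    rfl

end Inverse

/-! ### The operators z_i and the intertwining relations -/

section Intertwining

variable {K : Type} [Field K] [CharZero K] {q : K} (t : K) {m : ℕ}

theorem secondComm_opT {i : ℕ} (h₁ : 1 ≤ i) (h₂ : i < m) (F : V K (m + 1)) :
    secondComm q t m (opT q (m + 1) i F) = opT q (m + 1) (i + 1) (secondComm q t m F) := by
  rw [secondComm_apply, secondComm_apply, map_sub, opDm_opT q h₁ h₂, starHom_opT q t h₁ h₂,
    starHom_opT q t h₁ (by omega), opDm_opT q (by omega) (by omega)]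

theorem opT_secondComm_ascT {j : ℕ} (h : j < m) (F : V K (m + 1)) :
    opT q (m + 1) 1 (secondComm q t m (ascT q (m + 1) j F))
      = ascT q (m + 1) (j + 1) (secondComm q t m F) := by
  induction j generalizing F with
  | zero => rfl
  | succ j ih =>
    rw [ascT_succ, ih (by omega), secondComm_opT t (by omega) h]
    exact (ascT_succ q _ _ _).symm

/-- `X_mul_raiseSubst_secondComm` moves the commutator inside d_+ past raising; moving it out past
T_1⋯T_m raises their indices, and the extra T_1 completes the product. -/
theorem opDp_secondComm (F : V K (m + 1)) :
    opDp q (m + 1) (secondComm q t m F)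
      = opT q (m + 2) 1 (secondComm q t (m + 1) (opDp q (m + 1) F)) := by
  rw [opDp_apply, opDp_apply, X_mul_raiseSubst_secondComm, map_neg, map_neg, ascT_succ _ _ m
    (_ * raiseSubst _ _ _), opT_secondComm_ascT t (by omega)]

/-- The operator `z_{i+1}` on `V_{m+1}`. -/
def opZ (q t : K) (m : ℕ) : ℕ → Module.End K (V K (m + 1))
  | 0 => (q⁻¹ ^ m * (q⁻¹ - 1))⁻¹ • (secondComm q t m * descInv q (m + 1) m)
  | i + 1 => q⁻¹ • (opT q (m + 1) (i + 1) * opZ q t m i * opT q (m + 1) (i + 1))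

/-- The product T_m⁻¹⋯T_1⁻¹ in z_1 cancels T_1⋯T_m in d_+, leaving `secondComm_X_mul_raiseSubst`.
The power of q is (1-q)/(q^{-m}(q⁻¹-1)) = q^{m+1}, and the sign is that of d_+. -/
theorem opZ_zero_opDp (hq : q ≠ 0) (hq1 : q ≠ 1) (F : V K m) :
    opZ q t m 0 (opDp q m F)
      = -(t * q ^ (m + 1)) • (MvPolynomial.X 0 * starHom q t m F) := by
  rw [opZ, LinearMap.smul_apply, Module.End.mul_apply, opDp_apply, map_neg,
    descInv_ascT hq (by omega), map_neg, secondComm_X_mul_raiseSubst, ← Algebra.smul_def,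
    ← Algebra.smul_def, smul_neg, neg_smul, smul_smul, smul_smul]
  congr 2
  have : 1 - q ≠ 0 := sub_ne_zero.mpr hq1.symm
  have h : q⁻¹ - 1 = (1 - q) * q⁻¹ := by field_simp
  rw [h, inv_pow]
  field_simp
  ring

theorem opDp_opZ (hq : q ≠ 0) {i : ℕ} (h : i ≤ m) (F : V K (m + 1)) :
    opDp q (m + 1) (opZ q t m i F) = opZ q t (m + 1) (i + 1) (opDp q (m + 1) F) := by
  induction i generalizing F with
  | zero =>
    rw [opZ, opZ, opZ, LinearMap.smul_apply, LinearMap.smul_apply, Module.End.mul_apply,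
      Module.End.mul_apply, Module.End.mul_apply, LinearMap.smul_apply, Module.End.mul_apply,
      map_smul, map_smul, opDp_secondComm, opDp_descInv hq (by omega), smul_smul]
    -- Normalisations of z_1 on V_{m+1} and V_{m+2} differ by a factor q, absorbed by the q⁻¹ in z_2
    -- = q⁻¹T_1 z_1 T_1.
    congr 1
    rw [pow_succ, mul_inv, mul_inv, mul_inv]
    field_simp
  | succ i ih =>
    rw [opZ, LinearMap.smul_apply, Module.End.mul_apply, Module.End.mul_apply, map_smul,
      opDp_opT q (by omega) (by omega), ih (by omega), opDp_opT q (by omega) (by omega)]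
    rfl

end Intertwining

/-! The additive inverse of an operator on `V_*` is multiplication by `-1`; these instances are local
because they overlap with instances on spaces of linear maps. -/

local instance instNegEndVStar {K : Type} [Field K] : Neg (Module.End K (VStar K)) :=
  ⟨fun f => (-1 : K) • f⟩

local instance instRingEndVStar {K : Type} [Field K] : Ring (Module.End K (VStar K)) where
  __ := (Module.End.instSemiring : Semiring (Module.End K (VStar K)))
  zsmul := zsmulRec
  neg_add_cancel f := by
    have h : (-1 : K) • f + (1 : K) • f = ((-1 : K) + 1) • f := (add_smul (-1 : K) 1 f).symm
    rwa [one_smul, neg_add_cancel, zero_smul] at h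

/-! ### Operators on V_* supported on one summand -/

section Extend

variable {K : Type} [Field K] {k l m n : ℕ}

theorem extend_mul_extend (f : V K l →ₗ[K] V K m) (g : V K k →ₗ[K] V K l) :
    extend K f * extend K g = extend K (f ∘ₗ g) := by
  refine LinearMap.ext fun x => ?_
  change DirectSum.lof K ℕ (V K) m (f (DirectSum.component K ℕ (V K) l
    (DirectSum.lof K ℕ (V K) l (g (DirectSum.component K ℕ (V K) k x))))) = _
  rw [DirectSum.component.lof_self]
  rfl

theorem extend_mul_extend_of_ne (h : n ≠ l) (f : V K l →ₗ[K] V K m) (g : V K k →ₗ[K] V K n) :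
    extend K f * extend K g = 0 := by
  refine LinearMap.ext fun x => ?_
  change DirectSum.lof K ℕ (V K) m (f (DirectSum.component K ℕ (V K) l
    (DirectSum.lof K ℕ (V K) n (g (DirectSum.component K ℕ (V K) k x))))) = 0
  rw [DirectSum.component.of, dif_neg h, map_zero, map_zero]

theorem extend_add (f g : V K k →ₗ[K] V K l) : extend K (f + g) = extend K f + extend K g := by
  rw [extend, LinearMap.add_comp, LinearMap.comp_add]
  rfl

theorem extend_smul (c : K) (f : V K k →ₗ[K] V K l) : extend K (c • f) = c • extend K f := by
  rw [extend, LinearMap.smul_comp, LinearMap.comp_smul]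
  rfl

theorem extend_sub (f g : V K k →ₗ[K] V K l) : extend K (f - g) = extend K f - extend K g := by
  rw [sub_eq_add_neg f, extend_add, ← neg_one_smul K g, extend_smul, sub_eq_add_neg]
  rfl

theorem extend_zero : extend K (0 : V K k →ₗ[K] V K l) = 0 := by
  rw [extend, LinearMap.zero_comp, LinearMap.comp_zero]

end Extend

/-! ### Independence of the relations from the field of scalars -/

section ChangeOfScalars

variable {F K : Type} [Field F] [Field K] [Algebra F K] {B : Type} [NonUnitalRing B] [Module F B]
  [Module K B] [IsScalarTower F K B] (g : DyckFamily B)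

theorem DyckFamily.Rel.algebraMap {u : F} {x y : B} (h : g.Rel u x y) :
    g.Rel (algebraMap F K u) x y := by
  induction h with
  | quadratic k i h₁ h₂ =>
    rw [← algebraMap_smul K u (g.e k)]
    exact .quadratic k i h₁ h₂
  | braid k i h₁ h₂ => exact .braid k i h₁ h₂
  | far k i j hi₁ hi₂ hj₁ hj₂ hij => exact .far k i j hi₁ hi₂ hj₁ hj₂ hij
  | dm_dm_T k => exact .dm_dm_T k
  | T_dm k i h₁ h₂ => exact .T_dm k i h₁ h₂
  | T_dp_dp k => exact .T_dp_dp k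
  | dp_T k i h₁ h₂ => exact .dp_T k i h₁ h₂
  | dm_comm_T k hk =>
    rw [← algebraMap_smul K u]
    exact .dm_comm_T k hk
  | T_comm_dp k hk =>
    rw [← algebraMap_smul K u]
    exact .T_comm_dp k hk

theorem DyckFamily.Tinv_algebraMap (u : F) (k i : ℕ) :
    g.Tinv (algebraMap F K u) k i = g.Tinv u k i := by
  rw [DyckFamily.Tinv, DyckFamily.Tinv, ← map_inv₀, algebraMap_smul, ← map_one (algebraMap F K),
    ← map_sub, algebraMap_smul]

theorem DyckFamily.y_algebraMap (u : F) (k i : ℕ) :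
    g.y (algebraMap F K u) k i = g.y u k i := by
  induction i with
  | zero => rfl
  | succ i ih =>
    cases i with
    | zero =>
      rw [DyckFamily.y, DyckFamily.y, ← map_one (algebraMap F K), ← map_sub, ← map_pow, ← map_mul,
        ← map_inv₀, algebraMap_smul]
    | succ i => rw [DyckFamily.y, DyckFamily.y, ih, DyckFamily.Tinv_algebraMap, algebraMap_smul]

end ChangeOfScalars

/-! ### Verification of the defining relations on V_* -/

section Families

variable {K : Type} [Field K] [CharZero K] (q t : K)

theorem firstOps_isQuiverRep : (firstOps q).IsQuiverRep where
  e_mul_e _ := extend_mul_extend _ _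
  e_mul_e_of_ne _ _ h := extend_mul_extend_of_ne h.symm _ _
  e_mul_T _ _ := extend_mul_extend _ _
  T_mul_e _ _ := extend_mul_extend _ _
  e_mul_dm _ := extend_mul_extend _ _
  dm_mul_e _ := extend_mul_extend _ _
  e_mul_dp _ := extend_mul_extend _ _
  dp_mul_e _ := extend_mul_extend _ _

theorem secondOps_isQuiverRep : (secondOps q t).IsQuiverRep where
  e_mul_e _ := extend_mul_extend _ _
  e_mul_e_of_ne _ _ h := extend_mul_extend_of_ne h.symm _ _
  e_mul_T _ _ := extend_mul_extend _ _
  T_mul_e _ _ := extend_mul_extend _ _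
  e_mul_dm _ := extend_mul_extend _ _
  dm_mul_e _ := extend_mul_extend _ _
  e_mul_dp _ := extend_mul_extend _ _
  dp_mul_e _ := extend_mul_extend _ _

theorem firstOps_comm (m : ℕ) : (firstOps q).comm (m + 1) = extend K (firstComm q m) := by
  refine (congrArg₂ (· - ·) (extend_mul_extend (opDp q m) (opDm q m))
    (extend_mul_extend (opDm q (m + 1)) (opDp q (m + 1)))).trans (extend_sub _ _).symm

theorem secondOps_comm (m : ℕ) : (secondOps q t).comm (m + 1) = extend K (secondComm q t m) := by
  refine (congrArg₂ (· - ·) (extend_mul_extend (opDpStar q t m) (opDm q m))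
    (extend_mul_extend (opDm q (m + 1)) (opDpStar q t (m + 1)))).trans (extend_sub _ _).symm

theorem firstOps_rel {x y : Module.End K (VStar K)} (h : (firstOps q).Rel q x y) : x = y := by
  induction h with
  | quadratic k i h₁ h₂ =>
    simp only [firstOps]
    rw [← extend_smul, ← extend_add, ← extend_sub, extend_mul_extend, ← extend_zero]
    refine congrArg _ (LinearMap.ext fun F => ?_)
    have := opT_quadratic q h₁ h₂ F
    simp only [LinearMap.comp_apply, LinearMap.sub_apply, LinearMap.add_apply, map_add, map_smul,
      LinearMap.smul_apply, LinearMap.id_apply, this, LinearMap.zero_apply]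
    simp only [Algebra.smul_def]
    ring
  | braid k i h₁ h₂ =>
    simp only [firstOps, extend_mul_extend]
    exact congrArg _ (LinearMap.ext fun F => opT_braid q h₁ h₂ F)
  | far k i j hi₁ hi₂ hj₁ hj₂ hij =>
    simp only [firstOps, extend_mul_extend]
    exact congrArg _ (LinearMap.ext fun F => opT_far q hi₁ hi₂ hj₁ hj₂ hij F)
  | dm_dm_T k =>
    simp only [firstOps, extend_mul_extend]
    exact congrArg _ (LinearMap.ext fun F => opDm_opDm_opT q F)
  | T_dm k i h₁ h₂ =>
    simp only [firstOps, extend_mul_extend]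
    exact congrArg _ (LinearMap.ext fun F => (opDm_opT q h₁ h₂ F).symm)
  | T_dp_dp k =>
    simp only [firstOps, extend_mul_extend]
    exact congrArg _ (LinearMap.ext fun F => opT_opDp_opDp q k F)
  | dp_T k i h₁ h₂ =>
    simp only [firstOps, extend_mul_extend]
    exact congrArg _ (LinearMap.ext fun F => opDp_opT q h₁ h₂ F)
  | dm_comm_T k hk =>
    obtain ⟨m, rfl⟩ := Nat.exists_eq_add_of_le' hk
    rw [firstOps_comm, show m + 2 - 1 = m + 1 from rfl, firstOps_comm]
    simp only [firstOps, extend_mul_extend, ← extend_smul]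
    exact congrArg _ (LinearMap.ext fun F => opDm_firstComm_opT q F)
  | T_comm_dp k hk =>
    obtain ⟨m, rfl⟩ := Nat.exists_eq_add_of_le' hk
    rw [firstOps_comm, firstOps_comm]
    simp only [firstOps, extend_mul_extend, ← extend_smul]
    exact congrArg _ (LinearMap.ext fun F => opT_firstComm_opDp q F)

variable {q t}

/-- The identities above involve T_i rather than T_i⁻¹. Evaluating at T_i⁻¹F, or applying T_i⁻¹ to
both sides, converts them, and the factor q becomes the parameter q⁻¹. -/
theorem secondOps_rel (hq : q ≠ 0) (ht : t ≠ 0) {x y : Module.End K (VStar K)}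
    (h : (secondOps q t).Rel q⁻¹ x y) : x = y := by
  induction h with
  | quadratic k i h₁ h₂ =>
    simp only [secondOps]
    rw [← extend_smul, ← extend_add, ← extend_sub, extend_mul_extend, ← extend_zero]
    refine congrArg _ (LinearMap.ext fun F => ?_)
    have h := opT_quadratic q h₁ h₂ (Ring.inverse (opT q k i) (Ring.inverse (opT q k i) F))
    simp only [opT_inverse_apply hq h₁ h₂] at h
    simp only [LinearMap.comp_apply, LinearMap.sub_apply, LinearMap.add_apply, map_add, map_smul,
      LinearMap.smul_apply, LinearMap.id_apply, LinearMap.zero_apply]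
    apply (smul_eq_zero_iff_right hq).mp
    simp only [smul_add, smul_sub, smul_inv_smul₀ hq]
    simp only [Algebra.smul_def]
    linear_combination -h
  | braid k i h₁ h₂ =>
    simp only [secondOps, extend_mul_extend]
    refine congrArg _ ?_
    obtain ⟨a, ha⟩ := isUnit_opT (q := q) (k := k) hq h₁ (by omega)
    obtain ⟨b, hb⟩ := isUnit_opT (q := q) (k := k) (i := i + 1) hq (by omega) h₂
    have h : a * b * a = b * a * b := Units.ext (by
      rw [Units.val_mul, Units.val_mul, Units.val_mul, Units.val_mul, ha, hb]
      exact LinearMap.ext fun F => opT_braid q h₁ h₂ F)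
    rw [← ha, ← hb, Ring.inverse_unit, Ring.inverse_unit]
    have h' := congrArg (fun c => ((c⁻¹ : (Module.End K (V K k))ˣ) : Module.End K (V K k))) h
    simp only [mul_inv_rev, Units.val_mul] at h'
    exact h'
  | far k i j hi₁ hi₂ hj₁ hj₂ hij =>
    simp only [secondOps, extend_mul_extend]
    refine congrArg _ ?_
    have h : Commute (opT q k i) (opT q k j) :=
      LinearMap.ext fun F => opT_far q hi₁ hi₂ hj₁ hj₂ hij F
    exact h.ringInverse_ringInverse
  | dm_dm_T k =>
    simp only [secondOps, extend_mul_extend]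
    refine congrArg _ (LinearMap.ext fun F => ?_)
    have h := opDm_opDm_opT q (Ring.inverse (opT q (k + 2) (k + 1)) F)
    rw [opT_inverse_apply hq (by omega) (by omega)] at h
    exact h.symm
  | T_dm k i h₁ h₂ =>
    simp only [secondOps, extend_mul_extend]
    exact congrArg _ (LinearMap.ext fun F => opDm_inverse_opT hq h₁ h₂ F)
  | T_dp_dp k =>
    simp only [secondOps, extend_mul_extend]
    refine congrArg _ (LinearMap.ext fun F => ?_)
    have h := LinearMap.congr_arg (f := Ring.inverse (opT q (k + 2) 1)) (opT_one_starHom_starHom q t F)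
    rw [inverse_opT_apply hq le_rfl (by omega)] at h
    exact h.symm
  | dp_T k i h₁ h₂ =>
    simp only [secondOps, extend_mul_extend]
    exact congrArg _ (LinearMap.ext fun F => starHom_inverse_opT hq t h₁ h₂ F)
  | dm_comm_T k hk =>
    obtain ⟨m, rfl⟩ := Nat.exists_eq_add_of_le' hk
    rw [secondOps_comm, show m + 2 - 1 = m + 1 from rfl, secondOps_comm]
    simp only [secondOps, extend_mul_extend, ← extend_smul]
    refine congrArg _ (LinearMap.ext fun F => ?_)
    have h := opDm_secondComm q t hq (Ring.inverse (opT q (m + 2) (m + 1)) F)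
    rw [opT_inverse_apply hq (by omega) (by omega)] at h
    rw [LinearMap.smul_apply, eq_inv_smul_iff₀ hq]
    exact h
  | T_comm_dp k hk =>
    obtain ⟨m, rfl⟩ := Nat.exists_eq_add_of_le' hk
    rw [secondOps_comm, secondOps_comm]
    simp only [secondOps, extend_mul_extend, ← extend_smul]
    refine congrArg _ (LinearMap.ext fun F => ?_)
    have h := LinearMap.congr_arg (f := Ring.inverse (opT q (m + 2) 1))
      (opT_starHom_secondComm q t ht F)
    rw [inverse_opT_apply hq le_rfl (by omega), map_smul] at h
    rw [LinearMap.smul_apply, eq_inv_smul_iff₀ hq]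
    exact h.symm

end Families

/-! ### Identification of the elements y_i and z_i -/

section Multiplication

variable {K : Type} [Field K]

theorem opY_apply {k i : ℕ} (h : i < k) (F : V K k) :
    opY k (i + 1) F = MvPolynomial.X ⟨i, h⟩ * F :=
  LinearMap.congr_fun (dif_pos ⟨by omega, h⟩) F

theorem firstComm_descOpT [CharZero K] (q : K) (m : ℕ) (F : V K (m + 1)) :
    firstComm q m (descOpT q (m + 1) m F)
      = (q ^ m * (q - 1)) • (MvPolynomial.X ⟨0, m.succ_pos⟩ * F) := by
  have h : ascT q (m + 1) m (MvPolynomial.X (Fin.last m) * descOpT q (m + 1) m F)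
      = algebraMap K _ (q ^ m) * (MvPolynomial.X ⟨0, m.succ_pos⟩ * F) :=
    ascT_X_mul_descOpT q m.lt_succ_self F
  rw [firstComm_apply, ascT_algebraMap_mul, h, Algebra.smul_def, map_mul (algebraMap K _)]
  ring

end Multiplication

section Families

variable {K : Type} [Field K] [CharZero K] (q t : K)

theorem firstOps_descT (k j : ℕ) : (firstOps q).descT k j = extend K (descOpT q k j) := by
  induction j with
  | zero => rfl
  | succ j ih => rw [DyckFamily.descT, ih, firstOps, extend_mul_extend]; rfl

theorem secondOps_descT (k j : ℕ) : (secondOps q t).descT k j = extend K (descInv q k j) := by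
  induction j with
  | zero => rfl
  | succ j ih => rw [DyckFamily.descT, ih, secondOps, extend_mul_extend]; rfl

variable {q}

theorem firstOps_Tinv (hq : q ≠ 0) {k i : ℕ} (h₁ : 1 ≤ i) (h₂ : i < k) :
    (firstOps q).Tinv q k i = extend K (Ring.inverse (opT q k i)) := by
  rw [inverse_opT hq h₁ h₂, DyckFamily.Tinv, extend_smul, extend_add, extend_smul]
  rfl

theorem secondOps_Tinv (hq : q ≠ 0) {k i : ℕ} (h₁ : 1 ≤ i) (h₂ : i < k) :
    (secondOps q t).Tinv q⁻¹ k i = extend K (opT q k i) := by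
  have h : opT q k i = q⁻¹⁻¹ • (Ring.inverse (opT q k i) + (q⁻¹ - 1) • 1) := by
    rw [inverse_opT hq h₁ h₂, inv_inv, smul_add, smul_inv_smul₀ hq, smul_smul, mul_sub,
      mul_inv_cancel₀ hq]
    module
  rw [h, extend_smul, extend_add, extend_smul]
  rfl

/-- The explicit commutator settles y_1, where q must differ from 0 and 1 for the normalisation; the
recursion is T_i y_{i+1} T_i = q y_i solved for y_{i+1}. -/
theorem firstOps_y (hq : q ≠ 0) (hq1 : q ≠ 1) {k i : ℕ} (h : i < k) :
    (firstOps q).y q k (i + 1) = extend K (opY k (i + 1)) := by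
  induction i with
  | zero =>
    obtain ⟨m, rfl⟩ := Nat.exists_eq_add_of_le' h
    rw [DyckFamily.y, firstOps_comm, firstOps_descT, extend_mul_extend, ← extend_smul]
    refine congrArg _ (LinearMap.ext fun F => ?_)
    rw [LinearMap.smul_apply, opY_apply h]
    exact (inv_smul_eq_iff₀ (mul_ne_zero (pow_ne_zero m hq) (sub_ne_zero.mpr hq1))).mpr
      (firstComm_descOpT q m F)
  | succ i ih =>
    rw [DyckFamily.y, ih (by omega), firstOps_Tinv hq (by omega) h, extend_mul_extend,
      extend_mul_extend, ← extend_smul]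
    refine congrArg _ (LinearMap.ext fun F => ?_)
    rw [LinearMap.smul_apply, LinearMap.comp_apply, LinearMap.comp_apply, opY_apply h,
      opY_apply (by omega), ← map_smul, Algebra.smul_def, ← opT_X_mul_opT q h,
      inverse_opT_apply hq (by omega) h, opT_inverse_apply hq (by omega) h]

theorem secondOps_y (hq : q ≠ 0) {m i : ℕ} (h : i ≤ m) :
    (secondOps q t).y q⁻¹ (m + 1) (i + 1) = extend K (opZ q t m i) := by
  induction i with
  | zero =>
    rw [DyckFamily.y, secondOps_comm, secondOps_descT, extend_mul_extend, ← extend_smul]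
    rfl
  | succ i ih =>
    rw [DyckFamily.y, ih (by omega), secondOps_Tinv t hq (by omega) (by omega), extend_mul_extend,
      extend_mul_extend, ← extend_smul]
    rfl

theorem firstOps_dp_mul_z (hq : q ≠ 0) {k i : ℕ} (h₁ : 1 ≤ i) (h₂ : i ≤ k) :
    (firstOps q).dp k * (secondOps q t).y q⁻¹ k i
      = (secondOps q t).y q⁻¹ (k + 1) (i + 1) * (firstOps q).dp k := by
  obtain ⟨i, rfl⟩ := Nat.exists_eq_add_of_le' h₁
  obtain ⟨m, rfl⟩ := Nat.exists_eq_add_of_le' (h₁.trans h₂)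
  rw [secondOps_y t hq (by omega), secondOps_y t hq (by omega)]
  simp only [firstOps, extend_mul_extend]
  exact congrArg _ (LinearMap.ext fun F => opDp_opZ t hq (by omega) F)

theorem secondOps_dp_mul_y (hq : q ≠ 0) (hq1 : q ≠ 1) {k i : ℕ} (h₁ : 1 ≤ i) (h₂ : i ≤ k) :
    (secondOps q t).dp k * (firstOps q).y q k i
      = (firstOps q).y q (k + 1) (i + 1) * (secondOps q t).dp k := by
  obtain ⟨i, rfl⟩ := Nat.exists_eq_add_of_le' h₁
  rw [firstOps_y hq hq1 (by omega), firstOps_y hq hq1 (by omega)]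
  simp only [secondOps, extend_mul_extend]
  refine congrArg _ (LinearMap.ext fun F => ?_)
  rw [LinearMap.comp_apply, LinearMap.comp_apply, opY_apply (by omega), opY_apply (by omega),
    opDpStar_apply, opDpStar_apply, map_mul, starHom_X]
  rfl

theorem secondOps_z_mul_dp (hq : q ≠ 0) (hq1 : q ≠ 1) (k : ℕ) :
    (secondOps q t).y q⁻¹ (k + 1) 1 * (firstOps q).dp k
      = -(t * q ^ (k + 1)) • ((firstOps q).y q (k + 1) 1 * (secondOps q t).dp k) := by
  rw [secondOps_y t hq (by omega), firstOps_y hq hq1 (by omega)]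
  simp only [firstOps, secondOps, extend_mul_extend, ← extend_smul]
  refine congrArg _ (LinearMap.ext fun F => ?_)
  rw [LinearMap.comp_apply, LinearMap.smul_apply, LinearMap.comp_apply, opY_apply (by omega),
    opZ_zero_opDp t hq hq1]
  rfl

end Families

/-! ### The actions over the base fields -/

section Actions

variable {F : Type} [Field F] {K : Type} [Field K] [CharZero K] [Algebra F K] {u : F} {t : K}
  {ρ : DyckAlg F u →ₙₐ[F] Module.End K (VStar K)}
  {ρ' : DyckAlg F u⁻¹ →ₙₐ[F] Module.End K (VStar K)}

theorem map_y_eq_opY (hu : u ≠ 0) (hu1 : u ≠ 1)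
    (hρ : (dyckGen F u).MapsTo ρ (firstOps (algebraMap F K u))) {k i : ℕ} (h₁ : 1 ≤ i)
    (h₂ : i ≤ k) : ρ ((dyckGen F u).y u k i) = extend K (opY k i) := by
  obtain ⟨i, rfl⟩ := Nat.exists_eq_add_of_le' h₁
  rw [hρ.y u k _ h₁ h₂, ← DyckFamily.y_algebraMap (K := K)]
  exact firstOps_y ((map_ne_zero _).mpr hu) (fun h => hu1 (by
    rwa [← map_one (algebraMap F K), (algebraMap F K).injective.eq_iff] at h)) h₂

theorem correctlyIntertwined (hu : u ≠ 0) (hu1 : u ≠ 1)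
    (hρ : (dyckGen F u).MapsTo ρ (firstOps (algebraMap F K u)))
    (hρ' : (dyckGen F u⁻¹).MapsTo ρ' (secondOps (algebraMap F K u) t)) :
    CorrectlyIntertwined u t ρ ρ' := by
  have hq : algebraMap F K u ≠ 0 := (map_ne_zero _).mpr hu
  have hq1 : algebraMap F K u ≠ 1 := fun h => hu1 (by
    rwa [← map_one (algebraMap F K), (algebraMap F K).injective.eq_iff] at h)
  have hy : ∀ k i, 1 ≤ i → i ≤ k → ρ ((dyckGen F u).y u k i)
      = (firstOps (algebraMap F K u)).y (algebraMap F K u) k i := fun k i h₁ h₂ => by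
    rw [hρ.y u k i h₁ h₂, DyckFamily.y_algebraMap]
  have hz : ∀ k i, 1 ≤ i → i ≤ k → ρ' ((dyckGen F u⁻¹).y u⁻¹ k i)
      = (secondOps (algebraMap F K u) t).y (algebraMap F K u)⁻¹ k i := fun k i h₁ h₂ => by
    rw [hρ'.y u⁻¹ k i h₁ h₂, ← map_inv₀, DyckFamily.y_algebraMap]
  constructor
  · intro k i h₁ h₂
    rw [hρ.2.1 k i h₁ h₂, hρ'.2.1 k i h₁ h₂, hρ.1]
    exact (extend_mul_extend _ _).trans
      (congrArg _ (Ring.mul_inverse_cancel _ (isUnit_opT hq h₁ h₂)))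
  · intro k i h₁ h₂
    rw [hρ.2.1 k i h₁ h₂, hρ'.2.1 k i h₁ h₂, hρ.1]
    exact (extend_mul_extend _ _).trans
      (congrArg _ (Ring.inverse_mul_cancel _ (isUnit_opT hq h₁ h₂)))
  · intro k
    rw [hρ.2.2.1, hρ'.2.2.1]
    rfl
  · intro k i h₁ h₂
    rw [hρ.2.2.2, hz k i h₁ h₂, hz (k + 1) (i + 1) (by omega) (by omega)]
    exact firstOps_dp_mul_z t hq h₁ h₂
  · intro k i h₁ h₂
    rw [hρ'.2.2.2, hy k i h₁ h₂, hy (k + 1) (i + 1) (by omega) (by omega)]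
    exact secondOps_dp_mul_y t hq hq1 h₁ h₂
  · intro k
    rw [hρ.2.2.2, hρ'.2.2.2, hz (k + 1) 1 le_rfl (by omega), hy (k + 1) 1 le_rfl (by omega)]
    exact secondOps_z_mul_dp t hq hq1 k

theorem existsUnique_firstAction (u : F) :
    ∃! ρ : DyckAlg F u →ₙₐ[F] Module.End K (VStar K),
      (dyckGen F u).MapsTo ρ (firstOps (algebraMap F K u)) :=
  existsUnique_dyckAlg_hom _ _ (firstOps_isQuiverRep _)
    fun _ _ h => firstOps_rel _ (h.algebraMap (K := K))

theorem existsUnique_secondAction (hu : u ≠ 0) (ht : t ≠ 0) :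
    ∃! ρ' : DyckAlg F u⁻¹ →ₙₐ[F] Module.End K (VStar K),
      (dyckGen F u⁻¹).MapsTo ρ' (secondOps (algebraMap F K u) t) := by
  refine existsUnique_dyckAlg_hom _ _ (secondOps_isQuiverRep _ _)
    fun x y h => secondOps_rel ((map_ne_zero (algebraMap F K)).mpr hu) ht ?_
  have h' := h.algebraMap (K := K)
  rwa [map_inv₀] at h'

theorem existsUnique_doubleAction {q : K} (hq : q ≠ 0) (hq1 : q ≠ 1) (ht : t ≠ 0) :
    ∃! σ : DoubleDyckAlg K q t →ₙₐ[K] Module.End K (VStar K),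
      (doubleGen K q t).MapsTo σ (firstOps q) ∧
      ∀ k : ℕ, σ (doubleGenStar K q t k) = (secondOps q t).dp k :=
  existsUnique_doubleDyckAlg_hom q t (firstOps q) (secondOps q t)
    (firstOps_isQuiverRep _) rfl rfl (secondOps_isQuiverRep _ _)
    (fun _ _ h₁ h₂ => firstOps_Tinv hq h₁ h₂)
    (fun _ _ h => firstOps_rel _ h) (fun _ _ h => secondOps_rel hq ht h)
    (fun _ _ h₁ h₂ => firstOps_dp_mul_z t hq h₁ h₂)
    (fun _ _ h₁ h₂ => secondOps_dp_mul_y t hq hq1 h₁ h₂)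
    (fun k => secondOps_z_mul_dp t hq hq1 k)

end Actions

theorem qElt_ne_one : qElt ≠ 1 := by
  intro h
  have h' : algebraMap (Polynomial ℚ) (RatFunc ℚ) Polynomial.X
      = algebraMap (Polynomial ℚ) (RatFunc ℚ) 1 := by rw [RatFunc.algebraMap_X, map_one]; exact h
  exact Polynomial.X_ne_C 1 (RatFunc.algebraMap_injective ℚ h')

end DyckAlgebra

end

theorem mainTheorem10 :
    (∀ k i : ℕ, 1 ≤ i → i < k → IsUnit (opT qElt' k i)) ∧
    (∃! ρ : DyckAlg Qq qElt →ₙₐ[Qq] Module.End Qqt (VStar Qqt),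
      (dyckGen Qq qElt).MapsTo ρ (firstOps qElt')) ∧
    (∃! ρ' : DyckAlg Qq qElt⁻¹ →ₙₐ[Qq] Module.End Qqt (VStar Qqt),
      (dyckGen Qq qElt⁻¹).MapsTo ρ' (secondOps qElt' tElt)) ∧
    (∀ (ρ : DyckAlg Qq qElt →ₙₐ[Qq] Module.End Qqt (VStar Qqt))
      (ρ' : DyckAlg Qq qElt⁻¹ →ₙₐ[Qq] Module.End Qqt (VStar Qqt)),
      (dyckGen Qq qElt).MapsTo ρ (firstOps qElt') →
      (dyckGen Qq qElt⁻¹).MapsTo ρ' (secondOps qElt' tElt) →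
      (∀ k i : ℕ, 1 ≤ i → i ≤ k →
        ρ ((dyckGen Qq qElt).y qElt k i) = extend Qqt (opY k i)) ∧
      CorrectlyIntertwined qElt tElt ρ ρ') ∧
    (∃! σ : DoubleDyckAlg Qqt qElt' tElt →ₙₐ[Qqt] Module.End Qqt (VStar Qqt),
      (doubleGen Qqt qElt' tElt).MapsTo σ (firstOps qElt') ∧
      ∀ k : ℕ, σ (doubleGenStar Qqt qElt' tElt k) = (secondOps qElt' tElt).dp k) := by
  have hu : qElt ≠ 0 := RatFunc.X_ne_zero
  have hq : qElt' ≠ 0 := (map_ne_zero _).mpr hu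
  have hq1 : qElt' ≠ 1 := fun h => qElt_ne_one ((algebraMap Qq Qqt).injective (by
    rw [map_one]; exact h))
  have ht : tElt ≠ 0 := RatFunc.X_ne_zero
  exact ⟨fun k i h₁ h₂ => isUnit_opT hq h₁ h₂, existsUnique_firstAction qElt,
    existsUnique_secondAction hu ht, fun ρ ρ' hρ hρ' =>
      ⟨fun k i h₁ h₂ => map_y_eq_opY hu qElt_ne_one hρ h₁ h₂,
        correctlyIntertwined hu qElt_ne_one hρ hρ'⟩, existsUnique_doubleAction hq hq1 ht⟩
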